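/- Let $d\ge 2$, $d_S\ge 2$, $N\ge 1$, $\eta_S,\eta_E>0$. For $n\ge1$, $\eta>0$ let $\mathrm{GUE}(n,\eta)$ be the law of the Hermitian matrix $U\,\mathrm{diag}(\lambda)\,U^\dagger$, where $U\in U(n)$ is Haar distributed, independent of $\lambda\in\mathbb R^n$ with density $\propto e^{-\frac{\eta}{2}\sum_i\lambda_i^2}\prod_{i<j}(\lambda_i-\lambda_j)^2$. Let $\mu$ be either the Hilbert–Schmidt or the Bures measure on $d\times d$ density matrices, that is, the law of $V\,\mathrm{diag}(x)\,V^\dagger$ with $V\in U(d)$ Haar distributed, independent of $x$ in the open probability simplex with density $\propto w(x)\,\delta(1-\sum_i x_i)$, where $w(x)=\prod_{i<j}(x_i-x_j)^2$ (Hilbert–Schmidt) or $w(x)=(x_1\cdots x_d)^{-1/2}\prod_{i<j}\frac{(x_i-x_j)^2}{x_i+x_j}$ (Bures). Let $A\sim\mathrm{GUE}(d_S,\eta_S)$ with (labelled, unordered) eigenvalues $a_1,\dots,a_{d_S}$, let $B_1,\dots,B_N\sim\mathrm{GUE}(d,\eta_E)$ and $\rho_{01},\dots,\rho_{0N}\sim\mu$,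 all independent. Fix $i\ne j$, write $a=a_i$, $a'=a_j$, and put $\rho_{ak}(t)=e^{-iaB_kt}\rho_{0k}e^{iaB_kt}$, $$\Gamma^{(N)}(t)=\prod_{k=1}^{N}\bigl|\mathrm{tr}\,[e^{-i(a-a')B_kt}\rho_{0k}]\bigr|^2,\qquad G^{(N)}(t)=\prod_{k=1}^{N}G\bigl(\rho_{ak}(t),\rho_{a'k}(t)\bigr),$$ with the super-fidelity $G(\rho,\sigma)=\mathrm{tr}(\rho\sigma)+\sqrt{(1-\mathrm{tr}\rho^2)(1-\mathrm{tr}\sigma^2)}$. So $\Gamma^{(N_{uno})}$ is the collective decoherence factor of $N_{uno}$ unobserved apparatuses and $G^{(N_{mac})}$ is the super-fidelity bound of a macrofraction of $N_{mac}$ apparatuses. Let $\langle\langle\cdot\rangle\rangle$ be the expectation over $A$, all $B_k$ and all $\rho_{0k}$, let $P=\int \mathrm{tr}\rho^2\,d\mu(\rho)$ and $g=(\eta_S\eta_E)^{-1/2}$, and take as units of time $$\tau_{dec}=[8g^2Nd_S(d-P)]^{-1/2},\qquad \tau_{fid}=[8g^2Nd_S(dP-1)]^{-1/2}.$$ Below,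 "for $t\gg\tau$" means: for all $\eta_S,\eta_E>0$ and all $t\ge s\tau$, where $s>0$ does not depend on $t,\eta_S,\eta_E$, but may depend on everything else. (The $\tau$'s are natural units coming from a short-time heuristic; it is not claimed that $s$ is of order one.) Then $\Gamma^{(N)}(t)$ and $G^{(N)}(t)$ are integrable, and: 1. For every $\varepsilon>0$, $$\Bigl|\langle\langle\Gamma^{(N)}(t)\rangle\rangle-\Bigl(\tfrac{1+P}{d+1}\Bigr)^{N}\Bigr|\le\varepsilon\ \text{ for } t\gg\tau_{dec},\qquad \Bigl|\langle\langle G^{(N)}(t)\rangle\rangle-\Bigl(1-P+\tfrac{1+P}{d+1}\Bigr)^{N}\Bigr|\le\varepsilon\ \text{ for } t\gg\tau_{fid}.$$ 2. For every $K$ there is a constant $C$, independent of $d,d_S,N,i,j$ (and of $\eta_S,\eta_E,t$), such that $$0\le\langle\langle\Gamma^{(N)}(t)\rangle\rangle\le C\,e^{-N\log d}\ \text{ for } t\gg\tau_{dec},\ \text{if } N\le Kd,$$ $$0\le\langle\langle G^{(N)}(t)\rangle\rangle\le C\,e^{-N/d}\ \text{ for } t\gg\tau_{fid},\ \text{if }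 N\le Kd^2.$$ 3. There is an absolute constant $C$ such that, for all $d,d_S,N,i\neq j$, $$0\le\langle\langle\Gamma^{(N)}(t)\rangle\rangle\le e^{-N(\log d-C/d)}\ \text{ for } t\gg\tau_{dec},\qquad 0\le\langle\langle G^{(N)}(t)\rangle\rangle\le e^{-N(1/d-C/d^2)}\ \text{ for } t\gg\tau_{fid}.$$ 4. There is an absolute constant $c>0$ such that, for all $d,d_S,N,i\neq j$, $$0\le\langle\langle\Gamma^{(N)}(t)\rangle\rangle\le e^{-cN\log d}\ \text{ for } t\gg\tau_{dec},\qquad 0\le\langle\langle G^{(N)}(t)\rangle\rangle\le e^{-cN/d}\ \text{ for } t\gg\tau_{fid}.$$ -/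

import Mathlib

open MeasureTheory Filter Topology

noncomputable section

namespace Measurement

/-! ### Matrices and the Haar measure on the unitary group -/

/-- Complex `n × n` matrices. -/
abbrev Mat (n : ℕ) : Type := Matrix (Fin n) (Fin n) ℂ

/-- The unitary group `U(n)`. -/
abbrev UMat (n : ℕ) : Type := Matrix.unitaryGroup (Fin n) ℂ

/-- The Borel structure of the space of matrices (the product structure of the entries). -/
instance instMeasurableSpaceMat (n : ℕ) : MeasurableSpace (Mat n) :=
  inferInstanceAs (MeasurableSpace (Fin n → Fin n → ℂ))

instance instBorelSpaceMat (n : ℕ) : BorelSpace (Mat n) :=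
  inferInstanceAs (BorelSpace (Fin n → Fin n → ℂ))

instance instMeasurableSpaceUMat (n : ℕ) : MeasurableSpace (UMat n) :=
  inferInstanceAs (MeasurableSpace {U : Mat n // U ∈ Matrix.unitaryGroup (Fin n) ℂ})

instance instBorelSpaceUMat (n : ℕ) : BorelSpace (UMat n) :=
  inferInstanceAs (BorelSpace {U : Mat n // U ∈ Matrix.unitaryGroup (Fin n) ℂ})

theorem isCompact_unitaryGroup (n : ℕ) :
    IsCompact (Matrix.unitaryGroup (Fin n) ℂ : Set (Mat n)) := by
  have h1 : IsCompact (Set.pi Set.univ fun _ : Fin n => Set.pi Set.univ fun _ : Fin n =>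
      Metric.closedBall (0 : ℂ) 1) :=
    isCompact_univ_pi fun _ => isCompact_univ_pi fun _ => isCompact_closedBall 0 1
  refine IsCompact.of_isClosed_subset (s := (show Set (Mat n) from
    Set.pi Set.univ fun _ : Fin n => Set.pi Set.univ fun _ : Fin n =>
      Metric.closedBall (0 : ℂ) 1)) h1 ?_ ?_
  · have h2 : (Matrix.unitaryGroup (Fin n) ℂ : Set (Mat n)) = {A : Mat n | star A * A = 1} := by
      ext A
      exact Matrix.mem_unitaryGroup_iff'
    rw [h2]
    exact isClosed_eq (by fun_prop) continuous_const
  · intro A hA i _ j _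
    simpa using entry_norm_bound_of_unitary hA i j

instance instCompactSpaceUMat (n : ℕ) : CompactSpace (UMat n) :=
  isCompact_iff_compactSpace.mp (isCompact_unitaryGroup n)

/-- The Haar probability measure on `U(n)`. -/
def haarU (n : ℕ) : Measure (UMat n) := Measure.haarMeasure ⊤

/-- The measure `μ` rescaled to total mass one. -/
def normalized {α : Type*} [MeasurableSpace α] (μ : Measure α) : Measure α :=
  (μ Set.univ)⁻¹ • μ

/-- The Hermitian matrix `U diag(x) U†`. -/
def fromSpectral {n : ℕ} (s : (Fin n → ℝ) × UMat n) : Mat n :=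
  (s.2 : Mat n) * Matrix.diagonal (fun i => (s.1 i : ℂ)) * star (s.2 : Mat n)

/-- The squared Vandermonde determinant `∏_{i<j} (x_i - x_j)²`. -/
def vandermondeSq {n : ℕ} (x : Fin n → ℝ) : ℝ :=
  ∏ i, ∏ j ∈ Finset.Ioi i, (x i - x j) ^ 2

/-! ### The Gaussian Unitary Ensemble -/

/-- The joint law of the (unordered, labelled) GUE eigenvalues, with scale factor `η`:
`Z⁻¹ exp(-(η/2) ∑ x_i²) ∏_{i<j} (x_i - x_j)² dx`. -/
def gueLevels (n : ℕ) (η : ℝ) : Measure (Fin n → ℝ) :=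
  normalized (volume.withDensity fun x =>
    ENNReal.ofReal (Real.exp (-(η / 2) * ∑ i, x i ^ 2) * vandermondeSq x))

/-- GUE spectral data: the eigenvalues and an independent Haar-distributed eigenbasis. -/
def gueSpectral (n : ℕ) (η : ℝ) : Measure ((Fin n → ℝ) × UMat n) :=
  (gueLevels n η).prod (haarU n)

/-- The GUE law of the random Hermitian matrix `U diag(x) U†`. -/
def gue (n : ℕ) (η : ℝ) : Measure (Mat n) :=
  (gueSpectral n η).map fromSpectral

/-! ### The Hilbert–Schmidt and Bures measures on density matrices -/

/-- The two measures on mixed states. -/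
inductive StateMeasure : Type
  | hilbertSchmidt
  | bures

/-- The eigenvalue weight: `∏_{i<j} (x_i - x_j)²` for the Hilbert–Schmidt measure and
`(x_1 ⋯ x_n)^(-1/2) ∏_{i<j} (x_i - x_j)² / (x_i + x_j)` for the Bures measure. -/
def StateMeasure.weight {n : ℕ} : StateMeasure → (Fin n → ℝ) → ℝ
  | .hilbertSchmidt, x => vandermondeSq x
  | .bures, x => (∏ i, (√(x i))⁻¹) * ∏ i, ∏ j ∈ Finset.Ioi i, (x i - x j) ^ 2 / (x i + x j)

/-- The point of the hyperplane `∑ x_i = 1` in `ℝⁿ` (`n ≥ 1`) with the given first `n - 1`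
coordinates. -/
def simplexPoint (n : ℕ) (y : Fin (n - 1) → ℝ) : Fin n → ℝ :=
  fun i => if h : (i : ℕ) < n - 1 then y ⟨i, h⟩ else 1 - ∑ k, y k

/-- The law `∝ δ(1 - ∑ x_i) w(x) dx` on the open probability simplex of the (unordered, labelled)
eigenvalues of a random state; the `δ`-function is resolved by using the first `n - 1`
eigenvalues as coordinates. -/
def stateLevels (m : StateMeasure) (n : ℕ) : Measure (Fin n → ℝ) :=
  normalized (((volume.restrict {y | ∀ i, 0 < simplexPoint n y i}).withDensity fun y =>
    ENNReal.ofReal (m.weight (simplexPoint n y))).map (simplexPoint n))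

/-- The law of the random density matrix `V diag(x) V†` with Haar-distributed `V` independent
of the eigenvalues `x`. -/
def stateLaw (m : StateMeasure) (n : ℕ) : Measure (Mat n) :=
  ((stateLevels m n).prod (haarU n)).map fromSpectral

/-- The purity `tr ρ²`. -/
def purity {n : ℕ} (ρ : Mat n) : ℝ := (ρ * ρ).trace.re

/-- The mean purity `⟨tr ρ²⟩`. -/
def meanPurity (m : StateMeasure) (n : ℕ) : ℝ := ∫ ρ, purity ρ ∂(stateLaw m n)

/-! ### Dynamics, decoherence factor and super-fidelity -/

/-- The unitary `e^{-i s B}`. -/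
def evol {n : ℕ} (s : ℝ) (B : Mat n) : Mat n :=
  NormedSpace.exp ((-(Complex.I * (s : ℂ))) • B)

/-- The state `ρ_a(t) = e^{-i a B t} ρ₀ e^{i a B t}` of an apparatus with measuring observable `B`,
conditioned on the level `a` of the measured observable. -/
def condState {n : ℕ} (a t : ℝ) (B ρ : Mat n) : Mat n :=
  evol (a * t) B * ρ * evol (-(a * t)) B

/-- The super-fidelity `G(ρ, σ) = tr(ρσ) + √((1 - tr ρ²)(1 - tr σ²))`. -/
def superFidelity {n : ℕ} (ρ σ : Mat n) : ℝ :=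
  (ρ * σ).trace.re + √((1 - purity ρ) * (1 - purity σ))

/-- The collective decoherence factor `∏_k |tr(e^{-i(a-a')B_k t} ρ_{0k})|²` of `N` apparatuses;
`x k = (B_k, ρ_{0k})`. -/
def decoherenceFactor {d N : ℕ} (a a' t : ℝ) (x : Fin N → Mat d × Mat d) : ℝ :=
  ∏ k, ‖(evol ((a - a') * t) (x k).1 * (x k).2).trace‖ ^ 2

/-- The super-fidelity bound `∏_k G(ρ_{ak}(t), ρ_{a'k}(t))` of a macrofraction of `N` apparatuses;
`x k = (B_k, ρ_{0k})`. -/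
def macroSuperFidelity {d N : ℕ} (a a' t : ℝ) (x : Fin N → Mat d × Mat d) : ℝ :=
  ∏ k, superFidelity (condState a t (x k).1 (x k).2) (condState a' t (x k).1 (x k).2)

/-! ### Averages -/

/-- A configuration: the spectral data of the system observable `A = U diag(a) U†`, and the pairs
`(B_k, ρ_{0k})` of the `N` apparatuses. -/
abbrev Config (d dS N : ℕ) : Type :=
  ((Fin dS → ℝ) × UMat dS) × (Fin N → Mat d × Mat d)

/-- The law of the configuration: `A` is GUE with scale factor `ηS`, the `B_k` are i.i.d. GUE with
scale factor `ηE`, the `ρ_{0k}` are i.i.d. with the given measure on states, and all of these are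
independent. -/
def configLaw (m : StateMeasure) (d dS N : ℕ) (ηS ηE : ℝ) : Measure (Config d dS N) :=
  (gueSpectral dS ηS).prod (Measure.pi fun _ : Fin N => (gue d ηE).prod (stateLaw m d))

/-- The decoherence factor of the levels with labels `i`, `j` of `A`, as a random variable. -/
def decoherenceVar {d dS N : ℕ} (i j : Fin dS) (t : ℝ) (ω : Config d dS N) : ℝ :=
  decoherenceFactor (ω.1.1 i) (ω.1.1 j) t ω.2

/-- The super-fidelity bound for the levels with labels `i`, `j` of `A`, as a random variable. -/
def superFidelityVar {d dS N : ℕ} (i j : Fin dS) (t : ℝ) (ω : Config d dS N) : ℝ :=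
  macroSuperFidelity (ω.1.1 i) (ω.1.1 j) t ω.2

/-- The average `⟨⟨Γ^uno(t)⟩⟩`. -/
def avgDecoherence (m : StateMeasure) (d dS N : ℕ) (i j : Fin dS) (ηS ηE t : ℝ) : ℝ :=
  ∫ ω, decoherenceVar (d := d) (N := N) i j t ω ∂(configLaw m d dS N ηS ηE)

/-- The average `⟨⟨G^mac(t)⟩⟩`. -/
def avgSuperFidelity (m : StateMeasure) (d dS N : ℕ) (i j : Fin dS) (ηS ηE t : ℝ) : ℝ :=
  ∫ ω, superFidelityVar (d := d) (N := N) i j t ω ∂(configLaw m d dS N ηS ηE)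

/-- The decoherence time unit `[8 g² N d_S (d - ⟨tr ρ₀²⟩)]^(-1/2)`, `g² = 1 / (ηS ηE)`. -/
def tauDec (m : StateMeasure) (d dS N : ℕ) (ηS ηE : ℝ) : ℝ :=
  (√(8 * (ηS * ηE)⁻¹ * N * dS * (d - meanPurity m d)))⁻¹

/-- The super-fidelity time unit `[8 g² N d_S (d ⟨tr ρ₀²⟩ - 1)]^(-1/2)`, `g² = 1 / (ηS ηE)`. -/
def tauFid (m : StateMeasure) (d dS N : ℕ) (ηS ηE : ℝ) : ℝ :=
  (√(8 * (ηS * ηE)⁻¹ * N * dS * (d * meanPurity m d - 1)))⁻¹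

/-- The long-time value of the averaged single-apparatus decoherence factor. -/
def decoherenceFloor (m : StateMeasure) (d : ℕ) : ℝ :=
  (1 + meanPurity m d) / (d + 1)

/-- The long-time value of the averaged single-apparatus super-fidelity. -/
def superFidelityFloor (m : StateMeasure) (d : ℕ) : ℝ :=
  (1 - meanPurity m d) + (1 + meanPurity m d) / (d + 1)

/-- `F ηS ηE t → L` for `t ≫ τ ηS ηE`: for every `ε` there is a number `s` of time units `τ`
after which `F` stays within `ε` of `L`, whatever the scale factors. -/
def LongTimeLimit (F : ℝ → ℝ → ℝ → ℝ) (τ : ℝ → ℝ → ℝ) (L : ℝ) : Prop :=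
  ∀ ε > 0, ∃ s > 0, ∀ ηS > 0, ∀ ηE > 0, ∀ t ≥ s * τ ηS ηE, |F ηS ηE t - L| ≤ ε

/-- `0 ≤ F ηS ηE t ≤ M` for `t ≫ τ ηS ηE`: the bounds hold after some number `s` of time units
`τ`, whatever the scale factors. -/
def LongTimeBound (F : ℝ → ℝ → ℝ → ℝ) (τ : ℝ → ℝ → ℝ) (M : ℝ) : Prop :=
  ∃ s > 0, ∀ ηS > 0, ∀ ηE > 0, ∀ t ≥ s * τ ηS ηE, 0 ≤ F ηS ηE t ∧ F ηS ηE t ≤ M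

end Measurement

end

noncomputable section

namespace Measurement

/-! ### Haar measure on the unitary group -/

/-! Given the levels of `A`, the apparatuses are i.i.d., so each average is the mean over $(a,a')$
of the $N$-th power of a single-apparatus average $f(\varphi)$ at phase $\varphi=(a-a')t$. Rescaling
the GUE levels to $\eta=1$ leaves only the variable $t/\sqrt{\eta_S\eta_E}$, and both time units are
constant multiples of $\sqrt{\eta_S\eta_E}$; so a limit at infinity is automatically uniform in the
scale factors (`longTimeLimit_of_tendsto`).

Single apparatus: by unitary invariance the state may be taken diagonal with spectrum $x$. In the
eigenbasis $W$ of `B`, with levels $b$, decoherence factor and overlap are both sums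
$\sum_{k,l}e^{-i\varphi(b_k-b_l)}c_{kl}(W)$ with the same diagonal $c_{kk}=\rho_{kk}^2$. The levels
have a density, so the Riemann–Lebesgue lemma removes every term $k\ne l$ as $|\varphi|\to\infty$.
What stays is the Haar mean of $\sum_k\rho_{kk}^2$, equal to $(1+\sum x_i^2)/(n+1)$ by the fourth
moments of a column of a Haar unitary (`columnMoment_eq`). The super-fidelity adds the constant
$1-\sum x_i^2$, because conjugation preserves purity. Dominated convergence, first over $x$ and then
over $a\ne a'$, yields the two floors.

The explicit bounds need the mean purity $P$. It is controlled by a virial identity, the same for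
both measures: the field $x_px_q(x_p-x_q)(e_p-e_q)$ is tangent to the simplex, and its product with
the eigenvalue weight vanishes at the ends of the lines along $e_p-e_q$; hence its weighted
divergence integrates to zero (`setIntegral_pairDiv`). Summing over $p\ne q$ gives $P=2n/(n^2+1)$
for Hilbert–Schmidt, and for Bures an identity with one extra sum lying between $n$ and $2n$
(`meanSumSq_virial`). In both cases $2n\le(n^2+2)P\le 3n$ (`meanSumSq_bounds`), which places the
floors strictly below $e^{4/d}/d$ and $e^{-1/d+4/d^2}$. Strictness is what turns a limit into a
bound valid from some multiple of $\tau$ on. -/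

instance instSecondCountableTopologyMat (n : ℕ) : SecondCountableTopology (Mat n) :=
  inferInstanceAs (SecondCountableTopology (Fin n → Fin n → ℂ))

instance instSecondCountableTopologyUMat (n : ℕ) : SecondCountableTopology (UMat n) :=
  TopologicalSpace.Subtype.secondCountableTopology (Matrix.unitaryGroup (Fin n) ℂ : Set (Mat n))

instance instIsHaarMeasureHaarU (n : ℕ) : (haarU n).IsHaarMeasure := by
  unfold haarU; infer_instance

instance instIsProbabilityMeasureHaarU (n : ℕ) : IsProbabilityMeasure (haarU n) :=
  ⟨by simpa [haarU] using Measure.haarMeasure_self (K₀ := (⊤ : TopologicalSpace.PositiveCompacts (UMat n)))⟩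

theorem continuous_UMat_apply {n : ℕ} (a k : Fin n) : Continuous fun U : UMat n => (U : Mat n) a k :=
  continuous_subtype_val.matrix_elem a k

/-- Continuous functions on the unitary group are integrable. -/
theorem integrable_haarU {n : ℕ} {E : Type*} [NormedAddCommGroup E] {f : UMat n → E}
    (hf : Continuous f) : Integrable f (haarU n) :=
  hf.integrable_of_hasCompactSupport (HasCompactSupport.of_compactSpace f)

/-- The diagonal unitary matrix with entry `z` at `b` and `1` elsewhere. -/
def phaseUnitary {n : ℕ} (b : Fin n) (z : ℂ) (hz : ‖z‖ = 1) : UMat n :=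
  ⟨Matrix.diagonal (Function.update 1 b z), by
    rw [Matrix.mem_unitaryGroup_iff', Matrix.star_eq_conjTranspose, Matrix.diagonal_conjTranspose,
      Matrix.diagonal_mul_diagonal, ← Matrix.diagonal_one]
    congr 1
    ext i
    rcases eq_or_ne i b with rfl | hi
    · simp [← Complex.normSq_eq_conj_mul_self, Complex.normSq_eq_norm_sq, hz]
    · simp [hi]⟩

/-- The Householder reflection along `e_a + 2 e_b`. -/
def reflectUnitary {n : ℕ} (a b : Fin n) (hab : a ≠ b) : UMat n :=
  let v : Fin n → ℂ := Pi.single a 1 + Pi.single b 2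
  ⟨1 - (2 / 5 : ℂ) • Matrix.vecMulVec v v, by
    have hv : v ⬝ᵥ v = 5 := by
      simp [v, hab, hab.symm]
      norm_num
    have hs : star (1 - (2 / 5 : ℂ) • Matrix.vecMulVec v v) = 1 - (2 / 5 : ℂ) • Matrix.vecMulVec v v := by
      have h1 : star v = v := by
        ext i
        by_cases h1 : i = a <;> by_cases h2 : i = b <;> simp [v, h1, h2, hab, hab.symm]
      have h2 : star (2 / 5 : ℂ) = 2 / 5 := by simp
      rw [Matrix.star_eq_conjTranspose, Matrix.conjTranspose_sub, Matrix.conjTranspose_one,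
        Matrix.conjTranspose_smul, Matrix.conjTranspose_vecMulVec, h1, h2]
    rw [Matrix.mem_unitaryGroup_iff', hs]
    have : Matrix.vecMulVec v v * Matrix.vecMulVec v v = (5 : ℂ) • Matrix.vecMulVec v v := by
      rw [Matrix.vecMulVec_mul_vecMulVec, hv]
      ext i j; simp [Matrix.vecMulVec_apply]; try ring
    simp only [sub_mul, mul_sub, one_mul, mul_one, Matrix.smul_mul, Matrix.mul_smul, this, smul_smul]
    rw [sub_sub, sub_eq_self, ← sub_eq_zero]
    ext i j
    simp
    ring⟩

/-- The 3-4-5 triangle makes this rotation of two rows rational, so that Haar invariance yields a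
moment relation with integer coefficients. -/
theorem reflectUnitary_mul_phaseUnitary_mul_apply {n : ℕ} {a b : Fin n} (hab : a ≠ b) (z : ℂ)
    (hz : ‖z‖ = 1) (U : UMat n) (k : Fin n) :
    ((reflectUnitary a b hab * phaseUnitary b z hz * U : UMat n) : Mat n) a k =
      (3 * (U : Mat n) a k - 4 * (z * (U : Mat n) b k)) / 5 := by
  rw [mul_assoc]
  have h (i : Fin n) : (((phaseUnitary b z hz * U : UMat n)) : Mat n) i k =
      Function.update (1 : Fin n → ℂ) b z i * (U : Mat n) i k := by
    simp [phaseUnitary, Matrix.diagonal_mul]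
  have h2 : ((reflectUnitary a b hab * (phaseUnitary b z hz * U) : UMat n) : Mat n) a k
      = ∑ i, (reflectUnitary a b hab : Mat n) a i * ((phaseUnitary b z hz * U : UMat n) : Mat n) i k := by
    rw [← Matrix.mul_apply]; rfl
  rw [h2]
  simp only [h]
  have h3 (i : Fin n) : (reflectUnitary a b hab : Mat n) a i =
      (if i = a then (3 / 5 : ℂ) else 0) + (if i = b then (- 4 / 5 : ℂ) else 0) := by
    have : (reflectUnitary a b hab : Mat n) a i = (1 : Mat n) a i -
        (2 / 5 : ℂ) * ((Pi.single a 1 + Pi.single b 2 : Fin n → ℂ) a *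
          (Pi.single a 1 + Pi.single b 2 : Fin n → ℂ) i) := rfl
    rw [this]
    by_cases h1 : i = a
    · subst h1; simp [hab]; norm_num
    · by_cases h2 : i = b
      · subst h2; simp [hab, h1]; norm_num
      · simp [h1, h2, hab, Ne.symm h1]
  simp only [h3, add_mul, ite_mul, zero_mul, Finset.sum_add_distrib, Finset.sum_ite_eq',
    Finset.mem_univ, if_true]
  simp [hab]
  ring

/-- The fourth moments of the entries of a column of a Haar unitary. -/
def columnMoment {n : ℕ} (k a b : Fin n) : ℝ :=
  ∫ U : UMat n, Complex.normSq ((U : Mat n) a k) * Complex.normSq ((U : Mat n) b k) ∂(haarU n)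

theorem continuous_normSq_mul_normSq {n : ℕ} (k a b : Fin n) : Continuous fun U : UMat n =>
    Complex.normSq ((U : Mat n) a k) * Complex.normSq ((U : Mat n) b k) :=
  (Complex.continuous_normSq.comp (continuous_UMat_apply a k)).mul
    (Complex.continuous_normSq.comp (continuous_UMat_apply b k))

theorem columnMoment_comm {n : ℕ} (k a b : Fin n) : columnMoment k a b = columnMoment k b a := by
  simp only [columnMoment, mul_comm]

/-- Left invariance replaces $U_{ak}$ by $(3U_{ak}-4zU_{bk})/5$ for any phase $z$. Expanding the
fourth power of the modulus and averaging over $z$ leaves $81$, $256$ and $4\cdot 9\cdot 16=576$. -/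
theorem columnMoment_relation {n : ℕ} (k : Fin n) {a b : Fin n} (hab : a ≠ b) :
    625 * columnMoment k a a =
      81 * columnMoment k a a + 256 * columnMoment k b b + 576 * columnMoment k a b := by
  have key (z : ℂ) (hz : ‖z‖ = 1) : columnMoment k a a = ∫ U : UMat n,
      Complex.normSq ((3 * (U : Mat n) a k - 4 * (z * (U : Mat n) b k)) / 5) ^ 2 ∂(haarU n) := by
    rw [columnMoment, ← integral_mul_left_eq_self _ (reflectUnitary a b hab * phaseUnitary b z hz)]
    simp only [reflectUnitary_mul_phaseUnitary_mul_apply, sq]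
  have hint (z : ℂ) : Integrable (fun U : UMat n =>
      Complex.normSq ((3 * (U : Mat n) a k - 4 * (z * (U : Mat n) b k)) / 5) ^ 2) (haarU n) := by
    refine integrable_haarU ((Complex.continuous_normSq.comp ?_).pow 2)
    exact ((continuous_const.mul (continuous_UMat_apply a k)).sub
      (continuous_const.mul (continuous_const.mul (continuous_UMat_apply b k)))).div_const _
  -- The expansion contains only powers $z^r$ with $|r|\le 2$, so the mean over the four fourth
  -- roots of unity already removes all terms with $r\ne0$.
  have e : 4 * columnMoment k a a = ∫ U : UMat n,
      ((324 / 625) * (Complex.normSq ((U : Mat n) a k) * Complex.normSq ((U : Mat n) a k)) +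
      (1024 / 625) * (Complex.normSq ((U : Mat n) b k) * Complex.normSq ((U : Mat n) b k)) +
      (2304 / 625) * (Complex.normSq ((U : Mat n) a k) * Complex.normSq ((U : Mat n) b k)))
        ∂(haarU n) := by
    have hz : ∀ i : Fin 4, ‖(![1, -1, Complex.I, -Complex.I] : Fin 4 → ℂ) i‖ = 1 := by
      intro i; fin_cases i <;> simp
    have : 4 * columnMoment k a a = ∑ i : Fin 4, columnMoment k a a := by simp
    rw [this, Finset.sum_congr rfl fun i _ => key _ (hz i), ← integral_finsetSum _ fun i _ => hint _]
    congr 1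
    ext U
    simp [Complex.normSq_apply, Fin.sum_univ_four]
    ring
  have i1 (a b : Fin n) := integrable_haarU (continuous_normSq_mul_normSq k a b)
  have i2 : Integrable (fun U : UMat n =>
      (324 / 625) * (Complex.normSq ((U : Mat n) a k) * Complex.normSq ((U : Mat n) a k)) +
      (1024 / 625) * (Complex.normSq ((U : Mat n) b k) * Complex.normSq ((U : Mat n) b k))) (haarU n) :=
    ((i1 a a).const_mul _).add ((i1 b b).const_mul _)
  rw [integral_add i2 ((i1 a b).const_mul _),
    integral_add ((i1 a a).const_mul _) ((i1 b b).const_mul _), integral_const_mul,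
    integral_const_mul, integral_const_mul] at e
  simp only [columnMoment] at *
  linarith

/-- Subtracting the relations for $(a,b)$ and $(b,a)$ gives the first equality; substituting it back
gives $288\,M_{aa}=576\,M_{ab}$. -/
theorem columnMoment_self_eq {n : ℕ} (k : Fin n) {a b : Fin n} (hab : a ≠ b) :
    columnMoment k a a = columnMoment k b b ∧ columnMoment k a a = 2 * columnMoment k a b := by
  have h1 := columnMoment_relation k hab
  have h2 := columnMoment_relation k hab.symm
  rw [columnMoment_comm k b a] at h2
  constructor <;> linarith

theorem sum_normSq_column {n : ℕ} (U : UMat n) (k : Fin n) :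
    ∑ a, Complex.normSq ((U : Mat n) a k) = 1 := by
  have h := congrFun (congrFun (Matrix.mem_unitaryGroup_iff'.mp U.2) k) k
  rw [Matrix.mul_apply, Matrix.one_apply_eq] at h
  have : ((∑ a, Complex.normSq ((U : Mat n) a k) : ℝ) : ℂ) = 1 := by
    rw [← h]
    push_cast
    refine Finset.sum_congr rfl fun a _ => ?_
    rw [Complex.normSq_eq_conj_mul_self]
    simp [Matrix.star_apply]
  exact_mod_cast this

theorem sum_normSq_row {n : ℕ} (U : UMat n) (a : Fin n) :
    ∑ k, Complex.normSq ((U : Mat n) a k) = 1 := by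
  have := sum_normSq_column (star U) a
  simpa [Matrix.star_apply] using this

/-- All moments are now multiples of a single one, which is fixed by the unit norm of the column:
the sum over both row indices is $1$. -/
theorem columnMoment_eq {n : ℕ} (k a b : Fin n) :
    columnMoment k a b = (if a = b then 2 else 1) / (n * (n + 1)) := by
  have hn : (0 : ℝ) < n := by exact_mod_cast Fin.pos k
  have hall (c e : Fin n) : columnMoment k c e = (if c = e then 1 else 1 / 2) * columnMoment k k k := by
    have hc (c : Fin n) : columnMoment k c c = columnMoment k k k := by
      by_cases h : c = k
      · rw [h]
      · exact (columnMoment_self_eq k h).1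
    by_cases h : c = e
    · subst h; simp [hc]
    · have := (columnMoment_self_eq k h).2
      rw [hc] at this
      simp [h]; linarith
  have hsum : ∑ c, ∑ e, columnMoment k c e = 1 := by
    simp only [columnMoment]
    have i1 (a b : Fin n) := integrable_haarU (continuous_normSq_mul_normSq k a b)
    simp_rw [← integral_finsetSum _ (fun e _ => i1 _ e)]
    rw [← integral_finsetSum _ (fun c _ => integrable_finsetSum _ fun e _ => i1 c e)]
    simp_rw [← Finset.mul_sum, sum_normSq_column, mul_one, sum_normSq_column]
    simp
  have hk : columnMoment k k k = 2 / (n * (n + 1)) := by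
    have h2 : ∀ c : Fin n, ∑ e, columnMoment k c e = (n + 1) / 2 * columnMoment k k k := by
      intro c
      have : ∀ e, columnMoment k c e = 1 / 2 * columnMoment k k k +
          (if c = e then 1 / 2 * columnMoment k k k else 0) := by
        intro e; rw [hall]; split_ifs <;> ring
      simp only [this, Finset.sum_add_distrib, Finset.sum_const, Finset.card_univ, Fintype.card_fin,
        Finset.sum_ite_eq, Finset.mem_univ, if_true, nsmul_eq_mul]
      ring
    simp only [h2, Finset.sum_const, Finset.card_univ, Fintype.card_fin, nsmul_eq_mul] at hsum
    field_simp
    field_simp at hsum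
    linarith
  rw [hall, hk]
  split_ifs <;> field_simp

/-- The mean squared populations of a state with spectrum `x` in a Haar-distributed basis. -/
theorem integral_sum_sq_populations {n : ℕ} {x : Fin n → ℝ} (hx : ∑ i, x i = 1) :
    ∫ U : UMat n, ∑ k, (∑ a, x a * Complex.normSq ((U : Mat n) a k)) ^ 2 ∂(haarU n) =
      (1 + ∑ i, x i ^ 2) / (n + 1) := by
  have hn : (0 : ℝ) < n := by
    rcases Nat.eq_zero_or_pos n with rfl | h
    · simp at hx
    · exact_mod_cast h
  have i1 (k a b : Fin n) := integrable_haarU (continuous_normSq_mul_normSq k a b)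
  have hexp (U : UMat n) (k : Fin n) : (∑ a, x a * Complex.normSq ((U : Mat n) a k)) ^ 2 =
      ∑ a, ∑ b, (x a * x b) * (Complex.normSq ((U : Mat n) a k) * Complex.normSq ((U : Mat n) b k)) := by
    rw [sq, Finset.sum_mul_sum]
    exact Finset.sum_congr rfl fun a _ => Finset.sum_congr rfl fun b _ => by ring
  simp_rw [hexp]
  rw [integral_finsetSum _ fun k _ => integrable_finsetSum _ fun a _ => integrable_finsetSum _ fun b _ =>
    (i1 k a b).const_mul _]
  have hk (k : Fin n) : ∫ U : UMat n, ∑ a, ∑ b, (x a * x b) *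
      (Complex.normSq ((U : Mat n) a k) * Complex.normSq ((U : Mat n) b k)) ∂(haarU n) =
      (1 + ∑ i, x i ^ 2) / (n * (n + 1)) := by
    rw [integral_finsetSum _ fun a _ => integrable_finsetSum _ fun b _ => (i1 k a b).const_mul _]
    simp_rw [integral_finsetSum _ fun b _ => (i1 k _ b).const_mul _, integral_const_mul]
    change ∑ a, ∑ b, x a * x b * columnMoment k a b = _
    have : ∀ a b : Fin n, x a * x b * columnMoment k a b = (x a * x b + if a = b then x a * x b else 0) /
        (n * (n + 1)) := by
      intro a b; rw [columnMoment_eq]; split_ifs <;> ring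
    simp_rw [this, ← Finset.sum_div, Finset.sum_add_distrib, Finset.sum_ite_eq, ← Finset.mul_sum, hx]
    simp [hx, sq]
  simp_rw [hk]
  simp
  field_simp

/-! ### Coordinates on the open simplex -/

/-- The point of the hyperplane `∑ x_i = 1` with the given first coordinates. -/
def simplexExt {m : ℕ} (y : Fin m → ℝ) : Fin (m + 1) → ℝ :=
  Fin.snoc (α := fun _ => ℝ) y (1 - ∑ k, y k)

/-- Passing to `Fin.snoc` removes the subtraction in `Fin (n - 1)` and gives access to the
`castSucc`/`last` lemmas. -/
theorem simplexPoint_succ {m : ℕ} (y : Fin m → ℝ) : simplexPoint (m + 1) y = simplexExt y := by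
  ext i
  refine Fin.lastCases ?_ (fun j => ?_) i
  · simp [simplexPoint, simplexExt]
  · simp [simplexPoint, simplexExt]

@[simp] theorem simplexExt_castSucc {m : ℕ} (y : Fin m → ℝ) (j : Fin m) :
    simplexExt y j.castSucc = y j := by simp [simplexExt]

@[simp] theorem simplexExt_last {m : ℕ} (y : Fin m → ℝ) :
    simplexExt y (Fin.last m) = 1 - ∑ k, y k := by simp [simplexExt]

theorem sum_simplexExt {m : ℕ} (y : Fin m → ℝ) : ∑ i, simplexExt y i = 1 := by
  simp [Fin.sum_univ_castSucc]

theorem continuous_simplexExt {m : ℕ} : Continuous (simplexExt (m := m)) := by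
  refine continuous_pi fun i => ?_
  refine Fin.lastCases ?_ (fun j => ?_) i
  · simp only [simplexExt_last]; fun_prop
  · simp only [simplexExt_castSucc]; fun_prop

/-- The open simplex in the coordinates of `simplexExt`. -/
def simplexChart (m : ℕ) : Set (Fin m → ℝ) := {y | ∀ i, 0 < simplexExt y i}

theorem isOpen_simplexChart (m : ℕ) : IsOpen (simplexChart m) := by
  have : simplexChart m = ⋂ i, {y | 0 < simplexExt y i} := by ext; simp [simplexChart]
  rw [this]
  exact isOpen_iInter_of_finite fun i =>
    isOpen_lt continuous_const ((continuous_apply i).comp continuous_simplexExt)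

theorem measurableSet_simplexChart (m : ℕ) : MeasurableSet (simplexChart m) :=
  (isOpen_simplexChart m).measurableSet

theorem simplexExt_le_one {m : ℕ} {y : Fin m → ℝ} (hy : y ∈ simplexChart m) (i : Fin (m + 1)) :
    simplexExt y i ≤ 1 := by
  rw [← sum_simplexExt y]
  exact Finset.single_le_sum (fun j _ => (hy j).le) (Finset.mem_univ i)

/-- Exchanging the `j`-th and the last coordinate of the simplex. -/
def simplexSwap {m : ℕ} (j : Fin m) (y : Fin m → ℝ) : Fin m → ℝ :=
  Function.update y j (1 - ∑ k, y k)

theorem simplexExt_simplexSwap {m : ℕ} (j : Fin m) (y : Fin m → ℝ) :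
    simplexExt (simplexSwap j y) = simplexExt y ∘ Equiv.swap j.castSucc (Fin.last m) := by
  have hs : ∑ k, Function.update y j (1 - ∑ k, y k) k = 1 - y j := by
    rw [Finset.sum_update_of_mem (Finset.mem_univ j), ← Finset.sum_erase_add _ _ (Finset.mem_univ j),
      Finset.sdiff_singleton_eq_erase]
    ring
  ext i
  refine Fin.lastCases ?_ (fun k => ?_) i
  · simp [simplexSwap, hs]
  · rcases eq_or_ne k j with rfl | hk
    · simp [simplexSwap]
    · have : k.castSucc ≠ j.castSucc := by simpa using hk
      simp [simplexSwap, hk, Equiv.swap_apply_of_ne_of_ne this (Fin.castSucc_ne_last k)]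

theorem simplexSwap_mem_iff {m : ℕ} (j : Fin m) (y : Fin m → ℝ) :
    simplexSwap j y ∈ simplexChart m ↔ y ∈ simplexChart m := by
  simp only [simplexChart, Set.mem_ofPred_eq, simplexExt_simplexSwap, Function.comp]
  exact (Equiv.swap j.castSucc (Fin.last m)).forall_congr_left.trans (by simp)

/-- The linear part of `simplexSwap`. -/
def simplexSwapLinear {m : ℕ} (j : Fin m) : (Fin m → ℝ) →ₗ[ℝ] (Fin m → ℝ) where
  toFun y := Function.update y j (-∑ k, y k)
  map_add' x y := by
    ext i
    rcases eq_or_ne i j with rfl | h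
    · simp [Finset.sum_add_distrib]; ring
    · simp [h]
  map_smul' c x := by
    ext i
    rcases eq_or_ne i j with rfl | h
    · simp [Finset.mul_sum]
    · simp [h]

theorem simplexSwapLinear_comp_self {m : ℕ} (j : Fin m) :
    simplexSwapLinear j ∘ₗ simplexSwapLinear j = LinearMap.id := by
  refine LinearMap.ext fun y => ?_
  have hs : ∑ k, Function.update y j (-∑ k, y k) k = - y j := by
    rw [Finset.sum_update_of_mem (Finset.mem_univ j), ← Finset.sum_erase_add _ _ (Finset.mem_univ j),
      Finset.sdiff_singleton_eq_erase]
    ring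
  ext i
  rcases eq_or_ne i j with rfl | h
  · simp [simplexSwapLinear, hs]
  · simp [simplexSwapLinear, h]

/-- The chart singles out the last coordinate, and this map restores the lost symmetry. It is a
translation after a linear involution, whose determinant is $\pm1$. -/
theorem measurePreserving_simplexSwap {m : ℕ} (j : Fin m) :
    MeasurePreserving (simplexSwap j) volume volume := by
  have hdet : LinearMap.det (simplexSwapLinear j) * LinearMap.det (simplexSwapLinear j) = 1 := by
    rw [← LinearMap.det_comp, simplexSwapLinear_comp_self, LinearMap.det_id]
  have habs : |LinearMap.det (simplexSwapLinear j)| = 1 := by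
    rcases mul_self_eq_one_iff.mp hdet with h | h <;> simp [h]
  have hne : LinearMap.det (simplexSwapLinear j) ≠ 0 := fun h => by simp [h] at hdet
  have h1 : MeasurePreserving (simplexSwapLinear j) volume volume := by
    refine ⟨(LinearMap.continuous_of_finiteDimensional _).measurable, ?_⟩
    rw [Measure.map_linearMap_addHaar_eq_smul_addHaar _ hne, abs_inv, habs]
    simp
  have h2 : MeasurePreserving (fun y : Fin m → ℝ => Pi.single j 1 + y) volume volume :=
    measurePreserving_add_left volume _
  have : simplexSwap j = (fun y : Fin m → ℝ => Pi.single j 1 + y) ∘ simplexSwapLinear j := by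
    ext y i
    rcases eq_or_ne i j with rfl | h
    · simp [simplexSwap, simplexSwapLinear, sub_eq_add_neg]
    · simp [simplexSwap, simplexSwapLinear, h]
  rw [this]
  exact h2.comp h1

/-! ### Integrability of the Dirichlet density -/

theorem integrable_indicator_inv_sqrt :
    Integrable ((Set.Ioo (0 : ℝ) 1).indicator fun x => (√x)⁻¹) := by
  rw [integrable_indicator_iff measurableSet_Ioo]
  have h := (intervalIntegral.integrableOn_Ioo_rpow_iff (s := -(1 / 2 : ℝ)) (t := 1) one_pos).mpr
    (by norm_num)
  refine h.congr_fun (fun x hx => ?_) measurableSet_Ioo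
  simp only
  rw [Real.rpow_neg hx.1.le, Real.sqrt_eq_rpow]

/-- The Dirichlet density `∏ x_i^(-1/2)`. -/
def dirichletDensity {n : ℕ} (x : Fin n → ℝ) : ℝ := ∏ i, (√(x i))⁻¹

theorem dirichletDensity_comp {n : ℕ} (x : Fin n → ℝ) (σ : Equiv.Perm (Fin n)) :
    dirichletDensity (x ∘ σ) = dirichletDensity x :=
  Equiv.prod_comp σ fun i => (√(x i))⁻¹

theorem one_le_inv_sqrt {x : ℝ} (h0 : 0 < x) (h1 : x ≤ 1) : 1 ≤ (√x)⁻¹ :=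
  (one_le_inv₀ (Real.sqrt_pos.mpr h0)).mpr (by simpa using h1)

theorem one_le_dirichletDensity {m : ℕ} {y : Fin m → ℝ} (hy : y ∈ simplexChart m) :
    1 ≤ dirichletDensity (simplexExt y) :=
  Finset.one_le_prod fun i _ => one_le_inv_sqrt (hy i) (simplexExt_le_one hy i)

theorem measurable_dirichletDensity {n : ℕ} : Measurable (dirichletDensity (n := n)) := by
  unfold dirichletDensity
  fun_prop

/-- An integrable majorant of the Dirichlet density where the last coordinate is bounded below. -/
def dirichletMajorant (m : ℕ) (y : Fin m → ℝ) : ℝ :=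
  √(m + 1) * ∏ i, (Set.Ioo (0 : ℝ) 1).indicator (fun x => (√x)⁻¹) (y i)

theorem integrable_dirichletMajorant (m : ℕ) : Integrable (dirichletMajorant m) :=
  (Integrable.fintype_prod (μ := fun _ => volume) fun _ => integrable_indicator_inv_sqrt).const_mul _

theorem dirichletMajorant_nonneg (m : ℕ) (y : Fin m → ℝ) : 0 ≤ dirichletMajorant m y :=
  mul_nonneg (Real.sqrt_nonneg _) (Finset.prod_nonneg fun _ _ =>
    Set.indicator_nonneg (fun _ _ => inv_nonneg.mpr (Real.sqrt_nonneg _)) _)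

/-- If the last, dependent coordinate is at least $1/(m+1)$, its factor is at most $\sqrt{m+1}$, and
the other factors form a product of integrable one-variable functions. -/
theorem dirichletDensity_le_majorant {m : ℕ} {y : Fin m → ℝ} (hy : y ∈ simplexChart m)
    (h : 1 / ((m : ℝ) + 1) ≤ simplexExt y (Fin.last m)) :
    dirichletDensity (simplexExt y) ≤ dirichletMajorant m y := by
  unfold dirichletDensity dirichletMajorant
  rw [Fin.prod_univ_castSucc, mul_comm]
  have hlt (i : Fin m) : y i < 1 := by
    have h1 : simplexExt y i.castSucc + simplexExt y (Fin.last m) ≤ 1 := by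
      rw [← sum_simplexExt y, Fin.sum_univ_castSucc]
      gcongr
      exact Finset.single_le_sum (f := fun i : Fin m => simplexExt y i.castSucc)
        (fun j _ => (hy _).le) (Finset.mem_univ i)
    have h2 := hy (Fin.last m)
    simp only [simplexExt_castSucc] at h1
    linarith
  refine mul_le_mul ?_ (le_of_eq ?_) (Finset.prod_nonneg fun i _ => by positivity) (Real.sqrt_nonneg _)
  · rw [← Real.sqrt_inv]
    refine Real.sqrt_le_sqrt ?_
    rw [inv_le_comm₀ (hy _) (by positivity)]
    simpa using h
  · refine Finset.prod_congr rfl fun i _ => ?_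
    have h0 : 0 < y i := by simpa using hy i.castSucc
    rw [Set.indicator_of_mem (show y i ∈ Set.Ioo (0 : ℝ) 1 from ⟨h0, hlt i⟩)]
    simp

/-- Some coordinate is at least the average $1/(m+1)$; `simplexSwap` moves it to the last place, and
adding all the majorants avoids splitting the domain. -/
theorem dirichletDensity_le_sum {m : ℕ} {y : Fin m → ℝ} (hy : y ∈ simplexChart m) :
    dirichletDensity (simplexExt y) ≤
      dirichletMajorant m y + ∑ j, dirichletMajorant m (simplexSwap j y) := by
  have hex : ∃ i, 1 / ((m : ℝ) + 1) ≤ simplexExt y i := by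
    by_contra! h
    have := Finset.sum_lt_sum_of_nonempty (Finset.univ_nonempty (α := Fin (m + 1)))
      fun i _ => h i
    rw [sum_simplexExt] at this
    simp at this
    field_simp at this
    simp at this
  obtain ⟨i, hi⟩ := hex
  revert hi
  refine Fin.lastCases ?_ (fun j => ?_) i
  · intro hi
    have := Finset.sum_nonneg fun j (_ : j ∈ Finset.univ) => dirichletMajorant_nonneg m (simplexSwap j y)
    linarith [dirichletDensity_le_majorant hy hi]
  · intro hi
    have h1 := dirichletDensity_le_majorant ((simplexSwap_mem_iff j y).mpr hy)
      (by rw [simplexExt_simplexSwap]; simpa using hi)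
    rw [simplexExt_simplexSwap, dirichletDensity_comp] at h1
    have h2 := Finset.single_le_sum (f := fun j => dirichletMajorant m (simplexSwap j y))
      (fun j _ => dirichletMajorant_nonneg m _) (Finset.mem_univ j)
    linarith [dirichletMajorant_nonneg m y]

theorem integrableOn_dirichletDensity (m : ℕ) :
    IntegrableOn (fun y => dirichletDensity (simplexExt y)) (simplexChart m) := by
  have hint : Integrable fun y : Fin m → ℝ =>
      dirichletMajorant m y + ∑ j, dirichletMajorant m (simplexSwap j y) :=
    (integrable_dirichletMajorant m).add (integrable_finsetSum _ fun j _ =>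
      (measurePreserving_simplexSwap j).integrable_comp_of_integrable (integrable_dirichletMajorant m))
  refine hint.integrableOn.mono'
    (measurable_dirichletDensity.comp continuous_simplexExt.measurable).aestronglyMeasurable ?_
  filter_upwards [ae_restrict_mem (measurableSet_simplexChart m)] with y hy
  rw [Real.norm_of_nonneg (zero_le_one.trans (one_le_dirichletDensity hy))]
  exact dirichletDensity_le_sum hy

/-! ### The eigenvalue weights -/

/-- The one-point factor of the eigenvalue weight. -/
def StateMeasure.single : StateMeasure → ℝ → ℝ
  | .hilbertSchmidt, _ => 1
  | .bures, x => (√x)⁻¹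

/-- The two-point factor of the eigenvalue weight. -/
def StateMeasure.pair : StateMeasure → ℝ → ℝ → ℝ
  | .hilbertSchmidt, x, y => (x - y) ^ 2
  | .bures, x, y => (x - y) ^ 2 / (x + y)

/-- The exponent of `∏_{i,j} (x_i + x_j)^{-κ/2}` in the eigenvalue weight. -/
def StateMeasure.kappa : StateMeasure → ℝ
  | .hilbertSchmidt => 0
  | .bures => 1

theorem StateMeasure.weight_eq (m : StateMeasure) {n : ℕ} (x : Fin n → ℝ) :
    m.weight x = (∏ i, m.single (x i)) * ∏ i, ∏ j ∈ Finset.Ioi i, m.pair (x i) (x j) := by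
  cases m <;> simp [weight, single, pair, vandermondeSq]

theorem StateMeasure.pair_comm (m : StateMeasure) (x y : ℝ) : m.pair x y = m.pair y x := by
  cases m
  · simp only [pair]; ring
  · simp only [pair, add_comm x y]; ring

theorem StateMeasure.single_nonneg (m : StateMeasure) (x : ℝ) : 0 ≤ m.single x := by
  cases m <;> simp [single]

theorem StateMeasure.single_le (m : StateMeasure) {x : ℝ} (h0 : 0 < x) (h1 : x ≤ 1) :
    m.single x ≤ (√x)⁻¹ := by
  cases m
  · exact one_le_inv_sqrt h0 h1
  · exact le_rfl

theorem StateMeasure.single_pos (m : StateMeasure) {x : ℝ} (h0 : 0 < x) : 0 < m.single x := by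
  cases m
  · exact one_pos
  · exact inv_pos.mpr (Real.sqrt_pos.mpr h0)

theorem StateMeasure.pair_nonneg (m : StateMeasure) {x y : ℝ} (hx : 0 ≤ x) (hy : 0 ≤ y) :
    0 ≤ m.pair x y := by
  cases m <;> simp only [pair] <;> positivity

theorem StateMeasure.pair_pos (m : StateMeasure) {x y : ℝ} (hx : 0 < x) (hy : 0 < y) (h : x ≠ y) :
    0 < m.pair x y := by
  have : 0 < (x - y) ^ 2 := by have := sub_ne_zero.mpr h; positivity
  cases m <;> simp only [pair] <;> positivity

theorem StateMeasure.pair_self (m : StateMeasure) (x : ℝ) : m.pair x x = 0 := by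
  cases m <;> simp [pair]

/-- One power of $|x-y|$ is kept: it will absorb the pole $1/(x_i-x_j)$ of the logarithmic
derivative. -/
theorem StateMeasure.pair_le_abs (m : StateMeasure) {x y : ℝ} (hx : 0 < x) (hy : 0 < y)
    (hx1 : x ≤ 1) (hy1 : y ≤ 1) : m.pair x y ≤ |x - y| := by
  have h0 := abs_nonneg (x - y)
  cases m <;> simp only [pair]
  · have : |x - y| ≤ 1 := abs_le.mpr ⟨by linarith, by linarith⟩
    rw [← sq_abs]; nlinarith
  · have : |x - y| ≤ x + y := abs_le.mpr ⟨by linarith, by linarith⟩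
    rw [div_le_iff₀ (by positivity), ← sq_abs]; nlinarith

theorem StateMeasure.pair_le_one (m : StateMeasure) {x y : ℝ} (hx : 0 < x) (hy : 0 < y)
    (hx1 : x ≤ 1) (hy1 : y ≤ 1) : m.pair x y ≤ 1 :=
  (m.pair_le_abs hx hy hx1 hy1).trans (abs_le.mpr ⟨by linarith, by linarith⟩)

theorem StateMeasure.measurable_weight (m : StateMeasure) {n : ℕ} :
    Measurable (m.weight (n := n)) := by
  cases m
  · change Measurable fun x : Fin n → ℝ => ∏ i, ∏ j ∈ Finset.Ioi i, (x i - x j) ^ 2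
    fun_prop
  · change Measurable fun x : Fin n → ℝ => (∏ i, (√(x i))⁻¹) *
      ∏ i, ∏ j ∈ Finset.Ioi i, (x i - x j) ^ 2 / (x i + x j)
    fun_prop

theorem StateMeasure.weight_nonneg (m : StateMeasure) {n : ℕ} {x : Fin n → ℝ}
    (hx : ∀ i, 0 ≤ x i) : 0 ≤ m.weight x := by
  rw [weight_eq]
  exact mul_nonneg (Finset.prod_nonneg fun i _ => m.single_nonneg _)
    (Finset.prod_nonneg fun i _ => Finset.prod_nonneg fun j _ => m.pair_nonneg (hx i) (hx j))

theorem StateMeasure.weight_pos (m : StateMeasure) {n : ℕ} {x : Fin n → ℝ}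
    (hx : ∀ i, 0 < x i) (hi : Function.Injective x) : 0 < m.weight x := by
  rw [weight_eq]
  refine mul_pos (Finset.prod_pos fun i _ => m.single_pos (hx i))
    (Finset.prod_pos fun i _ => Finset.prod_pos fun j hj => m.pair_pos (hx i) (hx j) ?_)
  exact hi.ne (Finset.mem_Ioi.mp hj).ne

theorem StateMeasure.weight_le_mul (m : StateMeasure) {n : ℕ} {x : Fin n → ℝ}
    (hx : ∀ i, 0 < x i) (hx1 : ∀ i, x i ≤ 1) {p l : Fin n} (hpl : p ≠ l) :
    m.weight x ≤ |x p - x l| * dirichletDensity x := by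
  wlog h : p < l generalizing p l
  · rw [abs_sub_comm]
    exact this hpl.symm (lt_of_le_of_ne (not_lt.mp h) hpl.symm)
  rw [weight_eq, mul_comm]
  refine mul_le_mul ?_ (Finset.prod_le_prod (fun i _ => m.single_nonneg _)
    fun i _ => m.single_le (hx i) (hx1 i)) (Finset.prod_nonneg fun i _ => m.single_nonneg _)
    (abs_nonneg _)
  rw [Finset.prod_sigma', ← Finset.mul_prod_erase _ _
    (show (⟨p, l⟩ : Sigma fun _ : Fin n => Fin n) ∈ Finset.univ.sigma fun i => Finset.Ioi i by simpa)]
  refine (mul_le_of_le_one_right (m.pair_nonneg (hx _).le (hx _).le) ?_).trans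
    (m.pair_le_abs (hx _) (hx _) (hx1 _) (hx1 _))
  exact Finset.prod_le_one (fun e _ => m.pair_nonneg (hx _).le (hx _).le)
    fun e _ => m.pair_le_one (hx _) (hx _) (hx1 _) (hx1 _)

theorem StateMeasure.weight_le (m : StateMeasure) {n : ℕ} {x : Fin n → ℝ}
    (hx : ∀ i, 0 < x i) (hx1 : ∀ i, x i ≤ 1) : m.weight x ≤ dirichletDensity x := by
  rw [weight_eq]
  refine (mul_le_of_le_one_right (Finset.prod_nonneg fun i _ => m.single_nonneg _) ?_).trans
    (Finset.prod_le_prod (fun i _ => m.single_nonneg _) fun i _ => m.single_le (hx i) (hx1 i))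
  exact Finset.prod_le_one (fun i _ => Finset.prod_nonneg fun j _ => m.pair_nonneg (hx _).le (hx _).le)
    fun i _ => Finset.prod_le_one (fun j _ => m.pair_nonneg (hx _).le (hx _).le)
      fun j _ => m.pair_le_one (hx _) (hx _) (hx1 _) (hx1 _)

theorem prod_prod_Ioi_mul_self {n : ℕ} {f : Fin n → Fin n → ℝ} (hf : ∀ i j, f i j = f j i) :
    (∏ i, ∏ j ∈ Finset.Ioi i, f i j) * (∏ i, ∏ j ∈ Finset.Ioi i, f i j) =
      ∏ i, ∏ j ∈ {i}ᶜ, f i j := by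
  rw [← Finset.prod_prod_Ioi_mul_eq_prod_prod_off_diag, ← Finset.prod_mul_distrib]
  refine Finset.prod_congr rfl fun i _ => ?_
  rw [← Finset.prod_mul_distrib]
  exact Finset.prod_congr rfl fun j _ => by rw [hf j i]

/-- The product over $i<j$ is not visibly symmetric, but its square is a product over all ordered
pairs $i\ne j$; nonnegativity allows the square root to be taken back. -/
theorem StateMeasure.weight_comp (m : StateMeasure) {n : ℕ} {x : Fin n → ℝ}
    (hx : ∀ i, 0 ≤ x i) (σ : Equiv.Perm (Fin n)) : m.weight (x ∘ σ) = m.weight x := by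
  have hsq (y : Fin n → ℝ) : m.weight y ^ 2 =
      (∏ i, m.single (y i)) ^ 2 * ∏ i, ∏ j, if i = j then 1 else m.pair (y i) (y j) := by
    rw [weight_eq, mul_pow, sq (∏ i, ∏ j ∈ Finset.Ioi i, _),
      prod_prod_Ioi_mul_self fun i j => m.pair_comm _ _]
    congr 1
    refine Finset.prod_congr rfl fun i _ => ?_
    rw [← Finset.prod_subset (Finset.subset_univ ({i}ᶜ : Finset (Fin n)))]
    · refine Finset.prod_congr rfl fun j hj => ?_
      have : i ≠ j := by simpa [eq_comm] using hj
      simp [this]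
    · intro j _ hj
      have : i = j := by simpa [eq_comm] using hj
      simp [this]
  refine (pow_left_inj₀ (m.weight_nonneg fun i => hx _) (m.weight_nonneg hx) two_ne_zero).mp ?_
  rw [hsq, hsq]
  congr 1
  · congr 1
    exact Equiv.prod_comp σ fun i => m.single (x i)
  · rw [← Equiv.prod_comp σ fun i => ∏ j, if i = j then 1 else m.pair (x i) (x j)]
    refine Finset.prod_congr rfl fun i _ => ?_
    rw [← Equiv.prod_comp σ fun j => if σ i = j then 1 else m.pair (x (σ i)) (x j)]
    simp

theorem StateMeasure.weight_eq_zero (m : StateMeasure) {n : ℕ} {x : Fin n → ℝ}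
    (hi : ¬ Function.Injective x) : m.weight x = 0 := by
  simp only [Function.Injective, not_forall] at hi
  obtain ⟨i, j, hij, hne⟩ := hi
  wlog h : i < j generalizing i j
  · exact this j i hij.symm (Ne.symm hne) (lt_of_le_of_ne (not_lt.mp h) (Ne.symm hne))
  rw [weight_eq]
  refine mul_eq_zero_of_right _ (Finset.prod_eq_zero (Finset.mem_univ i)
    (Finset.prod_eq_zero (Finset.mem_Ioi.mpr h) ?_))
  rw [hij, pair_self]

/-! ### The normalization of the law of the state levels -/

theorem StateMeasure.integrableOn_weight (m : StateMeasure) (k : ℕ) :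
    IntegrableOn (fun y => m.weight (simplexExt y)) (simplexChart k) := by
  refine (integrableOn_dirichletDensity k).mono'
    (m.measurable_weight.comp continuous_simplexExt.measurable).aestronglyMeasurable ?_
  filter_upwards [ae_restrict_mem (measurableSet_simplexChart k)] with y hy
  rw [Real.norm_of_nonneg (m.weight_nonneg fun i => (hy i).le)]
  exact m.weight_le hy (simplexExt_le_one hy)

/-- The normalization constant of the law of the state levels. -/
def StateMeasure.partition (m : StateMeasure) (k : ℕ) : ℝ :=
  ∫ y in simplexChart k, m.weight (simplexExt y)

theorem isOpen_injective (n : ℕ) : IsOpen {x : Fin n → ℝ | Function.Injective x} := by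
  have : {x : Fin n → ℝ | Function.Injective x} = ⋂ i, ⋂ j, {x | i ≠ j → x i ≠ x j} := by
    ext x
    simp only [Set.mem_iInter, Set.mem_ofPred_eq, Function.Injective]
    exact forall_congr' fun i => forall_congr' fun j => by rw [← not_imp_not]
  rw [this]
  refine isOpen_iInter_of_finite fun i => isOpen_iInter_of_finite fun j => ?_
  by_cases hij : i = j
  · simp [hij]
  · simp only [ne_eq, hij, not_false_eq_true, forall_const]
    exact isOpen_ne_fun (continuous_apply i) (continuous_apply j)

theorem StateMeasure.partition_pos (m : StateMeasure) (k : ℕ) : 0 < m.partition k := by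
  -- A point of the simplex with distinct coordinates, proportional to $1,2,\dots,k+1$; `c` is their
  -- sum. Near it the weight is positive.
  set c : ℝ := ((k + 1 : ℕ) : ℝ) * ((k + 2 : ℕ) : ℝ) / 2 with hc
  have hcpos : 0 < c := by positivity
  let y₀ : Fin k → ℝ := fun i => ((i : ℕ) + 1) / c
  have hy₀ (i : Fin (k + 1)) : simplexExt y₀ i = ((i : ℕ) + 1) / c := by
    refine Fin.lastCases ?_ (fun j => ?_) i
    · have hs : ∀ l : ℕ, ∑ i : Fin l, (((i : ℕ) : ℝ) + 1) = l * (l + 1) / 2 := by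
        intro l
        induction l with
        | zero => simp
        | succ l ih => rw [Fin.sum_univ_castSucc]; simp [ih]; ring
      simp only [simplexExt_last, y₀, ← Finset.sum_div, hs, Fin.val_last]
      rw [eq_div_iff hcpos.ne', sub_mul, div_mul_cancel₀ _ hcpos.ne', hc]
      push_cast
      ring
    · simp [y₀]
  have hopen : IsOpen {y : Fin k → ℝ | y ∈ simplexChart k ∧ Function.Injective (simplexExt y)} := by
    exact (isOpen_simplexChart k).inter <|
      (isOpen_injective (k + 1)).preimage continuous_simplexExt
  have hmem : y₀ ∈ {y : Fin k → ℝ | y ∈ simplexChart k ∧ Function.Injective (simplexExt y)} := by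
    refine ⟨fun i => by rw [hy₀]; positivity, fun i j h => ?_⟩
    rw [hy₀, hy₀, div_left_inj' hcpos.ne'] at h
    exact Fin.ext (by exact_mod_cast add_right_cancel h)
  have hvol := hopen.measure_pos volume ⟨y₀, hmem⟩
  unfold partition
  rw [setIntegral_pos_iff_support_of_nonneg_ae]
  · refine hvol.trans_le (measure_mono fun y hy => ⟨?_, hy.1⟩)
    exact (m.weight_pos hy.1 hy.2).ne'
  · filter_upwards [ae_restrict_mem (measurableSet_simplexChart k)] with y hy
    exact m.weight_nonneg fun i => (hy i).le
  · exact m.integrableOn_weight k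

theorem isProbabilityMeasure_normalized {α : Type*} [MeasurableSpace α] {μ : Measure α}
    (h0 : μ Set.univ ≠ 0) (h1 : μ Set.univ ≠ ⊤) : IsProbabilityMeasure (normalized μ) :=
  ⟨by simp [normalized, ENNReal.inv_mul_cancel h0 h1]⟩

theorem stateLevels_succ (m : StateMeasure) (k : ℕ) : stateLevels m (k + 1) =
    (ENNReal.ofReal (m.partition k))⁻¹ • (((volume.restrict (simplexChart k)).withDensity fun y =>
      ENNReal.ofReal (m.weight (simplexExt y))).map simplexExt) := by
  have hset : {y : Fin k → ℝ | ∀ i, 0 < simplexPoint (k + 1) y i} = simplexChart k := by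
    simp only [simplexPoint_succ]; rfl
  have hfun : (simplexPoint (k + 1) : (Fin k → ℝ) → _) = simplexExt := funext simplexPoint_succ
  have hZ : (((volume.restrict (simplexChart k)).withDensity fun y =>
      ENNReal.ofReal (m.weight (simplexExt y))).map simplexExt) Set.univ =
      ENNReal.ofReal (m.partition k) := by
    rw [Measure.map_apply continuous_simplexExt.measurable MeasurableSet.univ, Set.preimage_univ,
      withDensity_apply _ MeasurableSet.univ, Measure.restrict_univ, StateMeasure.partition,
      ofReal_integral_eq_lintegral_ofReal (m.integrableOn_weight k)]
    filter_upwards [ae_restrict_mem (measurableSet_simplexChart k)] with y hy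
    exact m.weight_nonneg fun i => (hy i).le
  unfold stateLevels normalized
  -- `Fin (k + 1 - 1)` and `Fin k` agree definitionally, and this restates the goal over the latter.
  change (((((volume : Measure (Fin k → ℝ)).restrict {y : Fin k → ℝ | ∀ i, 0 < simplexPoint (k + 1) y i}).withDensity
    fun y => ENNReal.ofReal (m.weight (simplexPoint (k + 1) y))).map (simplexPoint (k + 1) : (Fin k → ℝ) → _)) Set.univ)⁻¹ •
    ((((volume : Measure (Fin k → ℝ)).restrict {y : Fin k → ℝ | ∀ i, 0 < simplexPoint (k + 1) y i}).withDensity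
    fun y => ENNReal.ofReal (m.weight (simplexPoint (k + 1) y))).map (simplexPoint (k + 1) : (Fin k → ℝ) → _)) = _
  rw [hset, hfun, hZ]

instance instIsProbabilityMeasureStateLevels (m : StateMeasure) (k : ℕ) :
    IsProbabilityMeasure (stateLevels m (k + 1)) := by
  have h := m.partition_pos k
  refine ⟨?_⟩
  rw [stateLevels_succ, Measure.smul_apply, Measure.map_apply continuous_simplexExt.measurable
    MeasurableSet.univ, Set.preimage_univ, withDensity_apply _ MeasurableSet.univ,
    Measure.restrict_univ, ← ofReal_integral_eq_lintegral_ofReal (m.integrableOn_weight k), smul_eq_mul]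
  · exact ENNReal.inv_mul_cancel (by simpa using h) ENNReal.ofReal_ne_top
  · filter_upwards [ae_restrict_mem (measurableSet_simplexChart k)] with y hy
    exact m.weight_nonneg fun i => (hy i).le

/-- The levels of a random state form a point of the simplex. -/
theorem ae_stateLevels (m : StateMeasure) (k : ℕ) :
    ∀ᵐ x ∂(stateLevels m (k + 1)), (∀ i, 0 < x i) ∧ ∑ i, x i = 1 := by
  rw [stateLevels_succ]
  refine Measure.ae_smul_measure ?_ _
  have hmeas : MeasurableSet {x : Fin (k + 1) → ℝ | (∀ i, 0 < x i) ∧ ∑ i, x i = 1} := by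
    refine MeasurableSet.inter ?_ (measurableSet_eq_fun (by fun_prop) measurable_const)
    have : {x : Fin (k + 1) → ℝ | ∀ i, 0 < x i} = ⋂ i, {x | 0 < x i} := by ext; simp
    change MeasurableSet {x : Fin (k + 1) → ℝ | ∀ i, 0 < x i}
    rw [this]
    exact MeasurableSet.iInter fun i => measurableSet_lt measurable_const (measurable_pi_apply i)
  rw [ae_map_iff continuous_simplexExt.measurable.aemeasurable hmeas]
  refine (withDensity_absolutelyContinuous _ _).ae_le ?_
  filter_upwards [ae_restrict_mem (measurableSet_simplexChart k)] with y hy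
  exact ⟨hy, sum_simplexExt y⟩

theorem integral_stateLevels (m : StateMeasure) (k : ℕ) {f : (Fin (k + 1) → ℝ) → ℝ}
    (hf : Measurable f) : ∫ x, f x ∂(stateLevels m (k + 1)) =
      (m.partition k)⁻¹ * ∫ y in simplexChart k, m.weight (simplexExt y) * f (simplexExt y) := by
  rw [stateLevels_succ, integral_smul_measure, integral_map
    continuous_simplexExt.measurable.aemeasurable hf.aestronglyMeasurable,
    integral_withDensity_eq_integral_toReal_smul]
  · rw [ENNReal.toReal_inv, ENNReal.toReal_ofReal (m.partition_pos k).le, smul_eq_mul]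
    congr 1
    refine setIntegral_congr_fun (measurableSet_simplexChart k) fun y hy => ?_
    simp only [smul_eq_mul]
    rw [ENNReal.toReal_ofReal (m.weight_nonneg fun i => (hy i).le)]
  · exact ENNReal.measurable_ofReal.comp (m.measurable_weight.comp continuous_simplexExt.measurable)
  · exact ae_of_all _ fun _ => ENNReal.ofReal_lt_top

/-! ### Logarithmic derivatives of the weights -/

/-- Derivatives are kept in the form $f\cdot g$, with no division by $f$, so the formula remains
valid where factors vanish. -/
theorem hasDerivAt_prod_of_logDeriv {ι : Type*} (s : Finset ι) {f : ι → ℝ → ℝ} {g : ι → ℝ} {t : ℝ}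
    (h : ∀ i ∈ s, HasDerivAt (f i) (f i t * g i) t) :
    HasDerivAt (fun u => ∏ i ∈ s, f i u) ((∏ i ∈ s, f i t) * ∑ i ∈ s, g i) t := by
  classical
  induction s using Finset.induction_on with
  | empty => simpa using hasDerivAt_const t (1 : ℝ)
  | insert a s ha ih =>
    have h1 := (h a (Finset.mem_insert_self a s)).mul
      (ih fun i hi => h i (Finset.mem_insert_of_mem hi))
    simp only [Finset.prod_insert ha, Finset.sum_insert ha]
    refine h1.congr_deriv ?_
    ring

/-- One term of the logarithmic derivative of the weight at `x` in the direction `v`. -/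
def StateMeasure.logTerm (m : StateMeasure) {n : ℕ} (x v : Fin n → ℝ) (i j : Fin n) : ℝ :=
  2 * ((v i - v j) / (x i - x j)) - m.kappa * ((v i + v j) / (x i + x j))

/-- The logarithmic derivative of the weight at `x` in the direction `v`. -/
def StateMeasure.logDeriv (m : StateMeasure) {n : ℕ} (x v : Fin n → ℝ) : ℝ :=
  1 / 2 * ∑ i, ∑ j, m.logTerm x v i j

theorem StateMeasure.logTerm_comm (m : StateMeasure) {n : ℕ} (x v : Fin n → ℝ) (i j : Fin n) :
    m.logTerm x v i j = m.logTerm x v j i := by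
  unfold logTerm
  rw [← neg_sub (v j), ← neg_sub (x j), neg_div_neg_eq, add_comm (v i), add_comm (x i)]

/-- On the diagonal the first quotient is $0/0=0$, and half of the remainder is the logarithmic
derivative of $x_i^{-\kappa/2}$. One sum over all ordered pairs thus includes the one-point factors.
-/
theorem StateMeasure.logTerm_self (m : StateMeasure) {n : ℕ} (x v : Fin n → ℝ) (i : Fin n) :
    m.logTerm x v i i = - (m.kappa * (v i / x i)) := by
  have : (v i + v i) / (x i + x i) = v i / x i := by
    rw [← two_mul, ← two_mul, mul_div_mul_left _ _ two_ne_zero]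
  simp [logTerm, this]

theorem sum_sum_eq_diag_add_Ioi {n : ℕ} {f : Fin n → Fin n → ℝ} (hf : ∀ i j, f i j = f j i) :
    ∑ i, ∑ j, f i j = ∑ i, f i i + 2 * ∑ i, ∑ j ∈ Finset.Ioi i, f i j := by
  have h := Finset.sum_sum_Ioi_add_eq_sum_sum_off_diag f
  have h1 (i : Fin n) : ∑ j, f i j = f i i + ∑ j ∈ {i}ᶜ, f j i := by
    rw [← Finset.sum_add_sum_compl {i}, Finset.sum_singleton]
    congr 1
    exact Finset.sum_congr rfl fun j _ => hf i j
  simp_rw [h1, Finset.sum_add_distrib]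
  rw [← h, Finset.mul_sum]
  congr 1
  refine Finset.sum_congr rfl fun i _ => ?_
  rw [Finset.mul_sum]
  exact Finset.sum_congr rfl fun j _ => by rw [hf j i]; ring

theorem StateMeasure.hasDerivAt_single (m : StateMeasure) {f : ℝ → ℝ} {f' t : ℝ}
    (hf : HasDerivAt f f' t) (h0 : 0 < f t) :
    HasDerivAt (fun u => m.single (f u)) (m.single (f t) * (-(m.kappa / 2 * (f' / f t)))) t := by
  cases m
  · simpa [single, kappa] using hasDerivAt_const t (1 : ℝ)
  · have hs := Real.sqrt_pos.mpr h0
    refine ((hf.sqrt h0.ne').inv hs.ne').congr_deriv ?_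
    simp only [single, kappa]
    have := Real.sq_sqrt h0.le
    rw [this]
    field_simp

/-- Where $f=g$ the pair factor has a double zero, so both sides vanish whatever value the quotient
takes. -/
theorem StateMeasure.hasDerivAt_pair (m : StateMeasure) {f g : ℝ → ℝ} {f' g' t : ℝ}
    (hf : HasDerivAt f f' t) (hg : HasDerivAt g g' t) (h0 : 0 < f t) (h1 : 0 < g t) :
    HasDerivAt (fun u => m.pair (f u) (g u)) (m.pair (f t) (g t) *
      (2 * ((f' - g') / (f t - g t)) - m.kappa * ((f' + g') / (f t + g t)))) t := by
  have hs : f t + g t ≠ 0 := by positivity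
  have hp := (hf.sub hg).pow 2
  cases m
  · refine hp.congr_deriv ?_
    simp only [pair, kappa]
    by_cases h : f t - g t = 0
    · simp [h]
    · field_simp
      simp
      ring
  · refine (hp.div (hf.add hg) hs).congr_deriv ?_
    simp only [pair, kappa]
    by_cases h : f t - g t = 0
    · simp [h]
    · simp only [Pi.sub_apply, Pi.pow_apply, Pi.add_apply]
      field_simp
      ring

theorem StateMeasure.hasDerivAt_weight (m : StateMeasure) {n : ℕ} {x : ℝ → Fin n → ℝ}
    {v : Fin n → ℝ} {t : ℝ} (hx : ∀ i, HasDerivAt (fun u => x u i) (v i) t) (h0 : ∀ i, 0 < x t i) :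
    HasDerivAt (fun u => m.weight (x u)) (m.weight (x t) * m.logDeriv (x t) v) t := by
  have h1 := hasDerivAt_prod_of_logDeriv Finset.univ fun i _ => m.hasDerivAt_single (hx i) (h0 i)
  have h2 := hasDerivAt_prod_of_logDeriv Finset.univ fun (i : Fin n) _ =>
    hasDerivAt_prod_of_logDeriv (Finset.Ioi i) fun j _ =>
      m.hasDerivAt_pair (hx i) (hx j) (h0 i) (h0 j)
  simp only [weight_eq]
  refine (h1.mul h2).congr_deriv ?_
  rw [logDeriv, sum_sum_eq_diag_add_Ioi (m.logTerm_comm (x t) v)]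
  simp_rw [logTerm_self]
  simp only [logTerm, Finset.sum_neg_distrib, ← Finset.mul_sum]
  ring

/-! ### The pairwise virial identity -/

/-- The divergence, relative to the weight, of the field `x_p x_q (x_p - x_q) (e_p - e_q)`. -/
def StateMeasure.pairDiv (m : StateMeasure) {n : ℕ} (p q : Fin n) (x : Fin n → ℝ) : ℝ :=
  4 * (x p * x q) - x p ^ 2 - x q ^ 2 +
    x p * x q * (x p - x q) * m.logDeriv x (Pi.single p 1 - Pi.single q 1)

theorem StateMeasure.measurable_pairDiv (m : StateMeasure) {n : ℕ} (p q : Fin n) :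
    Measurable (m.pairDiv p q) := by
  unfold pairDiv logDeriv logTerm
  fun_prop

theorem abs_single_sub_single_le {n : ℕ} (p q i : Fin n) :
    |(Pi.single p 1 - Pi.single q 1 : Fin n → ℝ) i| ≤ 1 := by
  simp only [Pi.sub_apply, Pi.single_apply]
  split_ifs <;> simp

theorem StateMeasure.kappa_mem (m : StateMeasure) : 0 ≤ m.kappa ∧ m.kappa ≤ 1 := by
  cases m <;> simp [kappa]

/-- On the diagonal, the factor $x_px_q$ of the field absorbs $v_i/x_i$, which is nonzero only for
$i\in\{p,q\}$. Off the diagonal, one factor $|x_i-x_j|$ of the weight absorbs the pole, and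
$|x_i-x_j|\le x_i+x_j$ lets it absorb the other quotient too. The constant is $2\cdot2+2=6$. -/
theorem StateMeasure.abs_weight_mul_logTerm_le (m : StateMeasure) {n : ℕ} {x : Fin n → ℝ}
    (hx : ∀ i, 0 < x i) (hx1 : ∀ i, x i ≤ 1) (p q i j : Fin n) :
    |m.weight x * (x p * x q * (x p - x q)) *
      m.logTerm x (Pi.single p 1 - Pi.single q 1) i j| ≤ 6 * dirichletDensity x := by
  set v : Fin n → ℝ := Pi.single p 1 - Pi.single q 1 with hv
  have hvi := fun i => abs_single_sub_single_le p q i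
  have hw := m.weight_nonneg fun i => (hx i).le
  have hd : 0 ≤ dirichletDensity x := hw.trans (m.weight_le hx hx1)
  obtain ⟨hk0, hk1⟩ := m.kappa_mem
  have hsub : |x p - x q| ≤ 1 := by
    have := hx p; have := hx q; have := hx1 p; have := hx1 q
    exact abs_le.mpr ⟨by linarith, by linarith⟩
  have hc (r : Fin n) (hr : r = p ∨ r = q) : |x p * x q * (x p - x q)| ≤ x r := by
    have hp := hx p; have hq := hx q; have hp1 := hx1 p; have hq1 := hx1 q
    rw [abs_mul, abs_of_pos (mul_pos hp hq)]
    refine (mul_le_of_le_one_right (mul_pos hp hq).le hsub).trans ?_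
    rcases hr with rfl | rfl
    · exact mul_le_of_le_one_right hp.le hq1
    · exact mul_le_of_le_one_left hq.le hp1
  by_cases hij : i = j
  · subst hij
    rw [logTerm_self, abs_mul, abs_mul (m.weight x), abs_of_nonneg hw, abs_neg, abs_mul m.kappa,
      abs_of_nonneg hk0, abs_div, abs_of_pos (hx i)]
    have h1 : |x p * x q * (x p - x q)| * (|v i| / x i) ≤ 1 := by
      by_cases h : i = p ∨ i = q
      · rw [mul_div_assoc', div_le_one (hx i)]
        exact (mul_le_of_le_one_right (abs_nonneg _) (hvi i)).trans (hc i h)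
      · push Not at h
        simp [hv, h.1, h.2]
    have h2 : |x p * x q * (x p - x q)| * (m.kappa * (|v i| / x i)) ≤ 1 := by
      rw [mul_left_comm]
      exact mul_le_one₀ hk1 (by have := hx i; positivity) h1
    rw [mul_assoc]
    have := mul_le_mul (m.weight_le hx hx1) h2 (by have := hx i; positivity) hd
    linarith
  · have hwl := m.weight_le_mul hx hx1 hij
    have hc1 : |x p * x q * (x p - x q)| ≤ 1 := (hc p (Or.inl rfl)).trans (hx1 p)
    rw [mul_right_comm, abs_mul]
    refine (mul_le_of_le_one_right (abs_nonneg _) hc1).trans ?_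
    rw [abs_mul, abs_of_nonneg hw]
    by_cases hne : x i - x j = 0
    · rw [hne] at hwl
      have : m.weight x = 0 := le_antisymm (by simpa using hwl) hw
      rw [this]; simp only [zero_mul]; positivity
    · have hpos : 0 < |x i - x j| := abs_pos.mpr hne
      have hle : |x i - x j| ≤ x i + x j := by
        have := hx i; have := hx j
        exact abs_le.mpr ⟨by linarith, by linarith⟩
      have t1 : |v i - v j| ≤ 2 := (abs_sub _ _).trans (by linarith [hvi i, hvi j])
      have t2 : |v i + v j| ≤ 2 := (abs_add_le _ _).trans (by linarith [hvi i, hvi j])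
      have ht : |m.logTerm x v i j| ≤ 6 / |x i - x j| := by
        unfold logTerm
        refine (abs_sub _ _).trans ?_
        rw [abs_mul, abs_mul, abs_div, abs_div, abs_of_nonneg hk0, abs_of_pos (hpos.trans_le hle),
          abs_two]
        have e1 : |v i - v j| / |x i - x j| ≤ 2 / |x i - x j| := by gcongr
        have e2 : |v i + v j| / (x i + x j) ≤ 2 / |x i - x j| := by gcongr
        have e3 : m.kappa * (|v i + v j| / (x i + x j)) ≤ 2 / |x i - x j| :=
          (mul_le_of_le_one_left (by have := hx i; have := hx j; positivity) hk1).trans e2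
        have : 6 / |x i - x j| = 2 * (2 / |x i - x j|) + 2 / |x i - x j| := by ring
        linarith
      calc m.weight x * |m.logTerm x v i j| ≤ (|x i - x j| * dirichletDensity x) * (6 / |x i - x j|) :=
            mul_le_mul hwl ht (abs_nonneg _) (by positivity)
        _ = 6 * dirichletDensity x := by field_simp

theorem StateMeasure.integrableOn_weight_mul_pairDiv (m : StateMeasure) {k : ℕ} (p q : Fin (k + 1)) :
    IntegrableOn (fun y => m.weight (simplexExt y) * m.pairDiv p q (simplexExt y)) (simplexChart k) := by
  refine ((integrableOn_dirichletDensity k).const_mul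
      (6 + 1 / 2 * ∑ _i : Fin (k + 1), ∑ _j : Fin (k + 1), 6)).mono'
    ((m.measurable_weight.mul (m.measurable_pairDiv p q)).comp
      continuous_simplexExt.measurable).aestronglyMeasurable ?_
  filter_upwards [ae_restrict_mem (measurableSet_simplexChart k)] with y hy
  set x := simplexExt y
  have hx : ∀ i, 0 < x i := hy
  have hx1 : ∀ i, x i ≤ 1 := simplexExt_le_one hy
  have hw := m.weight_nonneg fun i => (hx i).le
  have e : m.weight x * m.pairDiv p q x = m.weight x * (4 * (x p * x q) - x p ^ 2 - x q ^ 2) +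
      1 / 2 * ∑ i, ∑ j, m.weight x * (x p * x q * (x p - x q)) *
        m.logTerm x (Pi.single p 1 - Pi.single q 1) i j := by
    simp only [← Finset.mul_sum, pairDiv, logDeriv]
    ring
  rw [e, Real.norm_eq_abs, add_mul]
  refine (abs_add_le _ _).trans (add_le_add ?_ ?_)
  · rw [abs_mul, abs_of_nonneg hw, mul_comm]
    refine mul_le_mul ?_ (m.weight_le hx hx1) hw (by norm_num)
    have := hx p; have := hx q; have := hx1 p; have := hx1 q
    rw [abs_le]
    constructor <;> nlinarith
  · rw [abs_mul, mul_assoc (1 / 2 : ℝ) (∑ _i, ∑ _j, _), Finset.sum_mul,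
      abs_of_pos (by norm_num : (0 : ℝ) < 1 / 2)]
    refine mul_le_mul_of_nonneg_left ?_ (by norm_num)
    refine (Finset.abs_sum_le_sum_abs _ _).trans (Finset.sum_le_sum fun i _ => ?_)
    rw [Finset.sum_mul]
    exact (Finset.abs_sum_le_sum_abs _ _).trans (Finset.sum_le_sum fun j _ =>
      m.abs_weight_mul_logTerm_le hx hx1 p q i j)

/-- Only integrable slices need to be treated, since Fubini makes almost every slice integrable. -/
theorem integral_eq_zero_of_slices {k : ℕ} (j : Fin (k + 1)) {f : (Fin (k + 1) → ℝ) → ℝ}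
    (hf : Integrable f)
    (h : ∀ z : Fin k → ℝ, Integrable (fun τ : ℝ => f (j.insertNth τ z)) →
      ∫ τ : ℝ, f (j.insertNth τ z) = 0) : ∫ y, f y = 0 := by
  have e := (volume_preserving_piFinSuccAbove (fun _ : Fin (k + 1) => ℝ) j).symm
  rw [← e.integral_comp' f]
  have hint : Integrable (fun a : ℝ × (Fin k → ℝ) =>
      f ((MeasurableEquiv.piFinSuccAbove (fun _ => ℝ) j).symm a)) :=
    (e.integrable_comp_emb (MeasurableEquiv.measurableEmbedding _)).mpr hf
  rw [Measure.volume_eq_prod] at hint ⊢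
  rw [integral_prod_symm _ hint]
  refine integral_eq_zero_of_ae ?_
  filter_upwards [hint.prod_left_ae] with z hz
  exact h z hz

/-- The factors $x_p$ and $x_q$ of the field turn the singularity $x^{-1/2}$ into $\sqrt x$, so the
primitive extends continuously to the faces. -/
theorem StateMeasure.continuous_single_mul (m : StateMeasure) : Continuous fun t => m.single t * t := by
  cases m
  · simp only [single]; fun_prop
  · have : (fun t => StateMeasure.bures.single t * t) = Real.sqrt := by
      ext t
      rw [single, mul_comm, ← div_eq_mul_inv, Real.div_sqrt]
    rw [this]
    exact Real.continuous_sqrt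

theorem StateMeasure.continuousOn_pair (m : StateMeasure) {f g : ℝ → ℝ} {s : Set ℝ}
    (hf : ContinuousOn f s) (hg : ContinuousOn g s) (h : ∀ t ∈ s, f t + g t ≠ 0) :
    ContinuousOn (fun t => m.pair (f t) (g t)) s := by
  cases m
  · exact (hf.sub hg).pow 2
  · exact ((hf.sub hg).pow 2).div (hf.add hg) h

/-- The coordinates along a line of the simplex in the direction `e_j - e_last`. -/
theorem simplexExt_insertNth {k : ℕ} (j : Fin (k + 1)) (τ : ℝ) (z : Fin k → ℝ) :
    simplexExt (j.insertNth (α := fun _ => ℝ) τ z) j.castSucc = τ ∧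
    simplexExt (j.insertNth (α := fun _ => ℝ) τ z) (Fin.last (k + 1)) = (1 - ∑ l, z l) - τ ∧
    ∀ l, simplexExt (j.insertNth (α := fun _ => ℝ) τ z) (j.succAbove l).castSucc = z l := by
  refine ⟨by simp, ?_, fun l => by simp⟩
  rw [simplexExt_last, Fin.sum_univ_succAbove _ j]
  simp
  ring

theorem forall_fin_castSucc_succAbove {k : ℕ} (j : Fin (k + 1)) {P : Fin (k + 2) → Prop}
    (h1 : P j.castSucc) (h2 : P (Fin.last _)) (h3 : ∀ l, P (j.succAbove l).castSucc) : ∀ i, P i := by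
  intro i
  refine Fin.lastCases h2 (fun i => ?_) i
  exact Fin.succAboveCases (α := fun i => P i.castSucc) j h1 h3 i

/-- In the chart the direction $e_j-e_{\mathrm{last}}$ is the $j$-th coordinate axis. On a slice the
integrand is the derivative of `F`, weight times $x_px_q(x_p-x_q)$, which vanishes at both ends
because $x_px_q$ does. -/
theorem StateMeasure.integral_slice_eq_zero (m : StateMeasure) {k : ℕ} (j : Fin (k + 1))
    (z : Fin k → ℝ) (hint : Integrable fun τ : ℝ => (simplexChart (k + 1)).indicator
      (fun y => m.weight (simplexExt y) * m.pairDiv j.castSucc (Fin.last _) (simplexExt y))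
        (j.insertNth τ z)) :
    ∫ τ : ℝ, (simplexChart (k + 1)).indicator
      (fun y => m.weight (simplexExt y) * m.pairDiv j.castSucc (Fin.last _) (simplexExt y))
        (j.insertNth τ z) = 0 := by
  set s : ℝ := 1 - ∑ l, z l with hs
  let x : ℝ → Fin (k + 2) → ℝ := fun τ => simplexExt (j.insertNth (α := fun _ => ℝ) τ z)
  set p : Fin (k + 2) := j.castSucc with hp
  set q : Fin (k + 2) := Fin.last _ with hq
  have hxp (τ : ℝ) : x τ p = τ := (simplexExt_insertNth j τ z).1
  have hxq (τ : ℝ) : x τ q = s - τ := (simplexExt_insertNth j τ z).2.1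
  have hxl (τ : ℝ) (l : Fin k) : x τ (j.succAbove l).castSucc = z l := (simplexExt_insertNth j τ z).2.2 l
  by_cases hz : (∀ l, 0 < z l) ∧ 0 < s
  -- If some fixed coordinate or the remaining mass `s` is not positive, the slice misses the open
  -- simplex; otherwise it meets it in $(0,s)$.
  swap
  · have hnot (τ : ℝ) : j.insertNth (α := fun _ => ℝ) τ z ∉ simplexChart (k + 1) := by
      intro hmem
      have hmem' : ∀ i, 0 < x τ i := hmem
      refine hz ⟨fun l => (hxl τ l) ▸ hmem' _, ?_⟩
      have h1 := hmem' p
      have h2 := hmem' q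
      rw [hxp] at h1
      rw [hxq] at h2
      linarith
    simp [Set.indicator_of_notMem (hnot _)]
  obtain ⟨hz0, hs0⟩ := hz
  have hmem (τ : ℝ) : j.insertNth (α := fun _ => ℝ) τ z ∈ simplexChart (k + 1) ↔ τ ∈ Set.Ioo 0 s := by
    change (∀ i, 0 < x τ i) ↔ _
    constructor
    · intro h
      have h1 := h p
      have h2 := h q
      rw [hxp] at h1
      rw [hxq] at h2
      exact ⟨h1, by linarith⟩
    · intro h
      refine forall_fin_castSucc_succAbove j ?_ ?_ fun l => ?_
      · exact (hxp τ).symm ▸ h.1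
      · exact (hxq τ).symm ▸ sub_pos.mpr h.2
      · exact (hxl τ l).symm ▸ hz0 l
  let F : ℝ → ℝ := fun τ => m.weight (x τ) * (x τ p * x τ q * (x τ p - x τ q))
  let F' : ℝ → ℝ := fun τ => m.weight (x τ) * m.pairDiv p q (x τ)
  have hind : (fun τ : ℝ => (simplexChart (k + 1)).indicator
      (fun y => m.weight (simplexExt y) * m.pairDiv p q (simplexExt y)) (j.insertNth τ z)) =
      (Set.Ioo 0 s).indicator F' := by
    ext τ
    by_cases h : τ ∈ Set.Ioo 0 s
    · rw [Set.indicator_of_mem h, Set.indicator_of_mem ((hmem τ).mpr h)]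
    · rw [Set.indicator_of_notMem h, Set.indicator_of_notMem (mt (hmem τ).mp h)]
  rw [hind] at hint ⊢
  rw [integral_indicator measurableSet_Ioo, ← integral_Ioc_eq_integral_Ioo,
    ← intervalIntegral.integral_of_le hs0.le]
  have hxd (τ : ℝ) (i : Fin (k + 2)) :
      HasDerivAt (fun u => x u i) ((Pi.single p 1 - Pi.single q 1 : Fin (k + 2) → ℝ) i) τ := by
    have hpq : p ≠ q := Fin.castSucc_ne_last j
    revert i
    refine forall_fin_castSucc_succAbove j ?_ ?_ fun l => ?_
    · simp only [← hp, hxp]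
      simpa [hpq] using hasDerivAt_id' τ
    · simp only [← hq, hxq]
      simpa [hpq.symm] using (hasDerivAt_id' τ).const_sub s
    · simp only [hxl]
      have h1 : (j.succAbove l).castSucc ≠ p := by simp [hp, Fin.succAbove_ne]
      have h2 : (j.succAbove l).castSucc ≠ q := Fin.castSucc_ne_last _
      simpa [h1, h2] using hasDerivAt_const τ (z l)
  have hxc (i : Fin (k + 2)) : Continuous fun τ => x τ i :=
    continuous_iff_continuousAt.mpr fun τ => (hxd τ i).continuousAt
  have hderiv : ∀ τ ∈ Set.Ioo 0 s, HasDerivAt F (F' τ) τ := by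
    intro τ hτ
    have h1 := m.hasDerivAt_weight (hxd τ) ((hmem τ).mpr hτ)
    have hpq : p ≠ q := Fin.castSucc_ne_last j
    have dp := hxd τ p
    have dq := hxd τ q
    simp [hpq] at dp
    simp [hpq.symm] at dq
    refine (h1.mul ((dp.mul dq).mul (dp.sub dq))).congr_deriv ?_
    simp only [F', pairDiv, Pi.mul_apply, Pi.sub_apply]
    ring
  have hcont : ContinuousOn F (Set.Icc 0 s) := by
    have hF : F = fun τ => (m.single (x τ p) * x τ p) * (m.single (x τ q) * x τ q) *
        (∏ l, m.single (z l)) * (∏ i, ∏ i' ∈ Finset.Ioi i, m.pair (x τ i) (x τ i')) *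
          (x τ p - x τ q) := by
      ext τ
      simp only [F, weight_eq]
      rw [Fin.prod_univ_castSucc, Fin.prod_univ_succAbove _ j]
      simp only [hxl]
      ring
    rw [hF]
    refine ContinuousOn.mul (ContinuousOn.mul (Continuous.continuousOn ?_) ?_) (by fun_prop)
    · exact ((m.continuous_single_mul.comp (hxc p)).mul (m.continuous_single_mul.comp (hxc q))).mul
        continuous_const
    · refine continuousOn_finsetProd _ fun i _ => continuousOn_finsetProd _ fun i' hi' =>
        m.continuousOn_pair (hxc i).continuousOn (hxc i').continuousOn fun τ hτ => ?_
      have hne : i ≠ i' := (Finset.mem_Ioi.mp hi').ne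
      have hnn : ∀ r, 0 ≤ x τ r := forall_fin_castSucc_succAbove j ((hxp τ).symm ▸ hτ.1)
        ((hxq τ).symm ▸ sub_nonneg.mpr hτ.2) fun l => (hxl τ l).symm ▸ (hz0 l).le
      have hcase : ∀ r, x τ r = 0 → r = p ∨ r = q := forall_fin_castSucc_succAbove j
        (fun _ => Or.inl rfl) (fun _ => Or.inr rfl) fun l h => by
          rw [hxl] at h; exact absurd h (hz0 l).ne'
      -- On the closed slice only $x_p$ and $x_q$ can vanish, and $x_p+x_q=s>0$; so no denominator
      -- of a pair factor is zero.
      intro hsum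
      have hi0 : x τ i = 0 := by linarith [hnn i, hnn i']
      have hi0' : x τ i' = 0 := by linarith [hnn i, hnn i']
      have hsum' : x τ p + x τ q = 0 := by
        rcases hcase i hi0 with rfl | rfl <;> rcases hcase i' hi0' with rfl | rfl
        · exact absurd rfl hne
        · exact hsum
        · linarith
        · exact absurd rfl hne
      rw [hxp, hxq] at hsum'
      linarith
  rw [intervalIntegral.integral_eq_sub_of_hasDerivAt_of_le hs0.le hcont hderiv]
  · simp only [F, hxp, hxq]
    ring
  · rw [intervalIntegrable_iff_integrableOn_Ioo_of_le hs0.le]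
    exact (integrable_indicator_iff measurableSet_Ioo).mp hint

theorem StateMeasure.setIntegral_pairDiv_last (m : StateMeasure) {k : ℕ} (j : Fin k) :
    ∫ y in simplexChart k, m.weight (simplexExt y) * m.pairDiv j.castSucc (Fin.last _) (simplexExt y) = 0 := by
  cases k with
  | zero => exact j.elim0
  | succ k =>
    rw [← integral_indicator (measurableSet_simplexChart _)]
    refine integral_eq_zero_of_slices j ?_ fun z hz => m.integral_slice_eq_zero j z hz
    exact (integrable_indicator_iff (measurableSet_simplexChart _)).mpr
      (m.integrableOn_weight_mul_pairDiv _ _)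

theorem StateMeasure.pairDiv_comp (m : StateMeasure) {n : ℕ} (σ : Equiv.Perm (Fin n)) (p q : Fin n)
    (x : Fin n → ℝ) : m.pairDiv p q (x ∘ σ) = m.pairDiv (σ p) (σ q) x := by
  have hv (i : Fin n) : (Pi.single p 1 - Pi.single q 1 : Fin n → ℝ) i =
      (Pi.single (σ p) 1 - Pi.single (σ q) 1 : Fin n → ℝ) (σ i) := by
    simp [Pi.single_apply]
  have hl : m.logDeriv (x ∘ σ) (Pi.single p 1 - Pi.single q 1) =
      m.logDeriv x (Pi.single (σ p) 1 - Pi.single (σ q) 1) := by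
    unfold logDeriv logTerm
    congr 1
    conv_rhs => rw [← Equiv.sum_comp σ]
    refine Finset.sum_congr rfl fun i _ => ?_
    conv_rhs => rw [← Equiv.sum_comp σ]
    refine Finset.sum_congr rfl fun j _ => ?_
    rw [hv i, hv j]
    rfl
  simp only [pairDiv, hl, Function.comp]

/-- A pair not ending at the last index is carried to one that does by `simplexSwap`, under which
volume, chart and weight are invariant. -/
theorem StateMeasure.setIntegral_pairDiv (m : StateMeasure) {k : ℕ} {p q : Fin (k + 1)} (hpq : p ≠ q) :
    ∫ y in simplexChart k, m.weight (simplexExt y) * m.pairDiv p q (simplexExt y) = 0 := by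
  have hlast (p : Fin (k + 1)) (hp : p ≠ Fin.last k) : ∫ y in simplexChart k,
      m.weight (simplexExt y) * m.pairDiv p (Fin.last k) (simplexExt y) = 0 := by
    obtain ⟨j, rfl⟩ := Fin.exists_castSucc_eq.mpr hp
    exact m.setIntegral_pairDiv_last j
  by_cases hq : q = Fin.last k
  · subst hq; exact hlast p hpq
  obtain ⟨j, rfl⟩ := Fin.exists_castSucc_eq.mpr hq
  set σ := Equiv.swap j.castSucc (Fin.last k) with hσ
  have h0 := hlast (σ p) (by
    rw [← Equiv.swap_apply_left j.castSucc (Fin.last k)]; exact σ.injective.ne hpq)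
  rw [← integral_indicator (measurableSet_simplexChart _)] at h0 ⊢
  rw [← h0]
  have hmp := measurePreserving_simplexSwap j
  have hF : AEStronglyMeasurable ((simplexChart k).indicator fun y =>
      m.weight (simplexExt y) * m.pairDiv (σ p) (Fin.last k) (simplexExt y))
        (Measure.map (simplexSwap j) volume) :=
    (((m.measurable_weight.mul (m.measurable_pairDiv _ _)).comp
      continuous_simplexExt.measurable).indicator (measurableSet_simplexChart k)).aestronglyMeasurable
  rw [← hmp.map_eq] 
  rw [integral_map hmp.measurable.aemeasurable hF]
  rw [hmp.map_eq]
  congr 1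
  ext y
  by_cases hy : y ∈ simplexChart k
  · rw [Set.indicator_of_mem hy, Set.indicator_of_mem ((simplexSwap_mem_iff j y).mpr hy),
      simplexExt_simplexSwap, m.weight_comp fun i => (hy i).le, pairDiv_comp]
    simp [hσ]
  · rw [Set.indicator_of_notMem hy, Set.indicator_of_notMem (mt (simplexSwap_mem_iff j y).mp hy)]

/-! ### The mean purity -/

theorem StateMeasure.isLinearMap_logDeriv (m : StateMeasure) {n : ℕ} (x : Fin n → ℝ) :
    IsLinearMap ℝ (m.logDeriv x) := by
  constructor
  · intro v w
    simp only [logDeriv, ← mul_add, ← Finset.sum_add_distrib]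
    congr 1
    refine Finset.sum_congr rfl fun i _ => Finset.sum_congr rfl fun j _ => ?_
    simp only [logTerm, Pi.add_apply]
    ring
  · intro c v
    simp only [logDeriv, smul_eq_mul, Finset.mul_sum]
    refine Finset.sum_congr rfl fun i _ => Finset.sum_congr rfl fun j _ => ?_
    simp only [logTerm, Pi.smul_apply, smul_eq_mul]
    ring

/-- The sum `∑_{i,j} (x_i² + x_j²) / (x_i + x_j)`. -/
def buresSum {n : ℕ} (x : Fin n → ℝ) : ℝ := ∑ i, ∑ j, (x i ^ 2 + x j ^ 2) / (x i + x j)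

/-- Termwise $(x+y)/2\le(x^2+y^2)/(x+y)\le x+y$, and $\sum_{i,j}(x_i+x_j)=2n$. -/
theorem buresSum_mem {n : ℕ} {x : Fin n → ℝ} (hx : ∀ i, 0 < x i) (hs : ∑ i, x i = 1) :
    n ≤ buresSum x ∧ buresSum x ≤ 2 * n := by
  have e : ∑ i, ∑ j, (x i + x j) = 2 * n := by
    simp [Finset.sum_add_distrib, hs, ← Finset.mul_sum]
    ring
  constructor
  · have : (n : ℝ) = ∑ i, ∑ j, (x i + x j) / 2 := by
      simp_rw [← Finset.sum_div, e]; ring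
    rw [this]
    refine Finset.sum_le_sum fun i _ => Finset.sum_le_sum fun j _ => ?_
    have hi := hx i
    have hj := hx j
    rw [div_le_div_iff₀ (by norm_num) (by positivity)]
    nlinarith [sq_nonneg (x i - x j)]
  · rw [← e]
    refine Finset.sum_le_sum fun i _ => Finset.sum_le_sum fun j _ => ?_
    have hi := hx i
    have hj := hx j
    rw [div_le_iff₀ (by positivity)]
    nlinarith

/-- For $v_i=x_i^2-x_iP$ the divided difference is $x_i+x_j-P$, so the Vandermonde part becomes
explicit; only $(x_i^2+x_j^2)/(x_i+x_j)$ does not simplify. -/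
theorem StateMeasure.logDeriv_radial (m : StateMeasure) {n : ℕ} {x : Fin n → ℝ}
    (hx : ∀ i, 0 < x i) (hs : ∑ i, x i = 1) (hi : Function.Injective x) :
    m.logDeriv x (fun i => x i ^ 2 - x i * ∑ l, x l ^ 2) =
      2 * n - 2 - n * (n - 1) * (∑ l, x l ^ 2) - m.kappa / 2 * (buresSum x - n ^ 2 * ∑ l, x l ^ 2) := by
  set P := ∑ l, x l ^ 2 with hP
  have ht (i j : Fin n) : m.logTerm x (fun i => x i ^ 2 - x i * P) i j =
      2 * (x i + x j - P) - (if i = j then 2 * (2 * x i - P) else 0) -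
        m.kappa * ((x i ^ 2 + x j ^ 2) / (x i + x j) - P) := by
    have h1 : x i + x j ≠ 0 := (add_pos (hx i) (hx j)).ne'
    have e2 : (x i ^ 2 - x i * P + (x j ^ 2 - x j * P)) / (x i + x j) =
        (x i ^ 2 + x j ^ 2) / (x i + x j) - P := by field_simp; ring
    -- The correction at $i=j$ accounts for $0/0=0$.
    have e1 : (x i ^ 2 - x i * P - (x j ^ 2 - x j * P)) / (x i - x j) =
        x i + x j - P - (if i = j then 2 * x i - P else 0) := by
      by_cases h : i = j
      · subst h; simp; ring
      · have : x i - x j ≠ 0 := sub_ne_zero.mpr (hi.ne h)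
        simp only [h, if_false]
        field_simp
        ring
    simp only [logTerm, e1, e2]
    split_ifs <;> ring
  simp only [logDeriv, ht, buresSum, Finset.sum_sub_distrib, Finset.sum_ite_eq, Finset.mem_univ,
    if_true, ← Finset.mul_sum, Finset.sum_add_distrib, hs, Finset.sum_const, Finset.card_univ,
    Fintype.card_fin, nsmul_eq_mul]
  ring

/-- By linearity in the direction, the pair fields add up to $2(x_i^2-x_i\sum_l x_l^2)_i$. The
pairwise form serves the integration by parts, the summed form the evaluation. -/
theorem StateMeasure.sum_pairDiv (m : StateMeasure) {n : ℕ} {x : Fin n → ℝ}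
    (hx : ∀ i, 0 < x i) (hs : ∑ i, x i = 1) (hi : Function.Injective x) :
    ∑ p, ∑ q, (if p = q then 0 else m.pairDiv p q x) =
      4 * n - m.kappa * buresSum x - (2 * (n ^ 2 + 1) - m.kappa * n ^ 2) * ∑ l, x l ^ 2 := by
  have hdiag (p q : Fin n) : (if p = q then 0 else m.pairDiv p q x) =
      (4 * (x p * x q) - x p ^ 2 - x q ^ 2 - if p = q then 2 * x p ^ 2 else 0) +
        x p * x q * (x p - x q) * m.logDeriv x (Pi.single p 1 - Pi.single q 1) := by
    by_cases h : p = q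
    · subst h; simp; ring
    · simp [h, pairDiv]
  have hrad : ∑ p, ∑ q, x p * x q * (x p - x q) * m.logDeriv x (Pi.single p 1 - Pi.single q 1) =
      2 * m.logDeriv x (fun i => x i ^ 2 - x i * ∑ l, x l ^ 2) := by
    let L := IsLinearMap.mk' _ (m.isLinearMap_logDeriv x)
    change ∑ p, ∑ q, x p * x q * (x p - x q) * L (Pi.single p 1 - Pi.single q 1) =
      2 * L (fun i => x i ^ 2 - x i * ∑ l, x l ^ 2)
    simp_rw [← smul_eq_mul (_ * _) (L _), ← map_smul, ← map_sum]
    rw [← smul_eq_mul, ← map_smul]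
    congr 1
    ext i
    simp only [Finset.sum_apply, Pi.smul_apply, Pi.sub_apply, smul_eq_mul, mul_sub,
      Finset.sum_sub_distrib, Pi.single_apply, mul_ite, mul_one, mul_zero]
    simp only [Finset.sum_ite_eq, Finset.mem_univ, if_true, Finset.sum_ite_irrel, Finset.sum_const_zero]
    have e1 : ∑ q, x i * x q * x i = x i ^ 2 := by
      rw [← Finset.sum_mul, ← Finset.mul_sum, hs]; ring
    have e2 : ∑ q, x i * x q * x q = x i * ∑ l, x l ^ 2 := by
      rw [Finset.mul_sum]; exact Finset.sum_congr rfl fun _ _ => by ring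
    have e3 : ∑ p, x p * x i * x p = x i * ∑ l, x l ^ 2 := by
      rw [Finset.mul_sum]; exact Finset.sum_congr rfl fun _ _ => by ring
    have e4 : ∑ p, x p * x i * x i = x i ^ 2 := by
      rw [← Finset.sum_mul, ← Finset.sum_mul, hs]; ring
    rw [Finset.sum_sub_distrib, Finset.sum_sub_distrib, e1, e2, e3, e4]
    ring
  simp only [hdiag, Finset.sum_add_distrib, hrad, m.logDeriv_radial hx hs hi]
  simp only [Finset.sum_sub_distrib, ← Finset.mul_sum, ← Finset.sum_mul, hs, Finset.sum_const,
    Finset.card_univ, Fintype.card_fin, nsmul_eq_mul, Finset.sum_ite_eq, Finset.mem_univ, if_true]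
  ring

/-- The mean of `∑ x_i²` over the levels of a random state. -/
def meanSumSq (m : StateMeasure) (n : ℕ) : ℝ := ∫ x, ∑ i, x i ^ 2 ∂(stateLevels m n)

theorem StateMeasure.integrableOn_weight_mul (m : StateMeasure) {k : ℕ} {f : (Fin (k + 1) → ℝ) → ℝ}
    (hf : Measurable f) {C : ℝ} (hC : ∀ y ∈ simplexChart k, |f (simplexExt y)| ≤ C) :
    IntegrableOn (fun y => m.weight (simplexExt y) * f (simplexExt y)) (simplexChart k) := by
  refine ((m.integrableOn_weight k).mul_const C).mono'
    ((m.measurable_weight.mul hf).comp continuous_simplexExt.measurable).aestronglyMeasurable ?_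
  filter_upwards [ae_restrict_mem (measurableSet_simplexChart k)] with y hy
  have hw := m.weight_nonneg fun i => (hy i).le
  rw [Real.norm_eq_abs, abs_mul, abs_of_nonneg hw]
  exact mul_le_mul_of_nonneg_left (hC y hy) hw

theorem sum_sq_le_one {n : ℕ} {x : Fin n → ℝ} (hx : ∀ i, 0 ≤ x i) (hs : ∑ i, x i = 1) :
    ∑ i, x i ^ 2 ≤ 1 := by
  calc ∑ i, x i ^ 2 ≤ ∑ i, x i := Finset.sum_le_sum fun i _ => by
        have : x i ≤ 1 := hs ▸ Finset.single_le_sum (fun j _ => hx j) (Finset.mem_univ i)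
        nlinarith [hx i]
    _ = 1 := hs

theorem measurable_sum_sq {n : ℕ} : Measurable fun x : Fin n → ℝ => ∑ i, x i ^ 2 := by fun_prop

/-- The mean purity is known exactly for the Hilbert–Schmidt measure and up to `buresSum` for the
Bures measure. -/
theorem meanSumSq_virial (m : StateMeasure) (k : ℕ) :
    (2 - m.kappa) * ((k : ℝ) + 1) ≤ (((k : ℝ) + 1) ^ 2 + 1 - m.kappa / 2 * ((k : ℝ) + 1) ^ 2) * meanSumSq m (k + 1) ∧
    (((k : ℝ) + 1) ^ 2 + 1 - m.kappa / 2 * ((k : ℝ) + 1) ^ 2) * meanSumSq m (k + 1) ≤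
      (2 - m.kappa / 2) * ((k : ℝ) + 1) := by
  set n : ℝ := (k : ℝ) + 1 with hn
  have hZ := m.partition_pos k
  obtain ⟨hk0, hk1⟩ := m.kappa_mem
  set a : ℝ := 2 * (n ^ 2 + 1) - m.kappa * n ^ 2 with ha
  have hsq : IntegrableOn (fun y => m.weight (simplexExt y) * ∑ i, simplexExt y i ^ 2) (simplexChart k) :=
    m.integrableOn_weight_mul (f := fun x => ∑ i, x i ^ 2) measurable_sum_sq (C := 1) fun y hy => by
      rw [abs_of_nonneg (Finset.sum_nonneg fun i _ => sq_nonneg _)]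
      exact sum_sq_le_one (fun i => (hy i).le) (sum_simplexExt y)
  have hP : m.partition k * meanSumSq m (k + 1) =
      ∫ y in simplexChart k, m.weight (simplexExt y) * ∑ i, simplexExt y i ^ 2 := by
    rw [meanSumSq, integral_stateLevels m k measurable_sum_sq, mul_inv_cancel_left₀ hZ.ne']
  have hlin (c : ℝ) : ∫ y in simplexChart k, (c * m.weight (simplexExt y) -
      a * (m.weight (simplexExt y) * ∑ i, simplexExt y i ^ 2)) =
      m.partition k * (c - a * meanSumSq m (k + 1)) := by
    rw [integral_sub ((m.integrableOn_weight k).const_mul c) (hsq.const_mul a), integral_const_mul,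
      integral_const_mul, ← hP, StateMeasure.partition]
    ring
  have hlint (c : ℝ) : IntegrableOn (fun y => c * m.weight (simplexExt y) -
      a * (m.weight (simplexExt y) * ∑ i, simplexExt y i ^ 2)) (simplexChart k) :=
    ((m.integrableOn_weight k).const_mul c).sub (hsq.const_mul a)
  have hDint (p q : Fin (k + 1)) : IntegrableOn (fun y => m.weight (simplexExt y) *
      (if p = q then 0 else m.pairDiv p q (simplexExt y))) (simplexChart k) := by
    by_cases h : p = q
    · simp [h]
    · simpa only [h, if_false] using m.integrableOn_weight_mul_pairDiv p q
  have hD : ∫ y in simplexChart k, m.weight (simplexExt y) *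
      ∑ p, ∑ q, (if p = q then 0 else m.pairDiv p q (simplexExt y)) = 0 := by
    simp_rw [Finset.mul_sum]
    rw [integral_finsetSum _ fun p _ => integrable_finsetSum _ fun q _ => hDint p q]
    refine Finset.sum_eq_zero fun p _ => ?_
    rw [integral_finsetSum _ fun q _ => hDint p q]
    refine Finset.sum_eq_zero fun q _ => ?_
    by_cases h : p = q
    · simp [h]
    · simpa only [h, if_false] using m.setIntegral_pairDiv h
  have hDi : IntegrableOn (fun y => m.weight (simplexExt y) *
      ∑ p, ∑ q, (if p = q then 0 else m.pairDiv p q (simplexExt y))) (simplexChart k) := by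
    simp_rw [Finset.mul_sum]
    exact integrable_finsetSum _ fun p _ => integrable_finsetSum _ fun q _ => hDint p q
  have hpt : ∀ y ∈ simplexChart k, m.weight (simplexExt y) *
      (∑ p, ∑ q, (if p = q then 0 else m.pairDiv p q (simplexExt y))) =
      m.weight (simplexExt y) * (4 * n - m.kappa * buresSum (simplexExt y) -
        a * ∑ i, simplexExt y i ^ 2) := by
    intro y hy
    -- The evaluation of the divergence needs distinct coordinates; elsewhere the weight is zero, so
    -- the weighted identity holds at every point.
    by_cases hi : Function.Injective (simplexExt y)
    · rw [m.sum_pairDiv hy (sum_simplexExt y) hi]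
      push_cast
      rfl
    · rw [m.weight_eq_zero hi]; simp
  have hbur : ∀ y ∈ simplexChart k, n ≤ buresSum (simplexExt y) ∧ buresSum (simplexExt y) ≤ 2 * n := by
    intro y hy
    have := buresSum_mem hy (sum_simplexExt y)
    push_cast at this
    exact this
  -- The two extreme values $2n$ and $n$ of `buresSum` are inserted; for $\kappa=0$ both comparisons
  -- are equalities.
  have hle := setIntegral_mono_on (hlint (4 * n - m.kappa * (2 * n))) hDi
    (measurableSet_simplexChart k) fun y hy => by
      rw [hpt y hy]
      have hw := m.weight_nonneg fun i => (hy i).le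
      have : 0 ≤ m.weight (simplexExt y) * (m.kappa * (2 * n - buresSum (simplexExt y))) :=
        mul_nonneg hw (mul_nonneg hk0 (sub_nonneg.mpr (hbur y hy).2))
      linarith
  have hge := setIntegral_mono_on hDi (hlint (4 * n - m.kappa * n))
    (measurableSet_simplexChart k) fun y hy => by
      rw [hpt y hy]
      have hw := m.weight_nonneg fun i => (hy i).le
      have : 0 ≤ m.weight (simplexExt y) * (m.kappa * (buresSum (simplexExt y) - n)) :=
        mul_nonneg hw (mul_nonneg hk0 (sub_nonneg.mpr (hbur y hy).1))
      linarith
  rw [hlin, hD] at hle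
  rw [hlin, hD] at hge
  have h1 := nonpos_of_mul_nonpos_right hle hZ
  have h2 := nonneg_of_mul_nonneg_right hge hZ
  constructor <;> linarith

/-- The interval is the Bures one, from $n\le(n^2/2+1)P\le 3n/2$; the exact Hilbert–Schmidt value
$2n/(n^2+1)$ also lies in it. -/
theorem meanSumSq_bounds (m : StateMeasure) {n : ℕ} (hn : 1 ≤ n) :
    2 * (n : ℝ) ≤ ((n : ℝ) ^ 2 + 2) * meanSumSq m n ∧ ((n : ℝ) ^ 2 + 2) * meanSumSq m n ≤ 3 * n := by
  obtain ⟨k, rfl⟩ : ∃ k, n = k + 1 := ⟨n - 1, by omega⟩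
  obtain ⟨h1, h2⟩ := meanSumSq_virial m k
  push_cast
  set a : ℝ := (k : ℝ) + 1 with ha
  have ha1 : 1 ≤ a := by have : (0 : ℝ) ≤ k := Nat.cast_nonneg k; linarith
  set P := meanSumSq m (k + 1)
  cases m
  · simp only [StateMeasure.kappa] at h1 h2
    have hP : (a ^ 2 + 1) * P = 2 * a := by linarith
    have hP0 : 0 ≤ P := by
      by_contra! h
      nlinarith
    refine ⟨by nlinarith, ?_⟩
    have : P ≤ a := by
      by_contra! h
      nlinarith
    nlinarith
  · simp only [StateMeasure.kappa] at h1 h2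
    constructor <;> nlinarith

theorem integrable_sum_sq (m : StateMeasure) (k : ℕ) :
    Integrable (fun x => ∑ i, x i ^ 2) (stateLevels m (k + 1)) := by
  refine Integrable.of_bound measurable_sum_sq.aestronglyMeasurable 1 ?_
  filter_upwards [ae_stateLevels m k] with x hx
  rw [Real.norm_of_nonneg (Finset.sum_nonneg fun i _ => sq_nonneg _)]
  exact sum_sq_le_one (fun i => (hx.1 i).le) hx.2

theorem meanSumSq_le_one (m : StateMeasure) {n : ℕ} (hn : 1 ≤ n) : meanSumSq m n ≤ 1 := by
  obtain ⟨k, rfl⟩ : ∃ k, n = k + 1 := ⟨n - 1, by omega⟩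
  have h : ∀ᵐ x ∂(stateLevels m (k + 1)), ∑ i, x i ^ 2 ≤ 1 := by
    filter_upwards [ae_stateLevels m k] with x hx
    exact sum_sq_le_one (fun i => (hx.1 i).le) hx.2
  calc meanSumSq m (k + 1) ≤ ∫ _, (1 : ℝ) ∂(stateLevels m (k + 1)) :=
        integral_mono_ae (integrable_sum_sq m k) (integrable_const _) h
    _ = 1 := by simp

/-! ### The levels of the Gaussian Unitary Ensemble -/

/-- The unnormalized density of the GUE levels. -/
def gueDensity {n : ℕ} (η : ℝ) (x : Fin n → ℝ) : ℝ :=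
  Real.exp (-(η / 2) * ∑ i, x i ^ 2) * vandermondeSq x

theorem vandermondeSq_nonneg {n : ℕ} (x : Fin n → ℝ) : 0 ≤ vandermondeSq x :=
  Finset.prod_nonneg fun _ _ => Finset.prod_nonneg fun _ _ => sq_nonneg _

theorem gueDensity_nonneg {n : ℕ} (η : ℝ) (x : Fin n → ℝ) : 0 ≤ gueDensity η x :=
  mul_nonneg (Real.exp_pos _).le (vandermondeSq_nonneg x)

theorem continuous_gueDensity {n : ℕ} (η : ℝ) : Continuous (gueDensity (n := n) η) := by
  unfold gueDensity vandermondeSq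
  fun_prop

theorem integrable_one_add_sq_pow_mul_exp {b : ℝ} (hb : 0 < b) (l : ℕ) :
    Integrable fun x : ℝ => (1 + x ^ 2) ^ l * Real.exp (-b * x ^ 2) := by
  have h (a : ℕ) : Integrable fun x : ℝ => (x ^ 2) ^ a * Real.exp (-b * x ^ 2) := by
    have := integrable_rpow_mul_exp_neg_mul_sq hb (s := ((2 * a : ℕ) : ℝ)) (by
      have : (0 : ℝ) ≤ ((2 * a : ℕ) : ℝ) := Nat.cast_nonneg _
      linarith)
    simpa only [Real.rpow_natCast, pow_mul] using this
  simp_rw [add_pow, one_pow, one_mul, Finset.sum_mul]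
  refine integrable_finsetSum _ fun a _ => ?_
  refine ((h (l - a)).const_mul (l.choose a : ℝ)).congr (ae_of_all _ fun x => ?_)
  simp only
  ring

/-- Since $(x_i-x_j)^2\le 2(1+x_i^2)(1+x_j^2)$ and the right side is at least $1$, the Vandermonde
factor can be bounded by the product over all ordered pairs. This separates the variables. -/
theorem integrable_gueDensity {n : ℕ} {η : ℝ} (hη : 0 < η) : Integrable (gueDensity (n := n) η) := by
  have hg : Integrable fun x : Fin n → ℝ => (2 ^ n) ^ n *
      ∏ i, ((1 + x i ^ 2) ^ (2 * n) * Real.exp (-(η / 2) * x i ^ 2)) :=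
    (Integrable.fintype_prod (μ := fun _ => volume) (f := fun (_ : Fin n) (t : ℝ) =>
      (1 + t ^ 2) ^ (2 * n) * Real.exp (-(η / 2) * t ^ 2))
      fun _ => integrable_one_add_sq_pow_mul_exp (half_pos hη) _).const_mul _
  refine hg.mono' (continuous_gueDensity η).aestronglyMeasurable (ae_of_all _ fun x => ?_)
  rw [Real.norm_of_nonneg (gueDensity_nonneg η x), gueDensity, Finset.mul_sum, Real.exp_sum,
    Finset.prod_mul_distrib, mul_comm, ← mul_assoc]
  refine mul_le_mul_of_nonneg_right ?_ (Finset.prod_nonneg fun _ _ => (Real.exp_pos _).le)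
  have h1 : vandermondeSq x ≤ ∏ i, ∏ j, (2 * (1 + x i ^ 2) * (1 + x j ^ 2)) := by
    refine Finset.prod_le_prod (fun i _ => Finset.prod_nonneg fun _ _ => sq_nonneg _) fun i _ => ?_
    refine (Finset.prod_le_prod (fun j _ => sq_nonneg _) fun j _ =>
      (show (x i - x j) ^ 2 ≤ 2 * (1 + x i ^ 2) * (1 + x j ^ 2) by
        nlinarith [sq_nonneg (x i + x j), mul_nonneg (sq_nonneg (x i)) (sq_nonneg (x j))])).trans ?_
    exact Finset.prod_le_prod_of_subset_of_one_le (Finset.subset_univ _) (fun j _ => by positivity)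
      fun j _ _ => by nlinarith [mul_nonneg (sq_nonneg (x i)) (sq_nonneg (x j)), sq_nonneg (x i), sq_nonneg (x j)]
  refine h1.trans_eq ?_
  simp_rw [Finset.prod_mul_distrib, Finset.prod_const, Finset.card_univ, Fintype.card_fin,
    Finset.prod_pow]
  ring

theorem gueDensity_pos {n : ℕ} (η : ℝ) {x : Fin n → ℝ} (hx : Function.Injective x) :
    0 < gueDensity η x := by
  refine mul_pos (Real.exp_pos _) (Finset.prod_pos fun i _ => Finset.prod_pos fun j hj => ?_)
  have := sub_ne_zero.mpr (hx.ne (Finset.mem_Ioi.mp hj).ne)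
  positivity

/-- The unnormalized law of the GUE levels. -/
def gueWeight (n : ℕ) (η : ℝ) : Measure (Fin n → ℝ) :=
  volume.withDensity fun x => ENNReal.ofReal (gueDensity η x)

theorem gueLevels_eq (n : ℕ) (η : ℝ) : gueLevels n η = normalized (gueWeight n η) := rfl

theorem gueWeight_univ_ne_top {n : ℕ} {η : ℝ} (hη : 0 < η) : gueWeight n η Set.univ ≠ ⊤ := by
  rw [gueWeight, withDensity_apply _ MeasurableSet.univ, Measure.restrict_univ,
    ← ofReal_integral_eq_lintegral_ofReal (integrable_gueDensity hη)
      (ae_of_all _ (gueDensity_nonneg η))]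
  exact ENNReal.ofReal_ne_top

theorem gueWeight_univ_ne_zero (n : ℕ) (η : ℝ) : gueWeight n η Set.univ ≠ 0 := by
  rw [gueWeight, withDensity_apply _ MeasurableSet.univ, Measure.restrict_univ,
    Ne, lintegral_eq_zero_iff (continuous_gueDensity η).measurable.ennreal_ofReal]
  intro h
  have hpos := (isOpen_injective n).measure_pos volume
    ⟨fun i => (i : ℕ), fun i j h => Fin.ext (Nat.cast_injective (R := ℝ) h)⟩
  refine hpos.ne' (measure_mono_null (fun x hx => ?_) (ae_iff.mp h))
  simpa using gueDensity_pos η hx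

theorem isProbabilityMeasure_gueLevels (n : ℕ) {η : ℝ} (hη : 0 < η) :
    IsProbabilityMeasure (gueLevels n η) :=
  isProbabilityMeasure_normalized (gueWeight_univ_ne_zero n η) (gueWeight_univ_ne_top hη)

theorem gueLevels_absolutelyContinuous (n : ℕ) (η : ℝ) : gueLevels n η ≪ volume :=
  (Measure.AbsolutelyContinuous.smul_left (withDensity_absolutelyContinuous _ _) _)

/-- The levels have a density, and $x_i=x_j$ cuts out a proper subspace, which is Lebesgue null. -/
theorem ae_gueLevels_ne {n : ℕ} (η : ℝ) {i j : Fin n} (hij : i ≠ j) :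
    ∀ᵐ x ∂(gueLevels n η), x i ≠ x j := by
  refine (gueLevels_absolutelyContinuous n η).ae_le ?_
  let ℓ : (Fin n → ℝ) →ₗ[ℝ] ℝ := LinearMap.proj (R := ℝ) (φ := fun _ => ℝ) i - LinearMap.proj j
  have h := Measure.addHaar_submodule volume (LinearMap.ker ℓ) (by
    intro htop
    have : Pi.single i (1 : ℝ) ∈ LinearMap.ker ℓ := htop ▸ Submodule.mem_top
    simp [ℓ, hij.symm] at this)
  refine measure_mono_null (fun x hx => ?_) h
  have : x i = x j := by simpa using hx
  simp [ℓ, this]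

theorem normalized_smul {α : Type*} [MeasurableSpace α] (μ : Measure α) {c : ENNReal} (h0 : c ≠ 0)
    (h1 : c ≠ ⊤) : normalized (c • μ) = normalized μ := by
  simp only [normalized, Measure.smul_apply, smul_eq_mul, smul_smul]
  congr 1
  rw [ENNReal.mul_inv (Or.inl h0) (Or.inl h1), mul_right_comm, ENNReal.inv_mul_cancel h0 h1, one_mul]

theorem map_normalized {α β : Type*} [MeasurableSpace α] [MeasurableSpace β] (μ : Measure α) {f : α → β}
    (hf : Measurable f) : (normalized μ).map f = normalized (μ.map f) := by
  rw [normalized, normalized, Measure.map_smul, Measure.map_apply hf MeasurableSet.univ,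
    Set.preimage_univ]

/-- The GUE levels with scale factor `η` are `η^(-1/2)` times those with scale factor one. -/
theorem gueLevels_eq_map (n : ℕ) {η : ℝ} (hη : 0 < η) :
    gueLevels n η = (gueLevels n 1).map fun x => (√η)⁻¹ • x := by
  set c : ℝ := (√η)⁻¹ with hc
  have hcpos : 0 < c := inv_pos.mpr (Real.sqrt_pos.mpr hη)
  have hmeas : Measurable fun x : Fin n → ℝ => c • x := by fun_prop
  set k : ℝ := ∏ i : Fin n, ∏ _j ∈ Finset.Ioi i, c ^ 2 with hk
  have hkpos : 0 < k := Finset.prod_pos fun _ _ => Finset.prod_pos fun _ _ => by positivity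
  have hden (x : Fin n → ℝ) : gueDensity η (c • x) = k * gueDensity 1 x := by
    have hc2 : η * c ^ 2 = 1 := by
      rw [hc, inv_pow, Real.sq_sqrt hη.le, mul_inv_cancel₀ hη.ne']
    have h1 : vandermondeSq (c • x) = k * vandermondeSq x := by
      simp only [vandermondeSq, hk, ← Finset.prod_mul_distrib, Pi.smul_apply, smul_eq_mul]
      exact Finset.prod_congr rfl fun i _ => Finset.prod_congr rfl fun j _ => by ring
    have h2 : -(η / 2) * ∑ i, (c • x) i ^ 2 = -(1 / 2) * ∑ i, x i ^ 2 := by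
      simp only [Pi.smul_apply, smul_eq_mul, mul_pow, ← Finset.mul_sum]
      rw [← mul_assoc, show -(η / 2) * c ^ 2 = -(1 / 2) * (η * c ^ 2) by ring, hc2, mul_one]
    rw [gueDensity, h1, h2, gueDensity]
    ring
  -- The Jacobian and the homogeneity factor `k` of the Vandermonde product are constants, which
  -- disappear on normalization.
  have hmap : (gueWeight n 1).map (fun x => c • x) =
      (ENNReal.ofReal k⁻¹ * ENNReal.ofReal |(c ^ n)⁻¹|) • gueWeight n η := by
    have hvol : (volume : Measure (Fin n → ℝ)).map (fun x => c • x) =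
        ENNReal.ofReal |(c ^ n)⁻¹| • volume := by
      have := Measure.map_addHaar_smul (volume : Measure (Fin n → ℝ)) hcpos.ne'
      simpa using this
    ext s hs
    have hgm : Measurable fun x : Fin n → ℝ => ENNReal.ofReal (gueDensity η x) :=
      (continuous_gueDensity η).measurable.ennreal_ofReal
    have hset := setLIntegral_map (μ := (volume : Measure (Fin n → ℝ))) hs hgm hmeas
    rw [hvol, Measure.restrict_smul, lintegral_smul_measure] at hset
    rw [Measure.map_apply hmeas hs, gueWeight, withDensity_apply _ (hmeas hs), Measure.smul_apply,
      gueWeight, withDensity_apply _ hs, smul_eq_mul, mul_assoc, ← smul_eq_mul (ENNReal.ofReal |_|), hset,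
      ← lintegral_const_mul _ (f := fun x : Fin n → ℝ => ENNReal.ofReal (gueDensity η (c • x))) (hgm.comp hmeas)]
    refine lintegral_congr fun x => ?_
    rw [hden, ← ENNReal.ofReal_mul (by positivity), inv_mul_cancel_left₀ hkpos.ne']
  rw [gueLevels_eq, gueLevels_eq, map_normalized _ hmeas, hmap, normalized_smul]
  · simp only [ne_eq, mul_eq_zero, ENNReal.ofReal_eq_zero, not_or, not_le]
    exact ⟨by positivity, by positivity⟩
  · exact ENNReal.mul_ne_top ENNReal.ofReal_ne_top ENNReal.ofReal_ne_top

/-- The Riemann–Lebesgue lemma for the level differences. -/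
theorem tendsto_integral_exp_gueLevels {n : ℕ} (η : ℝ) {i j : Fin n} (hij : i ≠ j) :
    Tendsto (fun φ : ℝ => ∫ x, Complex.exp (-(Complex.I * (φ * (x i - x j) : ℝ))) ∂(gueLevels n η))
      (cocompact ℝ) (𝓝 0) := by
  let ℓ : StrongDual ℝ (Fin n → ℝ) := ContinuousLinearMap.proj (R := ℝ) (φ := fun _ => ℝ) i - ContinuousLinearMap.proj j
  -- The factor $(2\pi)^{-1}$ matches the normalization of the Fourier character. Multiples of a
  -- nonzero functional leave every compact set, so Riemann–Lebesgue in the dual space applies along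
  -- this line.
  have hℓ : ((2 * Real.pi)⁻¹ : ℝ) • ℓ ≠ 0 := by
    intro h
    have := congrArg (fun f : StrongDual ℝ (Fin n → ℝ) => f (Pi.single i 1)) h
    simp [ℓ, hij.symm, Real.pi_ne_zero] at this
  have hRL := (tendsto_integral_exp_smul_cocompact (fun x : Fin n → ℝ => (gueDensity η x : ℂ)) volume).comp
    (isClosedEmbedding_smul_left (𝕜 := ℝ) hℓ).tendsto_cocompact
  have hmul := hRL.const_mul (((gueWeight n η Set.univ)⁻¹).toReal : ℂ)
  rw [mul_zero] at hmul
  refine hmul.congr fun φ => ?_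
  rw [gueLevels_eq, normalized, integral_smul_measure, gueWeight,
    integral_withDensity_eq_integral_toReal_smul
      ((continuous_gueDensity η).measurable.ennreal_ofReal)
      (ae_of_all _ fun _ => ENNReal.ofReal_lt_top)]
  rw [Complex.real_smul]
  congr 1
  refine integral_congr_ae (ae_of_all _ fun x => ?_)
  simp only [Circle.smul_def, Real.fourierChar_apply, smul_eq_mul, Complex.real_smul]
  rw [ENNReal.toReal_ofReal (gueDensity_nonneg η x), mul_comm]
  congr 2
  simp [ℓ]
  have : (Real.pi : ℂ) ≠ 0 := by exact_mod_cast Real.pi_ne_zero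
  field_simp

/-! ### The unitary evolution -/

theorem continuous_matrix_exp (n : ℕ) : Continuous (NormedSpace.exp : Mat n → Mat n) := by
  let : NormedRing (Mat n) := Matrix.linftyOpNormedRing
  let : NormedAlgebra ℂ (Mat n) := Matrix.linftyOpNormedAlgebra
  let : NormedAlgebra ℚ (Mat n) := NormedAlgebra.restrictScalars ℚ ℂ (Mat n)
  exact NormedSpace.exp_continuous

theorem continuous_evol (n : ℕ) : Continuous fun p : ℝ × Mat n => evol p.1 p.2 := by
  refine (continuous_matrix_exp n).comp ?_
  fun_prop

theorem evol_add {n : ℕ} (s t : ℝ) (B : Mat n) : evol (s + t) B = evol s B * evol t B := by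
  unfold evol
  rw [← Matrix.exp_add_of_commute]
  · congr 1
    rw [← add_smul]
    congr 1
    push_cast
    ring
  · exact ((Commute.refl B).smul_left _).smul_right _

@[simp] theorem evol_zero {n : ℕ} (B : Mat n) : evol 0 B = 1 := by
  simp [evol]

theorem evol_mul_evol_neg {n : ℕ} (s : ℝ) (B : Mat n) : evol s B * evol (-s) B = 1 := by
  rw [← evol_add, add_neg_cancel, evol_zero]

theorem evol_neg_mul_evol {n : ℕ} (s : ℝ) (B : Mat n) : evol (-s) B * evol s B = 1 := by
  rw [← evol_add, neg_add_cancel, evol_zero]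

theorem evol_smul {n : ℕ} (s c : ℝ) (B : Mat n) : evol s (c • B) = evol (c * s) B := by
  unfold evol
  congr 1
  ext i j
  simp
  ring

theorem star_evol {n : ℕ} (s : ℝ) {B : Mat n} (hB : B.IsHermitian) : star (evol s B) = evol (-s) B := by
  unfold evol
  rw [Matrix.star_eq_conjTranspose, ← Matrix.exp_conjTranspose, Matrix.conjTranspose_smul, hB.eq]
  simp

theorem evol_mem_unitaryGroup {n : ℕ} (s : ℝ) {B : Mat n} (hB : B.IsHermitian) :
    evol s B ∈ Matrix.unitaryGroup (Fin n) ℂ := by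
  rw [Matrix.mem_unitaryGroup_iff, star_evol s hB, evol_mul_evol_neg]

theorem evol_conj {n : ℕ} (s : ℝ) (B : Mat n) (V : UMat n) :
    evol s ((V : Mat n) * B * star (V : Mat n)) = V * evol s B * star (V : Mat n) := by
  have h := Matrix.exp_units_conj (Unitary.toUnits V) ((-(Complex.I * (s : ℂ))) • B)
  unfold evol
  have e : (-(Complex.I * (s : ℂ))) • ((V : Mat n) * B * star (V : Mat n)) =
      (V : Mat n) * ((-(Complex.I * (s : ℂ))) • B) * star (V : Mat n) := by
    rw [Matrix.mul_smul, Matrix.smul_mul]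
  rw [e]
  exact h

theorem evol_diagonal {n : ℕ} (s : ℝ) (b : Fin n → ℝ) :
    evol s (Matrix.diagonal fun i => (b i : ℂ)) =
      Matrix.diagonal fun i => Complex.exp (-(Complex.I * (s * b i : ℝ))) := by
  unfold evol
  rw [← Matrix.diagonal_smul, Matrix.exp_diagonal]
  congr 1
  ext i
  rw [Pi.coe_exp, ← Complex.exp_eq_exp_ℂ]
  congr 1
  simp
  ring

theorem evol_fromSpectral {n : ℕ} (s : ℝ) (b : Fin n → ℝ) (W : UMat n) :
    evol s (fromSpectral (b, W)) =
      W * (Matrix.diagonal fun i => Complex.exp (-(Complex.I * (s * b i : ℝ)))) * star (W : Mat n) := by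
  rw [fromSpectral, evol_conj, evol_diagonal]

theorem isHermitian_fromSpectral {n : ℕ} (s : (Fin n → ℝ) × UMat n) : (fromSpectral s).IsHermitian := by
  unfold Matrix.IsHermitian fromSpectral
  rw [Matrix.star_eq_conjTranspose, Matrix.conjTranspose_mul, Matrix.conjTranspose_mul,
    Matrix.conjTranspose_conjTranspose, Matrix.diagonal_conjTranspose, mul_assoc]
  congr 3
  ext i
  simp

theorem continuous_fromSpectral (n : ℕ) : Continuous (fromSpectral (n := n)) := by
  unfold fromSpectral
  have h1 : Continuous fun s : (Fin n → ℝ) × UMat n => (s.2 : Mat n) :=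
    continuous_subtype_val.comp continuous_snd
  have h2 : Continuous fun s : (Fin n → ℝ) × UMat n => Matrix.diagonal fun i => (s.1 i : ℂ) :=
    Continuous.matrix_diagonal (by fun_prop)
  exact (h1.mul h2).mul h1.star

theorem star_mul_self_UMat {n : ℕ} (V : UMat n) : star (V : Mat n) * (V : Mat n) = 1 :=
  Matrix.mem_unitaryGroup_iff'.mp V.2

theorem mul_star_self_UMat {n : ℕ} (V : UMat n) : (V : Mat n) * star (V : Mat n) = 1 :=
  Matrix.mem_unitaryGroup_iff.mp V.2

theorem fromSpectral_mul {n : ℕ} (b : Fin n → ℝ) (V W : UMat n) :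
    fromSpectral (b, V * W) = (V : Mat n) * fromSpectral (b, W) * star (V : Mat n) := by
  simp [fromSpectral, mul_assoc]

theorem fromSpectral_smul {n : ℕ} (c : ℝ) (b : Fin n → ℝ) (W : UMat n) :
    fromSpectral (c • b, W) = c • fromSpectral (b, W) := by
  have : (Matrix.diagonal fun i => ((c • b) i : ℂ)) = c • Matrix.diagonal fun i => (b i : ℂ) := by
    rw [← Matrix.diagonal_smul]
    congr 1
    ext i
    simp
  simp only [fromSpectral, this, Matrix.mul_smul, Matrix.smul_mul]

/-! ### Density matrices -/

/-- The density matrices. -/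
def densitySet (n : ℕ) : Set (Mat n) :=
  fromSpectral '' (stdSimplex ℝ (Fin n) ×ˢ Set.univ)

/-- Closedness supplies the measurability needed to transfer almost-sure membership through
`fromSpectral`. -/
theorem isClosed_densitySet (n : ℕ) : IsClosed (densitySet n) :=
  (((isCompact_stdSimplex ℝ (Fin n)).prod isCompact_univ).image (continuous_fromSpectral n)).isClosed

theorem trace_conj {n : ℕ} (V : UMat n) (A : Mat n) :
    ((V : Mat n) * A * star (V : Mat n)).trace = A.trace := by
  rw [Matrix.trace_mul_cycle, star_mul_self_UMat, one_mul]

theorem conj_mul_conj {n : ℕ} (V : UMat n) (A B : Mat n) :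
    ((V : Mat n) * A * star (V : Mat n)) * ((V : Mat n) * B * star (V : Mat n)) =
      (V : Mat n) * (A * B) * star (V : Mat n) := by
  calc _ = (V : Mat n) * A * (star (V : Mat n) * (V : Mat n)) * B * star (V : Mat n) := by
        simp only [mul_assoc]
    _ = _ := by rw [star_mul_self_UMat, mul_one, mul_assoc (V : Mat n) A B]

theorem purity_conj {n : ℕ} (V : UMat n) (ρ : Mat n) :
    purity ((V : Mat n) * ρ * star (V : Mat n)) = purity ρ := by
  rw [purity, conj_mul_conj, trace_conj, purity]

theorem purity_diagonal {n : ℕ} (x : Fin n → ℝ) :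
    purity (Matrix.diagonal fun i => (x i : ℂ)) = ∑ i, x i ^ 2 := by
  simp [purity, Matrix.diagonal_mul_diagonal, Matrix.trace_diagonal, sq]

theorem purity_fromSpectral {n : ℕ} (s : (Fin n → ℝ) × UMat n) :
    purity (fromSpectral s) = ∑ i, s.1 i ^ 2 := by
  rw [fromSpectral, purity_conj, purity_diagonal]

/-! ### Observables of a single apparatus -/

/-- The squared modulus `|tr(e^{-iφB} ρ)|²`. -/
def decoherenceObs {n : ℕ} (φ : ℝ) (B ρ : Mat n) : ℝ := ‖(evol φ B * ρ).trace‖ ^ 2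

/-- The super-fidelity of `e^{-iφB} ρ e^{iφB}` and `ρ`. -/
def fidelityObs {n : ℕ} (φ : ℝ) (B ρ : Mat n) : ℝ :=
  (evol φ B * ρ * evol (-φ) B * ρ).trace.re + |1 - purity ρ|

theorem purity_condState {n : ℕ} (a t : ℝ) (B ρ : Mat n) : purity (condState a t B ρ) = purity ρ := by
  unfold purity condState
  congr 1
  calc _ = (evol (a * t) B * (ρ * (evol (-(a * t)) B * evol (a * t) B) * ρ) * evol (-(a * t)) B).trace := by
        simp only [mul_assoc]
    _ = _ := by rw [evol_neg_mul_evol, mul_one, Matrix.trace_mul_cycle, evol_neg_mul_evol, one_mul]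

/-- Conjugation preserves purity, so the square root is that of a square; cyclicity of the trace
leaves only the relative phase $(a-a')t$. -/
theorem superFidelity_condState {n : ℕ} (a a' t : ℝ) (B ρ : Mat n) :
    superFidelity (condState a t B ρ) (condState a' t B ρ) = fidelityObs ((a - a') * t) B ρ := by
  unfold superFidelity fidelityObs
  rw [purity_condState, purity_condState, Real.sqrt_mul_self_eq_abs]
  congr 2
  have h1 : evol ((a - a') * t) B = evol (-(a' * t)) B * evol (a * t) B := by
    rw [← evol_add]; congr 1; ring
  have h2 : evol (-((a - a') * t)) B = evol (-(a * t)) B * evol (a' * t) B := by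
    rw [← evol_add]; congr 1; ring
  rw [h1, h2]
  unfold condState
  calc _ = ((evol (a * t) B * ρ * evol (-(a * t)) B * evol (a' * t) B * ρ) * evol (-(a' * t)) B).trace := by
        simp only [mul_assoc]
    _ = (evol (-(a' * t)) B * (evol (a * t) B * ρ * evol (-(a * t)) B * evol (a' * t) B * ρ)).trace :=
        Matrix.trace_mul_comm _ _
    _ = _ := by simp only [mul_assoc]

/-- The properties of an observable of a single apparatus which determine its long-time average:
`F x` is the long-time average for a state with spectrum `x`. -/
structure IsApparatusObservable {n : ℕ} (O : ℝ → Mat n → Mat n → ℝ) (F : (Fin n → ℝ) → ℝ) : Prop where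
  continuous : Continuous fun p : ℝ × Mat n × Mat n => O p.1 p.2.1 p.2.2
  conj : ∀ φ B ρ (V : UMat n),
    O φ ((V : Mat n) * B * star (V : Mat n)) ((V : Mat n) * ρ * star (V : Mat n)) = O φ B ρ
  smul : ∀ φ (c : ℝ) B ρ, O φ (c • B) ρ = O (c * φ) B ρ
  mem_diagonal : ∀ φ B x, B.IsHermitian → x ∈ stdSimplex ℝ (Fin n) →
    O φ B (Matrix.diagonal fun i => (x i : ℂ)) ∈ Set.Icc (0 : ℝ) 2
  tendsto : ∀ x ∈ stdSimplex ℝ (Fin n), Tendsto (fun φ => ∫ s, O φ (fromSpectral s)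
    (Matrix.diagonal fun i => (x i : ℂ)) ∂(gueSpectral n 1)) (cocompact ℝ) (𝓝 (F x))

/-- The state with spectrum `x` in the basis `W`. -/
def rotated {n : ℕ} (x : Fin n → ℝ) (W : UMat n) : Mat n :=
  star (W : Mat n) * (Matrix.diagonal fun i => (x i : ℂ)) * (W : Mat n)

theorem continuous_rotated_apply {n : ℕ} (x : Fin n → ℝ) (k l : Fin n) :
    Continuous fun W => rotated x W k l := by
  have h1 : Continuous fun W : UMat n => (W : Mat n) := continuous_subtype_val
  exact ((h1.star.mul continuous_const).mul h1).matrix_elem k l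

theorem rotated_apply_self {n : ℕ} (x : Fin n → ℝ) (W : UMat n) (k : Fin n) :
    rotated x W k k = ((∑ a, x a * Complex.normSq ((W : Mat n) a k) : ℝ) : ℂ) := by
  unfold rotated
  rw [Matrix.mul_apply]
  push_cast
  refine Finset.sum_congr rfl fun a _ => ?_
  rw [Matrix.mul_diagonal, Matrix.star_apply, Complex.normSq_eq_conj_mul_self]
  simp only [RCLike.star_def]
  ring

theorem exp_mul_conj_exp (u v : ℝ) : Complex.exp (-(Complex.I * (u : ℂ))) *
    (starRingEnd ℂ) (Complex.exp (-(Complex.I * (v : ℂ)))) =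
      Complex.exp (-(Complex.I * ((u - v : ℝ) : ℂ))) := by
  rw [← Complex.exp_conj, ← Complex.exp_add]
  congr 1
  simp
  ring

theorem norm_exp_neg_I_mul (u : ℝ) : ‖Complex.exp (-(Complex.I * (u : ℂ)))‖ = 1 := by
  rw [Complex.norm_exp]; simp

theorem integrable_phase_mul {n : ℕ} (φ : ℝ) (k l : Fin n) {c : UMat n → ℂ} (hc : Continuous c) :
    Integrable (fun s : (Fin n → ℝ) × UMat n =>
      Complex.exp (-(Complex.I * (φ * (s.1 k - s.1 l) : ℝ))) * c s.2) (gueSpectral n 1) := by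
  have := isProbabilityMeasure_gueLevels n one_pos
  refine Integrable.mul_prod (f := fun b : Fin n → ℝ =>
    Complex.exp (-(Complex.I * (φ * (b k - b l) : ℝ)))) ?_ (integrable_haarU hc)
  refine Integrable.of_bound (Continuous.aestronglyMeasurable (by fun_prop)) 1 (ae_of_all _ fun b => ?_)
  rw [norm_exp_neg_I_mul]

theorem trace_evol_mul_diagonal {n : ℕ} (φ : ℝ) (b x : Fin n → ℝ) (W : UMat n) :
    (evol φ (fromSpectral (b, W)) * Matrix.diagonal fun i => (x i : ℂ)).trace =
      ∑ k, Complex.exp (-(Complex.I * (φ * b k : ℝ))) * rotated x W k k := by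
  set D : Mat n := Matrix.diagonal fun i => Complex.exp (-(Complex.I * (φ * b i : ℝ))) with hD
  set X : Mat n := Matrix.diagonal fun i => (x i : ℂ) with hX
  have h : (evol φ (fromSpectral (b, W)) * X).trace = (D * rotated x W).trace := by
    rw [evol_fromSpectral]
    calc _ = ((W : Mat n) * (D * star (W : Mat n) * X)).trace := by simp only [mul_assoc, hD]
      _ = ((D * star (W : Mat n) * X) * (W : Mat n)).trace := Matrix.trace_mul_comm _ _
      _ = _ := by simp only [mul_assoc, rotated, hX]
  rw [h, hD]
  simp only [Matrix.trace, Matrix.diag_apply, Matrix.diagonal_mul]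

theorem trace_evol_conj_mul_diagonal {n : ℕ} (φ : ℝ) (b x : Fin n → ℝ) (W : UMat n) :
    (evol φ (fromSpectral (b, W)) * (Matrix.diagonal fun i => (x i : ℂ)) *
      evol (-φ) (fromSpectral (b, W)) * Matrix.diagonal fun i => (x i : ℂ)).trace =
      ∑ k, ∑ l, Complex.exp (-(Complex.I * (φ * (b k - b l) : ℝ))) *
        (rotated x W k l * rotated x W l k) := by
  set D : Mat n := Matrix.diagonal fun i => Complex.exp (-(Complex.I * (φ * b i : ℝ))) with hD
  set D' : Mat n := Matrix.diagonal fun i => Complex.exp (-(Complex.I * (-φ * b i : ℝ))) with hD'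
  set X : Mat n := Matrix.diagonal fun i => (x i : ℂ) with hX
  have h : (evol φ (fromSpectral (b, W)) * X * evol (-φ) (fromSpectral (b, W)) * X).trace =
      (D * rotated x W * (D' * rotated x W)).trace := by
    rw [evol_fromSpectral, evol_fromSpectral]
    calc _ = ((W : Mat n) * (D * star (W : Mat n) * X * W * D' * star (W : Mat n) * X)).trace := by
          simp only [mul_assoc, hD, hD']
      _ = ((D * star (W : Mat n) * X * W * D' * star (W : Mat n) * X) * (W : Mat n)).trace :=
          Matrix.trace_mul_comm _ _
      _ = _ := by simp only [mul_assoc, rotated, hX]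
  rw [h, hD, hD']
  simp only [Matrix.trace, Matrix.diag_apply, Matrix.mul_apply (M := _ * _), Matrix.diagonal_mul]
  refine Finset.sum_congr rfl fun k _ => Finset.sum_congr rfl fun l _ => ?_
  rw [mul_mul_mul_comm, ← Complex.exp_add]
  congr 2
  push_cast
  ring

/-- Levels and eigenbasis are independent, so each term factorizes. The phase averages vanish in the
limit for $k\ne l$ and equal $1$ for $k=l$, leaving the Haar mean of the squared populations. -/
theorem tendsto_integral_re_sum_phases {n : ℕ} {x : Fin n → ℝ} (hx : ∑ i, x i = 1)
    {c : Fin n → Fin n → UMat n → ℂ} (hc : ∀ k l, Continuous (c k l))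
    (hd : ∀ k W, c k k W = rotated x W k k ^ 2) :
    Tendsto (fun φ : ℝ => ∫ s : (Fin n → ℝ) × UMat n, (∑ k, ∑ l,
      Complex.exp (-(Complex.I * (φ * (s.1 k - s.1 l) : ℝ))) * c k l s.2).re ∂(gueSpectral n 1))
      (cocompact ℝ) (𝓝 ((1 + ∑ i, x i ^ 2) / (n + 1))) := by
  have := isProbabilityMeasure_gueLevels n one_pos
  have hint (φ : ℝ) (k l : Fin n) := integrable_phase_mul φ k l (hc k l)
  have heq (φ : ℝ) : ∫ s : (Fin n → ℝ) × UMat n, (∑ k, ∑ l,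
      Complex.exp (-(Complex.I * (φ * (s.1 k - s.1 l) : ℝ))) * c k l s.2).re ∂(gueSpectral n 1) =
      (∑ k, ∑ l, (∫ b, Complex.exp (-(Complex.I * (φ * (b k - b l) : ℝ))) ∂(gueLevels n 1)) *
        ∫ W, c k l W ∂(haarU n)).re := by
    have h1 := integral_re (𝕜 := ℂ) (integrable_finsetSum Finset.univ fun k _ =>
      integrable_finsetSum Finset.univ fun l _ => hint φ k l)
    simp only [RCLike.re_to_complex] at h1
    rw [h1, integral_finsetSum _ fun k _ => integrable_finsetSum _ fun l _ => hint φ k l]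
    congr 1
    refine Finset.sum_congr rfl fun k _ => ?_
    rw [integral_finsetSum _ fun l _ => hint φ k l]
    refine Finset.sum_congr rfl fun l _ => ?_
    exact integral_prod_mul (μ := gueLevels n 1) (ν := haarU n) (fun b : Fin n → ℝ =>
      Complex.exp (-(Complex.I * (φ * (b k - b l) : ℝ)))) (c k l)
  simp_rw [heq]
  have hlim : Tendsto (fun φ : ℝ => ∑ k, ∑ l,
      (∫ b, Complex.exp (-(Complex.I * (φ * (b k - b l) : ℝ))) ∂(gueLevels n 1)) *
        ∫ W, c k l W ∂(haarU n)) (cocompact ℝ)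
      (𝓝 (∑ k, ∑ l, (if k = l then 1 else 0) * ∫ W, c k l W ∂(haarU n))) := by
    refine tendsto_finsetSum _ fun k _ => tendsto_finsetSum _ fun l _ => Tendsto.mul_const _ ?_
    by_cases h : k = l
    · subst h
      simp
    · simpa [h] using tendsto_integral_exp_gueLevels 1 h
  have hval : ∑ k, ∑ l, (if k = l then 1 else 0) * ∫ W, c k l W ∂(haarU n) =
      (((1 + ∑ i, x i ^ 2) / (n + 1) : ℝ) : ℂ) := by
    rw [← integral_sum_sq_populations hx, ← integral_complex_ofReal]
    simp only [ite_mul, one_mul, zero_mul, Finset.sum_ite_eq, Finset.mem_univ, if_true]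
    rw [← integral_finsetSum _ fun k _ => integrable_haarU (hc k k)]
    refine integral_congr_ae (ae_of_all _ fun W => ?_)
    simp only [hd, rotated_apply_self]
    push_cast
    rfl
  rw [hval] at hlim
  have h := (Complex.continuous_re.tendsto _).comp hlim
  rw [Complex.ofReal_re] at h
  exact h

/-- Expanding $|\sum_k e^{-i\varphi b_k}\rho_{kk}|^2$ gives coefficients
$\rho_{kk}\overline{\rho_{ll}}$, with diagonal $\rho_{kk}^2$ because populations are real. -/
theorem isApparatusObservable_decoherenceObs (n : ℕ) :
    IsApparatusObservable (decoherenceObs (n := n)) fun x => (1 + ∑ i, x i ^ 2) / (n + 1) where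
  continuous := by
    unfold decoherenceObs
    have h1 : Continuous fun p : ℝ × Mat n × Mat n => evol p.1 p.2.1 :=
      (continuous_evol n).comp (continuous_fst.prodMk (continuous_fst.comp continuous_snd))
    exact ((h1.mul (continuous_snd.comp continuous_snd)).matrix_trace.norm).pow 2
  conj φ B ρ V := by
    unfold decoherenceObs
    rw [evol_conj, conj_mul_conj, trace_conj]
  smul φ c B ρ := by
    unfold decoherenceObs
    rw [evol_smul]
  mem_diagonal φ B x hB hx := by
    refine ⟨sq_nonneg _, ?_⟩
    have h : ‖(evol φ B * Matrix.diagonal fun i => (x i : ℂ)).trace‖ ≤ 1 := by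
      simp only [Matrix.trace, Matrix.diag_apply, Matrix.mul_diagonal]
      refine (norm_sum_le _ _).trans ?_
      rw [← hx.2]
      refine Finset.sum_le_sum fun i _ => ?_
      rw [norm_mul, Complex.norm_real, Real.norm_of_nonneg (hx.1 i)]
      exact mul_le_of_le_one_left (hx.1 i) (entry_norm_bound_of_unitary (evol_mem_unitaryGroup φ hB) i i)
    unfold decoherenceObs
    nlinarith [norm_nonneg (evol φ B * Matrix.diagonal fun i => (x i : ℂ)).trace]
  tendsto x hx := by
    refine (tendsto_integral_re_sum_phases hx.2 (c := fun k l W => rotated x W k k *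
      (starRingEnd ℂ) (rotated x W l l)) (fun k l => (continuous_rotated_apply x k k).mul
        (Complex.continuous_conj.comp (continuous_rotated_apply x l l))) fun k W => ?_).congr fun φ => ?_
    · rw [rotated_apply_self, Complex.conj_ofReal, sq]
    · refine integral_congr_ae (ae_of_all _ fun ⟨b, W⟩ => ?_)
      simp only [decoherenceObs, trace_evol_mul_diagonal]
      rw [← Complex.normSq_eq_norm_sq, ← Complex.ofReal_re (Complex.normSq _), Complex.normSq_eq_conj_mul_self,
        map_sum, mul_comm, Finset.sum_mul_sum]
      congr 1
      refine Finset.sum_congr rfl fun k _ => Finset.sum_congr rfl fun l _ => ?_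
      rw [map_mul, mul_mul_mul_comm, exp_mul_conj_exp, mul_sub]

/-- Here the coefficients are $\rho_{kl}\rho_{lk}$: they differ from those of the decoherence factor
only off the diagonal, hence the same limit up to the purity term. -/
theorem isApparatusObservable_fidelityObs (n : ℕ) :
    IsApparatusObservable (fidelityObs (n := n)) fun x =>
      (1 + ∑ i, x i ^ 2) / (n + 1) + (1 - ∑ i, x i ^ 2) where
  continuous := by
    unfold fidelityObs purity
    have h1 : Continuous fun p : ℝ × Mat n × Mat n => evol p.1 p.2.1 :=
      (continuous_evol n).comp (continuous_fst.prodMk (continuous_fst.comp continuous_snd))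
    have h2 : Continuous fun p : ℝ × Mat n × Mat n => evol (-p.1) p.2.1 :=
      (continuous_evol n).comp (continuous_fst.neg.prodMk (continuous_fst.comp continuous_snd))
    have h3 : Continuous fun p : ℝ × Mat n × Mat n => p.2.2 := continuous_snd.comp continuous_snd
    exact (Complex.continuous_re.comp (((h1.mul h3).mul h2).mul h3).matrix_trace).add
      (continuous_const.sub (Complex.continuous_re.comp (h3.mul h3).matrix_trace)).abs
  conj φ B ρ V := by
    unfold fidelityObs
    rw [evol_conj, evol_conj, conj_mul_conj, conj_mul_conj, conj_mul_conj, trace_conj, purity_conj]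
  smul φ c B ρ := by
    unfold fidelityObs
    rw [evol_smul, evol_smul, mul_neg]
  mem_diagonal φ B x hB hx := by
    have hx1 : ∀ i, x i ≤ 1 := fun i =>
      hx.2 ▸ Finset.single_le_sum (fun j _ => hx.1 j) (Finset.mem_univ i)
    have hP1 := sum_sq_le_one hx.1 hx.2
    have hP0 : 0 ≤ ∑ i, x i ^ 2 := Finset.sum_nonneg fun i _ => sq_nonneg _
    let Q : UMat n := ⟨evol φ B, evol_mem_unitaryGroup φ hB⟩
    -- The overlap is $\sum_{i,j}x_ix_j|Q_{ij}|^2$ with rows of $|Q_{ij}|^2$ summing to one, so it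
    -- lies in $[0,1]$; the purity term adds at most $1$, whence the common bound $2$.
    have ht : (evol φ B * (Matrix.diagonal fun i => (x i : ℂ)) * evol (-φ) B *
        Matrix.diagonal fun i => (x i : ℂ)).trace.re =
        ∑ i, ∑ j, x i * (x j * Complex.normSq ((Q : Mat n) i j)) := by
      rw [← star_evol φ hB]
      simp only [Matrix.trace, Matrix.diag_apply, Matrix.mul_diagonal, Matrix.mul_apply (N := star _),
        Matrix.star_apply, Complex.re_sum, Finset.sum_mul]
      refine Finset.sum_congr rfl fun i _ => Finset.sum_congr rfl fun j _ => ?_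
      rw [Complex.normSq_apply]
      simp [Q]
      ring
    unfold fidelityObs
    rw [ht, purity_diagonal, abs_of_nonneg (by linarith)]
    have hle : ∑ i, ∑ j, x i * (x j * Complex.normSq ((Q : Mat n) i j)) ≤ 1 := by
      calc _ ≤ ∑ i, ∑ j, x i * Complex.normSq ((Q : Mat n) i j) :=
            Finset.sum_le_sum fun i _ => Finset.sum_le_sum fun j _ =>
              mul_le_mul_of_nonneg_left (mul_le_of_le_one_left (Complex.normSq_nonneg _) (hx1 j)) (hx.1 i)
        _ = 1 := by simp_rw [← Finset.mul_sum, sum_normSq_row, mul_one, hx.2]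
    have hge : 0 ≤ ∑ i, ∑ j, x i * (x j * Complex.normSq ((Q : Mat n) i j)) :=
      Finset.sum_nonneg fun i _ => Finset.sum_nonneg fun j _ =>
        mul_nonneg (hx.1 i) (mul_nonneg (hx.1 j) (Complex.normSq_nonneg _))
    constructor <;> linarith
  tendsto x hx := by
    have := isProbabilityMeasure_gueLevels n one_pos
    have hP1 := sum_sq_le_one hx.1 hx.2
    have hc (k l : Fin n) : Continuous fun W => rotated x W k l * rotated x W l k :=
      (continuous_rotated_apply x k l).mul (continuous_rotated_apply x l k)
    have h := (tendsto_integral_re_sum_phases hx.2 hc fun k W => (sq _).symm).add_const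
      (1 - ∑ i, x i ^ 2)
    refine h.congr fun φ => ?_
    have hint : Integrable (fun s : (Fin n → ℝ) × UMat n => (∑ k, ∑ l,
        Complex.exp (-(Complex.I * (φ * (s.1 k - s.1 l) : ℝ))) *
          (rotated x s.2 k l * rotated x s.2 l k)).re) (gueSpectral n 1) :=
      (integrable_finsetSum Finset.univ fun k _ => integrable_finsetSum Finset.univ fun l _ =>
        integrable_phase_mul φ k l (hc k l)).re
    have : IsProbabilityMeasure (gueSpectral n 1) := by unfold gueSpectral; infer_instance
    have hconst : ∫ _, (1 - ∑ i, x i ^ 2) ∂(gueSpectral n 1) = 1 - ∑ i, x i ^ 2 := by simp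
    rw [← hconst, ← integral_add hint (integrable_const _)]
    refine integral_congr_ae (ae_of_all _ fun ⟨b, W⟩ => ?_)
    simp only [fidelityObs, trace_evol_conj_mul_diagonal, purity_diagonal]
    rw [abs_of_nonneg (by linarith)]

/-! ### Averages over a single apparatus -/

theorem isProbabilityMeasure_gueSpectral (n : ℕ) {η : ℝ} (hη : 0 < η) :
    IsProbabilityMeasure (gueSpectral n η) := by
  have := isProbabilityMeasure_gueLevels n hη
  unfold gueSpectral
  infer_instance

theorem isProbabilityMeasure_gue (n : ℕ) {η : ℝ} (hη : 0 < η) : IsProbabilityMeasure (gue n η) := by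
  have := isProbabilityMeasure_gueSpectral n hη
  exact Measure.isProbabilityMeasure_map (continuous_fromSpectral n).measurable.aemeasurable

instance instIsProbabilityMeasureStateLaw (m : StateMeasure) (k : ℕ) :
    IsProbabilityMeasure (stateLaw m (k + 1)) :=
  Measure.isProbabilityMeasure_map (continuous_fromSpectral _).measurable.aemeasurable

theorem ae_gue_isHermitian (n : ℕ) (η : ℝ) : ∀ᵐ B ∂(gue n η), B.IsHermitian := by
  have hm : MeasurableSet {B : Mat n | B.IsHermitian} :=
    (isClosed_eq (continuous_star (R := Mat n)) continuous_id).measurableSet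
  exact (ae_map_iff (continuous_fromSpectral n).measurable.aemeasurable hm).mpr
    (ae_of_all _ isHermitian_fromSpectral)

theorem ae_stateLaw_mem_densitySet (m : StateMeasure) (k : ℕ) :
    ∀ᵐ ρ ∂(stateLaw m (k + 1)), ρ ∈ densitySet (k + 1) := by
  refine (ae_map_iff (continuous_fromSpectral _).measurable.aemeasurable
    (isClosed_densitySet _).measurableSet).mpr ?_
  filter_upwards [Measure.quasiMeasurePreserving_fst.ae (ae_stateLevels m k)] with s hs
  exact ⟨s, ⟨⟨fun i => (hs.1 i).le, hs.2⟩, Set.mem_univ _⟩, rfl⟩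

theorem ae_apparatus (m : StateMeasure) (k : ℕ) {η : ℝ} (hη : 0 < η) :
    ∀ᵐ p ∂((gue (k + 1) η).prod (stateLaw m (k + 1))), p.1.IsHermitian ∧ p.2 ∈ densitySet (k + 1) := by
  have := isProbabilityMeasure_gue (k + 1) hη
  exact (Measure.quasiMeasurePreserving_fst.ae (ae_gue_isHermitian (k + 1) η)).and
    (Measure.quasiMeasurePreserving_snd.ae (ae_stateLaw_mem_densitySet m k))

namespace IsApparatusObservable

variable {n : ℕ} {O : ℝ → Mat n → Mat n → ℝ} {F : (Fin n → ℝ) → ℝ}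

theorem apply_fromSpectral (h : IsApparatusObservable O F) (φ : ℝ) (B : Mat n) (x : Fin n → ℝ)
    (V : UMat n) : O φ B (fromSpectral (x, V)) =
      O φ (star (V : Mat n) * B * (V : Mat n)) (Matrix.diagonal fun i => (x i : ℂ)) := by
  rw [← h.conj φ (star (V : Mat n) * B * (V : Mat n)) _ V]
  congr 1
  calc B = ((V : Mat n) * star (V : Mat n)) * B * ((V : Mat n) * star (V : Mat n)) := by
        rw [mul_star_self_UMat, one_mul, mul_one]
    _ = _ := by simp only [mul_assoc]

theorem mem_Icc (h : IsApparatusObservable O F) (φ : ℝ) {B ρ : Mat n} (hB : B.IsHermitian)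
    (hρ : ρ ∈ densitySet n) : O φ B ρ ∈ Set.Icc (0 : ℝ) 2 := by
  obtain ⟨⟨x, V⟩, ⟨hx, -⟩, rfl⟩ := hρ
  rw [h.apply_fromSpectral]
  refine h.mem_diagonal φ _ x ?_ hx
  have := Matrix.isHermitian_conjTranspose_mul_mul (V : Mat n) hB
  rwa [← Matrix.star_eq_conjTranspose] at this

/-- Haar invariance of the eigenbasis of `B` absorbs the eigenbasis `V` of the state. -/
theorem integral_gueSpectral_fromSpectral (h : IsApparatusObservable O F) (φ : ℝ) {η : ℝ} (hη : 0 < η)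
    (x : Fin n → ℝ) (V : UMat n) :
    ∫ s, O φ (fromSpectral s) (fromSpectral (x, V)) ∂(gueSpectral n η) =
      ∫ s, O φ (fromSpectral s) (Matrix.diagonal fun i => (x i : ℂ)) ∂(gueSpectral n η) := by
  have := isProbabilityMeasure_gueLevels n hη
  have hmp : MeasurePreserving (Prod.map id (fun W => V⁻¹ * W) : (Fin n → ℝ) × UMat n → _)
      (gueSpectral n η) (gueSpectral n η) :=
    (MeasurePreserving.id _).prod (measurePreserving_mul_left (haarU n) V⁻¹)
  have hc : Continuous fun s => O φ (fromSpectral s) (Matrix.diagonal fun i => (x i : ℂ)) :=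
    h.continuous.comp (continuous_const.prodMk ((continuous_fromSpectral n).prodMk continuous_const))
  conv_rhs => rw [← hmp.map_eq]
  rw [integral_map hmp.measurable.aemeasurable hc.aestronglyMeasurable]
  refine integral_congr_ae (ae_of_all _ fun ⟨b, W⟩ => ?_)
  simp only [Prod.map, id]
  rw [h.apply_fromSpectral, fromSpectral_mul]
  congr 1
  simp [Matrix.UnitaryGroup.inv_val]

end IsApparatusObservable

/-- The average of an observable of a single apparatus. -/
def apparatusMean (m : StateMeasure) {n : ℕ} (O : ℝ → Mat n → Mat n → ℝ) (η φ : ℝ) : ℝ :=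
  ∫ p, O φ p.1 p.2 ∂((gue n η).prod (stateLaw m n))

namespace IsApparatusObservable

variable {k : ℕ} {O : ℝ → Mat (k + 1) → Mat (k + 1) → ℝ} {F : (Fin (k + 1) → ℝ) → ℝ}

theorem integrable_apparatus (h : IsApparatusObservable O F) (m : StateMeasure) {η : ℝ} (hη : 0 < η)
    (φ : ℝ) : Integrable (fun p : Mat (k + 1) × Mat (k + 1) => O φ p.1 p.2)
      ((gue (k + 1) η).prod (stateLaw m (k + 1))) := by
  have := isProbabilityMeasure_gue (k + 1) hη
  refine Integrable.of_bound (h.continuous.comp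
    (continuous_const.prodMk continuous_id)).aestronglyMeasurable 2 ?_
  filter_upwards [ae_apparatus m k hη] with p hp
  have := h.mem_Icc φ hp.1 hp.2
  rw [Real.norm_of_nonneg this.1]
  exact this.2

theorem apparatusMean_mem_Icc (h : IsApparatusObservable O F) (m : StateMeasure) {η : ℝ} (hη : 0 < η)
    (φ : ℝ) : apparatusMean m O η φ ∈ Set.Icc (0 : ℝ) 2 := by
  have := isProbabilityMeasure_gue (k + 1) hη
  have hb : ∀ᵐ p ∂((gue (k + 1) η).prod (stateLaw m (k + 1))), O φ p.1 p.2 ∈ Set.Icc (0 : ℝ) 2 := by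
    filter_upwards [ae_apparatus m k hη] with p hp using h.mem_Icc φ hp.1 hp.2
  refine ⟨integral_nonneg_of_ae (hb.mono fun p hp => hp.1), ?_⟩
  calc apparatusMean m O η φ ≤ ∫ _, (2 : ℝ) ∂((gue (k + 1) η).prod (stateLaw m (k + 1))) :=
        integral_mono_ae (h.integrable_apparatus m hη φ) (integrable_const _) (hb.mono fun p hp => hp.2)
    _ = 2 := by simp

theorem apparatusMean_eq (h : IsApparatusObservable O F) (m : StateMeasure) {η : ℝ} (hη : 0 < η)
    (φ : ℝ) : apparatusMean m O η φ = ∫ x, ∫ s, O φ (fromSpectral s)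
      (Matrix.diagonal fun i => (x i : ℂ)) ∂(gueSpectral (k + 1) η) ∂(stateLevels m (k + 1)) := by
  have := isProbabilityMeasure_gueSpectral (k + 1) hη
  have hf := (continuous_fromSpectral (k + 1)).measurable
  have hO : Continuous fun p : Mat (k + 1) × Mat (k + 1) => O φ p.1 p.2 :=
    h.continuous.comp (continuous_const.prodMk continuous_id)
  have hi := h.integrable_apparatus m hη φ
  have hmap : (gue (k + 1) η).prod (stateLaw m (k + 1)) =
      ((gueSpectral (k + 1) η).prod ((stateLevels m (k + 1)).prod (haarU (k + 1)))).map
        (Prod.map fromSpectral fromSpectral) :=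
    Measure.map_prod_map _ _ hf hf
  unfold apparatusMean
  rw [hmap] at hi ⊢
  rw [integrable_map_measure hO.aestronglyMeasurable (hf.prodMap hf).aemeasurable,
    Function.comp_def] at hi
  rw [integral_map (hf.prodMap hf).aemeasurable hO.aestronglyMeasurable, integral_prod_symm _ hi]
  have hinner (p : (Fin (k + 1) → ℝ) × UMat (k + 1)) :
      ∫ s, O φ (Prod.map fromSpectral fromSpectral (s, p)).1
        (Prod.map fromSpectral fromSpectral (s, p)).2 ∂(gueSpectral (k + 1) η) =
      ∫ s, O φ (fromSpectral s) (Matrix.diagonal fun i => (p.1 i : ℂ)) ∂(gueSpectral (k + 1) η) :=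
    h.integral_gueSpectral_fromSpectral φ hη p.1 p.2
  simp_rw [hinner]
  rw [integral_fun_fst (f := fun x : Fin (k + 1) → ℝ => ∫ s, O φ (fromSpectral s)
    (Matrix.diagonal fun i => (x i : ℂ)) ∂(gueSpectral (k + 1) η))]
  simp

theorem tendsto_apparatusMean (h : IsApparatusObservable O F) (m : StateMeasure) :
    Tendsto (apparatusMean m O 1) (cocompact ℝ) (𝓝 (∫ x, F x ∂(stateLevels m (k + 1)))) := by
  have := isProbabilityMeasure_gueSpectral (k + 1) one_pos
  -- Dominated convergence along a filter requires it to be countably generated.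
  have : (cocompact ℝ).IsCountablyGenerated := by rw [cocompact_eq_atBot_atTop]; infer_instance
  rw [funext (h.apparatusMean_eq m one_pos)]
  have hc (φ : ℝ) : Continuous fun p : (Fin (k + 1) → ℝ) × ((Fin (k + 1) → ℝ) × UMat (k + 1)) =>
      O φ (fromSpectral p.2) (Matrix.diagonal fun i => (p.1 i : ℂ)) :=
    h.continuous.comp (continuous_const.prodMk (((continuous_fromSpectral _).comp continuous_snd).prodMk
      (Continuous.matrix_diagonal (by fun_prop))))
  refine tendsto_integral_filter_of_dominated_convergence (fun _ => 2) ?_ ?_ (integrable_const _) ?_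
  · exact Eventually.of_forall fun φ =>
      ((hc φ).stronglyMeasurable.integral_prod_right' (ν := gueSpectral (k + 1) 1)).aestronglyMeasurable
  · refine Eventually.of_forall fun φ => ?_
    filter_upwards [ae_stateLevels m k] with x hx
    refine (norm_integral_le_of_norm_le_const (C := 2) (ae_of_all _ fun s => ?_)).trans (by simp)
    have := h.mem_diagonal φ (fromSpectral s) x (isHermitian_fromSpectral s) ⟨fun i => (hx.1 i).le, hx.2⟩
    rw [Real.norm_of_nonneg this.1]
    exact this.2
  · filter_upwards [ae_stateLevels m k] with x hx
    exact h.tendsto x ⟨fun i => (hx.1 i).le, hx.2⟩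

theorem apparatusMean_scale (h : IsApparatusObservable O F) (m : StateMeasure) {η : ℝ} (hη : 0 < η)
    (φ : ℝ) : apparatusMean m O η φ = apparatusMean m O 1 ((√η)⁻¹ * φ) := by
  have i1 := isProbabilityMeasure_gueLevels (k + 1) one_pos
  have i2 := isProbabilityMeasure_gue (k + 1) one_pos
  have hf := (continuous_fromSpectral (k + 1)).measurable
  have hs : Measurable fun x : Fin (k + 1) → ℝ => (√η)⁻¹ • x := by fun_prop
  have hS : Measurable fun B : Mat (k + 1) => (√η)⁻¹ • B :=
    (continuous_const_smul (T := Mat (k + 1)) (√η)⁻¹).measurable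
  have hgue : gue (k + 1) η = (gue (k + 1) 1).map fun B => (√η)⁻¹ • B := by
    have : gueSpectral (k + 1) η = (gueSpectral (k + 1) 1).map (Prod.map (fun x => (√η)⁻¹ • x) id) := by
      unfold gueSpectral
      rw [gueLevels_eq_map _ hη]
      conv_lhs => rw [← Measure.map_id (μ := haarU (k + 1))]
      exact Measure.map_prod_map _ _ hs measurable_id
    unfold gue
    rw [this, Measure.map_map hf (hs.prodMap measurable_id), Measure.map_map hS hf]
    congr 1
    ext1 ⟨b, W⟩
    exact fromSpectral_smul _ b W
  have hmap : (gue (k + 1) η).prod (stateLaw m (k + 1)) =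
      ((gue (k + 1) 1).prod (stateLaw m (k + 1))).map (Prod.map (fun B => (√η)⁻¹ • B) id) := by
    rw [hgue]
    conv_lhs => rw [← Measure.map_id (μ := stateLaw m (k + 1))]
    exact Measure.map_prod_map _ _ hS measurable_id
  have hO : Continuous fun p : Mat (k + 1) × Mat (k + 1) => O φ p.1 p.2 :=
    h.continuous.comp (continuous_const.prodMk continuous_id)
  unfold apparatusMean
  rw [hmap, integral_map (hS.prodMap measurable_id).aemeasurable hO.aestronglyMeasurable]
  simp only [Prod.map, id, h.smul]

/-! ### Averages over all apparatuses and the system -/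

variable {dS N : ℕ}

theorem ae_config (m : StateMeasure) (k : ℕ) {ηS ηE : ℝ} (hS : 0 < ηS) (hE : 0 < ηE) :
    ∀ᵐ ω ∂(configLaw m (k + 1) dS N ηS ηE),
      ∀ l, (ω.2 l).1.IsHermitian ∧ (ω.2 l).2 ∈ densitySet (k + 1) := by
  have i1 := isProbabilityMeasure_gue (k + 1) hE
  have i2 := isProbabilityMeasure_gueSpectral dS hS
  refine Measure.quasiMeasurePreserving_snd.ae (p := fun x : Fin N → Mat (k + 1) × Mat (k + 1) =>
    ∀ l, (x l).1.IsHermitian ∧ (x l).2 ∈ densitySet (k + 1)) ?_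
  rw [ae_all_iff]
  intro l
  exact (Measure.quasiMeasurePreserving_eval
    (fun _ : Fin N => (gue (k + 1) ηE).prod (stateLaw m (k + 1))) l).ae (ae_apparatus m k hE)

theorem isProbabilityMeasure_configLaw (m : StateMeasure) (k : ℕ) {ηS ηE : ℝ} (hS : 0 < ηS)
    (hE : 0 < ηE) : IsProbabilityMeasure (configLaw m (k + 1) dS N ηS ηE) := by
  have i1 := isProbabilityMeasure_gue (k + 1) hE
  have i2 := isProbabilityMeasure_gueSpectral dS hS
  unfold configLaw
  infer_instance

theorem ae_prod_nonneg (h : IsApparatusObservable O F) (m : StateMeasure) (i j : Fin dS) (t : ℝ)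
    {ηS ηE : ℝ} (hS : 0 < ηS) (hE : 0 < ηE) : ∀ᵐ ω ∂(configLaw m (k + 1) dS N ηS ηE),
      0 ≤ ∏ l, O ((ω.1.1 i - ω.1.1 j) * t) (ω.2 l).1 (ω.2 l).2 := by
  filter_upwards [ae_config m k hS hE] with ω hω
  exact Finset.prod_nonneg fun l _ => (h.mem_Icc _ (hω l).1 (hω l).2).1

theorem integrable_prod (h : IsApparatusObservable O F) (m : StateMeasure) (i j : Fin dS) (t : ℝ)
    {ηS ηE : ℝ} (hS : 0 < ηS) (hE : 0 < ηE) :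
    Integrable (fun ω : Config (k + 1) dS N => ∏ l, O ((ω.1.1 i - ω.1.1 j) * t) (ω.2 l).1 (ω.2 l).2)
      (configLaw m (k + 1) dS N ηS ηE) := by
  have := isProbabilityMeasure_configLaw (dS := dS) (N := N) m k hS hE
  refine Integrable.of_bound (Continuous.aestronglyMeasurable ?_) (2 ^ N) ?_
  · refine continuous_finsetProd _ fun l _ => ?_
    have h1 : Continuous fun ω : Config (k + 1) dS N => (ω.1.1 i - ω.1.1 j) * t := by fun_prop
    have h2 : Continuous fun ω : Config (k + 1) dS N => ω.2 l :=
      (continuous_apply l).comp continuous_snd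
    exact h.continuous.comp (h1.prodMk h2)
  · filter_upwards [ae_config m k hS hE] with ω hω
    have hb := fun l => h.mem_Icc ((ω.1.1 i - ω.1.1 j) * t) (hω l).1 (hω l).2
    rw [Real.norm_of_nonneg (Finset.prod_nonneg fun l _ => (hb l).1)]
    exact (Finset.prod_le_prod (fun l _ => (hb l).1) fun l _ => (hb l).2).trans (by simp)

/-- The average over the levels of the system, in rescaled time. -/
def rescaledMean (m : StateMeasure) {n : ℕ} (O : ℝ → Mat n → Mat n → ℝ) {dS : ℕ} (N : ℕ) (i j : Fin dS)
    (r : ℝ) : ℝ :=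
  ∫ a, apparatusMean m O 1 ((a i - a j) * r) ^ N ∂(gueLevels dS 1)

theorem measurable_apparatusMean (h : IsApparatusObservable O F) (m : StateMeasure) {η : ℝ} (hη : 0 < η) :
    Measurable (apparatusMean m O η) := by
  have := isProbabilityMeasure_gue (k + 1) hη
  exact (h.continuous.stronglyMeasurable.integral_prod_right'
    (ν := (gue (k + 1) η).prod (stateLaw m (k + 1)))).measurable

/-- Given the levels of `A`, independence turns the product into an $N$-th power; the two rescalings
merge into $t/\sqrt{\eta_S\eta_E}$. -/
theorem integral_prod_eq_rescaledMean (h : IsApparatusObservable O F) (m : StateMeasure) (i j : Fin dS)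
    (t : ℝ) {ηS ηE : ℝ} (hS : 0 < ηS) (hE : 0 < ηE) :
    ∫ ω : Config (k + 1) dS N, ∏ l, O ((ω.1.1 i - ω.1.1 j) * t) (ω.2 l).1 (ω.2 l).2
      ∂(configLaw m (k + 1) dS N ηS ηE) = rescaledMean m O N i j (t / √(ηS * ηE)) := by
  have i1 := isProbabilityMeasure_gue (k + 1) hE
  have i2 := isProbabilityMeasure_gueSpectral dS hS
  have i3 := isProbabilityMeasure_gueLevels dS hS
  have hint := h.integrable_prod (N := N) m i j t hS hE
  unfold configLaw at hint ⊢
  rw [integral_prod _ hint]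
  have hpow (s : (Fin dS → ℝ) × UMat dS) : ∫ x : Fin N → Mat (k + 1) × Mat (k + 1),
      ∏ l, O ((s.1 i - s.1 j) * t) (x l).1 (x l).2
        ∂(Measure.pi fun _ : Fin N => (gue (k + 1) ηE).prod (stateLaw m (k + 1))) =
      apparatusMean m O 1 ((√ηE)⁻¹ * ((s.1 i - s.1 j) * t)) ^ N := by
    rw [integral_fintype_prod_eq_pow (fun p : Mat (k + 1) × Mat (k + 1) =>
      O ((s.1 i - s.1 j) * t) p.1 p.2), Fintype.card_fin, ← h.apparatusMean_scale m hE]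
    rfl
  simp_rw [hpow]
  have hmeas : Measurable fun a : Fin dS → ℝ =>
      apparatusMean m O 1 ((√ηE)⁻¹ * ((a i - a j) * t)) ^ N :=
    ((h.measurable_apparatusMean m one_pos).comp (by fun_prop)).pow_const N
  unfold gueSpectral
  rw [integral_fun_fst (f := fun a : Fin dS → ℝ =>
    apparatusMean m O 1 ((√ηE)⁻¹ * ((a i - a j) * t)) ^ N), probReal_univ, one_smul,
    gueLevels_eq_map _ hS, integral_map (by fun_prop) hmeas.aestronglyMeasurable]
  unfold rescaledMean
  refine integral_congr_ae (ae_of_all _ fun a => ?_)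
  simp only [Pi.smul_apply, smul_eq_mul]
  congr 2
  rw [Real.sqrt_mul hS.le, div_eq_mul_inv, mul_inv]
  ring

/-- Almost surely $a_i\ne a_j$, so the phase leaves every compact set as time grows; dominated
convergence with bound $2^N$ concludes. -/
theorem tendsto_rescaledMean (h : IsApparatusObservable O F) (m : StateMeasure) {i j : Fin dS}
    (hij : i ≠ j) :
    Tendsto (rescaledMean m O N i j) atTop (𝓝 ((∫ x, F x ∂(stateLevels m (k + 1))) ^ N)) := by
  have i1 := isProbabilityMeasure_gueLevels dS one_pos
  have hconst : (∫ x, F x ∂(stateLevels m (k + 1))) ^ N =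
      ∫ _ : Fin dS → ℝ, (∫ x, F x ∂(stateLevels m (k + 1))) ^ N ∂(gueLevels dS 1) := by simp
  rw [hconst]
  refine tendsto_integral_filter_of_dominated_convergence (fun _ => 2 ^ N) ?_ ?_ (integrable_const _) ?_
  · exact Eventually.of_forall fun r => (((h.measurable_apparatusMean m one_pos).comp
      (by fun_prop)).pow_const N).aestronglyMeasurable
  · refine Eventually.of_forall fun r => ae_of_all _ fun a => ?_
    have hb := h.apparatusMean_mem_Icc m one_pos ((a i - a j) * r)
    rw [Real.norm_of_nonneg (pow_nonneg hb.1 N)]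
    exact pow_le_pow_left₀ hb.1 hb.2 N
  · filter_upwards [ae_gueLevels_ne 1 hij] with a ha
    refine ((h.tendsto_apparatusMean m).comp ?_).pow N
    have := (isClosedEmbedding_smul_left (𝕜 := ℝ) (sub_ne_zero.mpr ha)).tendsto_cocompact
    refine (this.mono_left atTop_le_cocompact).congr fun r => ?_
    rw [smul_eq_mul, mul_comm]

end IsApparatusObservable

/-! ### The long-time values -/

theorem meanPurity_eq (m : StateMeasure) (k : ℕ) : meanPurity m (k + 1) = meanSumSq m (k + 1) := by
  have hp : Continuous (purity (n := k + 1)) :=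
    Complex.continuous_re.comp (continuous_id.mul continuous_id).matrix_trace
  unfold meanPurity stateLaw meanSumSq
  rw [integral_map (continuous_fromSpectral _).measurable.aemeasurable hp.aestronglyMeasurable]
  simp_rw [purity_fromSpectral]
  rw [integral_fun_fst (f := fun x : Fin (k + 1) → ℝ => ∑ i, x i ^ 2)]
  simp

theorem decoherenceFloor_eq (m : StateMeasure) (k : ℕ) :
    decoherenceFloor m (k + 1) =
      ∫ x, (1 + ∑ i, x i ^ 2) / (((k + 1 : ℕ) : ℝ) + 1) ∂(stateLevels m (k + 1)) := by
  rw [integral_div, integral_add (integrable_const _) (integrable_sum_sq m k), decoherenceFloor,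
    meanPurity_eq, meanSumSq]
  simp

theorem superFidelityFloor_eq (m : StateMeasure) (k : ℕ) :
    superFidelityFloor m (k + 1) = ∫ x, ((1 + ∑ i, x i ^ 2) / (((k + 1 : ℕ) : ℝ) + 1) +
      (1 - ∑ i, x i ^ 2)) ∂(stateLevels m (k + 1)) := by
  have h := integrable_sum_sq m k
  have h1 : Integrable (fun x : Fin (k + 1) → ℝ => (1 + ∑ i, x i ^ 2) / (((k + 1 : ℕ) : ℝ) + 1))
      (stateLevels m (k + 1)) := ((integrable_const 1).add h).div_const _
  have h2 : Integrable (fun x : Fin (k + 1) → ℝ => 1 - ∑ i, x i ^ 2) (stateLevels m (k + 1)) :=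
    (integrable_const 1).sub h
  rw [integral_add h1 h2, integral_sub (integrable_const _) h]
  have := decoherenceFloor_eq m k
  rw [decoherenceFloor] at this
  rw [superFidelityFloor, this, meanPurity_eq, meanSumSq]
  simp
  ring

/-- Since $\tau=\sqrt{\eta_S\eta_E}/\sqrt{8Nd_SD}$, the condition $t\ge s\tau$ is a lower bound on
$t/\sqrt{\eta_S\eta_E}$ free of the scale factors. Positivity of `D` matters: otherwise the inverse
square root would be $0$. -/
theorem longTimeLimit_of_tendsto {J : ℝ → ℝ} {L : ℝ} (hJ : Tendsto J atTop (𝓝 L)) {N dS : ℕ} {D : ℝ}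
    (hN : 1 ≤ N) (hdS : 1 ≤ dS) (hD : 0 < D) {f : ℝ → ℝ → ℝ → ℝ}
    (hf : ∀ ηS > 0, ∀ ηE > 0, ∀ t, f ηS ηE t = J (t / √(ηS * ηE))) :
    LongTimeLimit f (fun ηS ηE => (√(8 * (ηS * ηE)⁻¹ * N * dS * D))⁻¹) L := by
  intro ε hε
  have h := Metric.tendsto_atTop.mp hJ ε hε
  obtain ⟨R, hR⟩ := h
  have hc : 0 < 8 * (N : ℝ) * dS * D := by
    have h1 : (0 : ℝ) < N := by exact_mod_cast hN
    have h2 : (0 : ℝ) < dS := by exact_mod_cast hdS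
    positivity
  have hsc := Real.sqrt_pos.mpr hc
  -- `R` is the threshold in rescaled time; the maximum with $1$ keeps `s` positive.
  refine ⟨max R 1 * √(8 * N * dS * D), by positivity, fun ηS hS ηE hE t ht => ?_⟩
  rw [hf ηS hS ηE hE t]
  have hη : 0 < √(ηS * ηE) := Real.sqrt_pos.mpr (mul_pos hS hE)
  have hτ : (√(8 * (ηS * ηE)⁻¹ * N * dS * D))⁻¹ = √(ηS * ηE) / √(8 * N * dS * D) := by
    rw [show 8 * (ηS * ηE)⁻¹ * N * dS * D = (8 * N * dS * D) * (ηS * ηE)⁻¹ by ring,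
      Real.sqrt_mul hc.le, Real.sqrt_inv, mul_inv, inv_inv, mul_comm, div_eq_mul_inv]
  beta_reduce at ht
  rw [hτ] at ht
  have ht' : R ≤ t / √(ηS * ηE) := by
    rw [le_div_iff₀ hη]
    refine le_trans ?_ ht
    rw [mul_assoc, mul_div_cancel₀ _ hsc.ne']
    exact mul_le_mul_of_nonneg_right (le_max_left _ _) hη.le
  have := hR _ ht'
  rw [Real.dist_eq] at this
  exact this.le

theorem LongTimeLimit.longTimeBound {f : ℝ → ℝ → ℝ → ℝ} {τ : ℝ → ℝ → ℝ} {L M : ℝ}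
    (h : LongTimeLimit f τ L) (hLM : L < M) (h0 : ∀ ηS > 0, ∀ ηE > 0, ∀ t, 0 ≤ f ηS ηE t) :
    LongTimeBound f τ M := by
  obtain ⟨s, hs, hb⟩ := h (M - L) (sub_pos.mpr hLM)
  refine ⟨s, hs, fun ηS hS ηE hE t ht => ⟨h0 ηS hS ηE hE t, ?_⟩⟩
  have := (abs_le.mp (hb ηS hS ηE hE t ht)).2
  linarith

theorem LongTimeBound.mono {f : ℝ → ℝ → ℝ → ℝ} {τ : ℝ → ℝ → ℝ} {M M' : ℝ}
    (h : LongTimeBound f τ M) (hM : M ≤ M') : LongTimeBound f τ M' := by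
  obtain ⟨s, hs, hb⟩ := h
  exact ⟨s, hs, fun ηS hS ηE hE t ht => ⟨(hb ηS hS ηE hE t ht).1, (hb ηS hS ηE hE t ht).2.trans hM⟩⟩

theorem decoherenceVar_eq {d dS N : ℕ} (i j : Fin dS) (t : ℝ) :
    decoherenceVar (d := d) (N := N) i j t =
      fun ω => ∏ l, decoherenceObs ((ω.1.1 i - ω.1.1 j) * t) (ω.2 l).1 (ω.2 l).2 := rfl

theorem superFidelityVar_eq {d dS N : ℕ} (i j : Fin dS) (t : ℝ) :
    superFidelityVar (d := d) (N := N) i j t =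
      fun ω => ∏ l, fidelityObs ((ω.1.1 i - ω.1.1 j) * t) (ω.2 l).1 (ω.2 l).2 := by
  ext ω
  simp only [superFidelityVar, macroSuperFidelity, superFidelity_condState]

/-! ### Bounds on the mean purity and on the long-time values -/

theorem meanPurity_bounds (m : StateMeasure) {d : ℕ} (hd : 2 ≤ d) :
    2 * (d : ℝ) ≤ ((d : ℝ) ^ 2 + 2) * meanPurity m d ∧
      ((d : ℝ) ^ 2 + 2) * meanPurity m d ≤ 3 * d ∧ meanPurity m d ≤ 1 := by
  obtain ⟨k, rfl⟩ : ∃ k, d = k + 1 := ⟨d - 1, by omega⟩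
  rw [meanPurity_eq]
  have h := meanSumSq_bounds m (n := k + 1) (by omega)
  exact ⟨h.1, h.2, meanSumSq_le_one m (by omega)⟩

theorem meanPurity_pos (m : StateMeasure) {d : ℕ} (hd : 2 ≤ d) : 0 < meanPurity m d := by
  have h := (meanPurity_bounds m hd).1
  have hd' : (2 : ℝ) ≤ d := by exact_mod_cast hd
  by_contra! hneg
  nlinarith

theorem sub_meanPurity_pos (m : StateMeasure) {d : ℕ} (hd : 2 ≤ d) : 0 < (d : ℝ) - meanPurity m d := by
  have h := (meanPurity_bounds m hd).2.2
  have hd' : (2 : ℝ) ≤ d := by exact_mod_cast hd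
  linarith

/-- The lower purity bound gives $(d^2-2)/(d^2+2)$, which is increasing in $d$ and equals $1/3$ at
$d=2$. -/
theorem one_third_le_mul_meanPurity_sub_one (m : StateMeasure) {d : ℕ} (hd : 2 ≤ d) :
    1 / 3 ≤ (d : ℝ) * meanPurity m d - 1 := by
  have h := (meanPurity_bounds m hd).1
  have hd' : (2 : ℝ) ≤ d := by exact_mod_cast hd
  have h2 : (d : ℝ) * (2 * d) ≤ d * (((d : ℝ) ^ 2 + 2) * meanPurity m d) :=
    mul_le_mul_of_nonneg_left h (by linarith)
  by_contra! hneg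
  nlinarith

theorem decoherenceFloor_nonneg (m : StateMeasure) {d : ℕ} (hd : 2 ≤ d) : 0 ≤ decoherenceFloor m d := by
  have := meanPurity_pos m hd
  unfold decoherenceFloor
  positivity

/-- $P\le 3/d$ gives a floor of at most $(1+3/d)/d$, and $1+3/d<1+4/d\le e^{4/d}$. -/
theorem decoherenceFloor_lt_sharp (m : StateMeasure) {d : ℕ} (hd : 2 ≤ d) :
    decoherenceFloor m d < Real.exp (-(Real.log d - 4 / d)) := by
  have hP := meanPurity_pos m hd
  obtain ⟨-, h, -⟩ := meanPurity_bounds m hd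
  have hd' : (2 : ℝ) ≤ d := by exact_mod_cast hd
  have hd0 : (0 : ℝ) < d := by linarith
  rw [neg_sub, Real.exp_sub, Real.exp_log hd0]
  have h3 : meanPurity m d ≤ 3 / d := by
    rw [le_div_iff₀ hd0]
    nlinarith
  have hexp : 1 + 4 / d ≤ Real.exp (4 / d) := by linarith [Real.add_one_le_exp (4 / (d : ℝ))]
  have h34 : 3 / (d : ℝ) < 4 / d := div_lt_div_of_pos_right (by norm_num) hd0
  unfold decoherenceFloor
  calc (1 + meanPurity m d) / (d + 1) ≤ (1 + meanPurity m d) / d := by gcongr; linarith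
    _ < Real.exp (4 / d) / d := div_lt_div_of_pos_right (by linarith) hd0

/-- With only $P\le1$ the floor is at most $2/(d+1)<d^{-1/2}$, as $(\sqrt d-1)^2>0$. The exponent
$1/9$ is weaker than $1/2$, to share one constant with the super-fidelity. -/
theorem decoherenceFloor_lt (m : StateMeasure) {d : ℕ} (hd : 2 ≤ d) :
    decoherenceFloor m d < Real.exp (-(1 / 9 * Real.log d)) := by
  obtain ⟨-, -, h⟩ := meanPurity_bounds m hd
  have hd' : (2 : ℝ) ≤ d := by exact_mod_cast hd
  have hd0 : (0 : ℝ) < d := by linarith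
  have hlog : 0 ≤ Real.log d := Real.log_nonneg (by linarith)
  have hs : 0 < √(d : ℝ) := Real.sqrt_pos.mpr hd0
  have hs1 : 1 < √(d : ℝ) := by rw [Real.lt_sqrt (by norm_num)]; linarith
  have hsq := Real.sq_sqrt hd0.le
  have h1 : (√(d : ℝ))⁻¹ ≤ Real.exp (-(1 / 9 * Real.log d)) := by
    have : (√(d : ℝ))⁻¹ = Real.exp (-(1 / 2 * Real.log d)) := by
      rw [Real.exp_neg, Real.sqrt_eq_rpow, Real.rpow_def_of_pos hd0, mul_comm]
    rw [this]
    exact Real.exp_le_exp.mpr (by linarith)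
  refine lt_of_lt_of_le ?_ h1
  unfold decoherenceFloor
  rw [div_lt_iff₀ (by positivity), inv_mul_eq_div, lt_div_iff₀ hs]
  nlinarith

theorem superFidelityFloor_eq_one_sub (m : StateMeasure) (d : ℕ) :
    superFidelityFloor m d = 1 - (d * meanPurity m d - 1) / (d + 1) := by
  unfold superFidelityFloor
  have : (d : ℝ) + 1 ≠ 0 := by positivity
  field_simp
  ring

theorem superFidelityFloor_nonneg (m : StateMeasure) {d : ℕ} (hd : 2 ≤ d) :
    0 ≤ superFidelityFloor m d := by
  have := meanPurity_pos m hd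
  have h1 := (meanPurity_bounds m hd).2.2
  unfold superFidelityFloor
  have : 0 ≤ 1 - meanPurity m d := by linarith
  positivity

/-- By $1-u\le e^{-u}$ it suffices that $(dP-1)/(d+1)$ exceeds $(d-4)/d^2$; this follows from
$dP-1\ge(d^2-2)/(d^2+2)$. -/
theorem superFidelityFloor_lt_sharp (m : StateMeasure) {d : ℕ} (hd : 2 ≤ d) :
    superFidelityFloor m d < Real.exp (-(1 / d - 4 / (d : ℝ) ^ 2)) := by
  obtain ⟨h, -, -⟩ := meanPurity_bounds m hd
  have hd' : (2 : ℝ) ≤ d := by exact_mod_cast hd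
  have hd0 : (0 : ℝ) < d := by linarith
  rw [superFidelityFloor_eq_one_sub]
  refine lt_of_lt_of_le ?_ (Real.add_one_le_exp _)
  have h2 : (d : ℝ) * (2 * d) ≤ d * (((d : ℝ) ^ 2 + 2) * meanPurity m d) :=
    mul_le_mul_of_nonneg_left h hd0.le
  have h3 : ((d : ℝ) ^ 2 - 2) / (d ^ 2 + 2) ≤ d * meanPurity m d - 1 := by
    rw [div_le_iff₀ (by positivity)]
    linarith
  have h4 : 1 / (d : ℝ) - 4 / d ^ 2 < (((d : ℝ) ^ 2 - 2) / (d ^ 2 + 2)) / (d + 1) := by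
    rw [div_div, show 1 / (d : ℝ) - 4 / d ^ 2 = (d - 4) / d ^ 2 by field_simp,
      div_lt_div_iff₀ (by positivity) (by positivity)]
    nlinarith [pow_pos hd0 3, pow_pos hd0 2]
  have h5 : (((d : ℝ) ^ 2 - 2) / (d ^ 2 + 2)) / (d + 1) ≤ (d * meanPurity m d - 1) / (d + 1) := by
    gcongr
  linarith

/-- $dP-1\ge1/3$ and $d+1<3d$ give $(dP-1)/(d+1)>1/(9d)$, the origin of the constant $1/9$. -/
theorem superFidelityFloor_lt (m : StateMeasure) {d : ℕ} (hd : 2 ≤ d) :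
    superFidelityFloor m d < Real.exp (-(1 / 9 / d)) := by
  have h := one_third_le_mul_meanPurity_sub_one m hd
  have hd' : (2 : ℝ) ≤ d := by exact_mod_cast hd
  have hd0 : (0 : ℝ) < d := by linarith
  rw [superFidelityFloor_eq_one_sub]
  refine lt_of_lt_of_le ?_ (Real.add_one_le_exp _)
  have h1 : (1 / 3) / ((d : ℝ) + 1) ≤ (d * meanPurity m d - 1) / (d + 1) := by gcongr
  have h2 : 1 / 9 / (d : ℝ) < (1 / 3) / (d + 1) := by
    rw [div_lt_div_iff₀ hd0 (by positivity)]
    linarith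
  linarith

theorem pow_lt_exp_neg_nat_mul {L u : ℝ} {N : ℕ} (hN : 1 ≤ N) (hL : 0 ≤ L) (h : L < Real.exp (-u)) :
    L ^ N < Real.exp (-(N * u)) := by
  rw [← mul_neg, Real.exp_nat_mul]
  exact pow_lt_pow_left₀ h hL (by omega)

/-! ### Long-time limits of the averages -/

section Averages

variable (m : StateMeasure) {d dS N : ℕ} {i j : Fin dS}

theorem integrable_decoherenceVar (hd : 2 ≤ d) (i j : Fin dS) {ηS ηE : ℝ} (hS : 0 < ηS) (hE : 0 < ηE)
    (t : ℝ) : Integrable (decoherenceVar (d := d) (N := N) i j t) (configLaw m d dS N ηS ηE) := by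
  obtain ⟨k, rfl⟩ : ∃ k, d = k + 1 := ⟨d - 1, by omega⟩
  exact (isApparatusObservable_decoherenceObs (k + 1)).integrable_prod m i j t hS hE

theorem integrable_superFidelityVar (hd : 2 ≤ d) (i j : Fin dS) {ηS ηE : ℝ} (hS : 0 < ηS) (hE : 0 < ηE)
    (t : ℝ) : Integrable (superFidelityVar (d := d) (N := N) i j t) (configLaw m d dS N ηS ηE) := by
  obtain ⟨k, rfl⟩ : ∃ k, d = k + 1 := ⟨d - 1, by omega⟩
  rw [superFidelityVar_eq]
  exact (isApparatusObservable_fidelityObs (k + 1)).integrable_prod m i j t hS hE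

theorem avgDecoherence_nonneg (ηS ηE t : ℝ) : 0 ≤ avgDecoherence m d dS N i j ηS ηE t :=
  integral_nonneg fun ω => by
    rw [decoherenceVar_eq]
    exact Finset.prod_nonneg fun _ _ => sq_nonneg _

theorem avgSuperFidelity_nonneg (hd : 2 ≤ d) {ηS ηE : ℝ} (hS : 0 < ηS) (hE : 0 < ηE) (t : ℝ) :
    0 ≤ avgSuperFidelity m d dS N i j ηS ηE t := by
  obtain ⟨k, rfl⟩ : ∃ k, d = k + 1 := ⟨d - 1, by omega⟩
  unfold avgSuperFidelity
  rw [superFidelityVar_eq]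
  exact integral_nonneg_of_ae
    ((isApparatusObservable_fidelityObs (k + 1)).ae_prod_nonneg m i j t hS hE)

theorem longTimeLimit_avgDecoherence (hd : 2 ≤ d) (hN : 1 ≤ N) (hij : i ≠ j) :
    LongTimeLimit (avgDecoherence m d dS N i j) (tauDec m d dS N) (decoherenceFloor m d ^ N) := by
  have hD := sub_meanPurity_pos m hd
  obtain ⟨k, rfl⟩ : ∃ k, d = k + 1 := ⟨d - 1, by omega⟩
  have h := isApparatusObservable_decoherenceObs (k + 1)
  have hlim := h.tendsto_rescaledMean (N := N) m hij
  rw [← decoherenceFloor_eq] at hlim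
  exact longTimeLimit_of_tendsto hlim hN (Fin.pos i) hD fun ηS hS ηE hE t =>
    h.integral_prod_eq_rescaledMean m i j t hS hE

theorem longTimeLimit_avgSuperFidelity (hd : 2 ≤ d) (hN : 1 ≤ N) (hij : i ≠ j) :
    LongTimeLimit (avgSuperFidelity m d dS N i j) (tauFid m d dS N) (superFidelityFloor m d ^ N) := by
  have hD : 0 < (d : ℝ) * meanPurity m d - 1 := by
    linarith [one_third_le_mul_meanPurity_sub_one m hd]
  obtain ⟨k, rfl⟩ : ∃ k, d = k + 1 := ⟨d - 1, by omega⟩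
  have h := isApparatusObservable_fidelityObs (k + 1)
  have hlim := h.tendsto_rescaledMean (N := N) m hij
  rw [← superFidelityFloor_eq] at hlim
  refine longTimeLimit_of_tendsto hlim hN (Fin.pos i) hD fun ηS hS ηE hE t => ?_
  rw [avgSuperFidelity, superFidelityVar_eq]
  exact h.integral_prod_eq_rescaledMean m i j t hS hE

theorem longTimeBound_avgDecoherence (hd : 2 ≤ d) (hN : 1 ≤ N) (hij : i ≠ j) {u : ℝ}
    (hu : decoherenceFloor m d < Real.exp (-u)) :
    LongTimeBound (avgDecoherence m d dS N i j) (tauDec m d dS N) (Real.exp (-(N * u))) :=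
  (longTimeLimit_avgDecoherence m hd hN hij).longTimeBound
    (pow_lt_exp_neg_nat_mul hN (decoherenceFloor_nonneg m hd) hu)
    fun ηS _ ηE _ t => avgDecoherence_nonneg m ηS ηE t

theorem longTimeBound_avgSuperFidelity (hd : 2 ≤ d) (hN : 1 ≤ N) (hij : i ≠ j) {u : ℝ}
    (hu : superFidelityFloor m d < Real.exp (-u)) :
    LongTimeBound (avgSuperFidelity m d dS N i j) (tauFid m d dS N) (Real.exp (-(N * u))) :=
  (longTimeLimit_avgSuperFidelity m hd hN hij).longTimeBound
    (pow_lt_exp_neg_nat_mul hN (superFidelityFloor_nonneg m hd) hu)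
    fun _ hS _ hE t => avgSuperFidelity_nonneg m hd hS hE t

end Averages

end Measurement

end

theorem mainTheorem2 (m : Measurement.StateMeasure) :
    -- the averages are those of integrable quantities
    (∀ (d dS N : ℕ) (i j : Fin dS), 2 ≤ d → 1 ≤ N → i ≠ j →
      ∀ ηS > 0, ∀ ηE > 0, ∀ t : ℝ,
        Integrable (Measurement.decoherenceVar (d := d) (N := N) i j t)
            (Measurement.configLaw m d dS N ηS ηE) ∧
          Integrable (Measurement.superFidelityVar (d := d) (N := N) i j t)
            (Measurement.configLaw m d dS N ηS ηE)) ∧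
    -- at long times the averages tend to the powers of the single-apparatus noise floors
    (∀ (d dS N : ℕ) (i j : Fin dS), 2 ≤ d → 1 ≤ N → i ≠ j →
      Measurement.LongTimeLimit (Measurement.avgDecoherence m d dS N i j)
          (Measurement.tauDec m d dS N) (Measurement.decoherenceFloor m d ^ N) ∧
        Measurement.LongTimeLimit (Measurement.avgSuperFidelity m d dS N i j)
          (Measurement.tauFid m d dS N) (Measurement.superFidelityFloor m d ^ N)) ∧
    -- `O(exp(-N log d))` and `O(exp(-N / d))` with one constant for all parameters, as long as
    -- `N = O(d)` and `N = O(d²)` respectively (in particular for fixed `N`)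
    (∀ K : ℝ, ∃ C : ℝ, ∀ (d dS N : ℕ) (i j : Fin dS), 2 ≤ d → 1 ≤ N → i ≠ j →
      ((N : ℝ) ≤ K * d →
        Measurement.LongTimeBound (Measurement.avgDecoherence m d dS N i j)
          (Measurement.tauDec m d dS N) (C * Real.exp (-(N * Real.log d)))) ∧
      ((N : ℝ) ≤ K * (d : ℝ) ^ 2 →
        Measurement.LongTimeBound (Measurement.avgSuperFidelity m d dS N i j)
          (Measurement.tauFid m d dS N) (C * Real.exp (-(N / d))))) ∧
    -- for all parameters: the exponents are `-N log d` and `-N / d` to leading order in `d`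
    (∃ C : ℝ, ∀ (d dS N : ℕ) (i j : Fin dS), 2 ≤ d → 1 ≤ N → i ≠ j →
      Measurement.LongTimeBound (Measurement.avgDecoherence m d dS N i j)
          (Measurement.tauDec m d dS N) (Real.exp (-(N * (Real.log d - C / d)))) ∧
        Measurement.LongTimeBound (Measurement.avgSuperFidelity m d dS N i j)
          (Measurement.tauFid m d dS N) (Real.exp (-(N * (1 / d - C / (d : ℝ) ^ 2))))) ∧
    -- for all parameters: exponential decay in `N log d` and in `N / d`
    (∃ c > 0, ∀ (d dS N : ℕ) (i j : Fin dS), 2 ≤ d → 1 ≤ N → i ≠ j →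
      Measurement.LongTimeBound (Measurement.avgDecoherence m d dS N i j)
          (Measurement.tauDec m d dS N) (Real.exp (-(c * (N * Real.log d)))) ∧
        Measurement.LongTimeBound (Measurement.avgSuperFidelity m d dS N i j)
          (Measurement.tauFid m d dS N) (Real.exp (-(c * (N / d))))) := by
  refine ⟨fun d dS N i j hd _ _ ηS hS ηE hE t =>
      ⟨Measurement.integrable_decoherenceVar m hd i j hS hE t,
        Measurement.integrable_superFidelityVar m hd i j hS hE t⟩,
    fun d dS N i j hd hN hij => ⟨Measurement.longTimeLimit_avgDecoherence m hd hN hij,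
      Measurement.longTimeLimit_avgSuperFidelity m hd hN hij⟩,
    -- The error terms $4N/d$ and $4N/d^2$ of the sharp bounds are at most $4K$ in the respective
    -- ranges of `N`.
    fun K => ⟨Real.exp (4 * K), fun d dS N i j hd hN hij => ⟨fun hK => ?_, fun hK => ?_⟩⟩,
    ⟨4, fun d dS N i j hd hN hij =>
      ⟨Measurement.longTimeBound_avgDecoherence m hd hN hij (Measurement.decoherenceFloor_lt_sharp m hd),
        Measurement.longTimeBound_avgSuperFidelity m hd hN hij
          (Measurement.superFidelityFloor_lt_sharp m hd)⟩⟩,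
    ⟨1 / 9, by norm_num, fun d dS N i j hd hN hij => ⟨?_, ?_⟩⟩⟩
  · have hd0 : (0 : ℝ) < d := by exact_mod_cast (by omega : 0 < d)
    refine (Measurement.longTimeBound_avgDecoherence m hd hN hij
      (Measurement.decoherenceFloor_lt_sharp m hd)).mono ?_
    rw [← Real.exp_add, Real.exp_le_exp]
    have : (N : ℝ) * (4 / d) ≤ 4 * K := by
      rw [mul_div_assoc', div_le_iff₀ hd0]
      linarith
    linarith
  · have hd0 : (0 : ℝ) < (d : ℝ) ^ 2 := by
      have : (0 : ℝ) < d := by exact_mod_cast (by omega : 0 < d)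
      positivity
    refine (Measurement.longTimeBound_avgSuperFidelity m hd hN hij
      (Measurement.superFidelityFloor_lt_sharp m hd)).mono ?_
    rw [← Real.exp_add, Real.exp_le_exp]
    have h1 : (N : ℝ) * (4 / (d : ℝ) ^ 2) ≤ 4 * K := by
      rw [mul_div_assoc', div_le_iff₀ hd0]
      linarith
    have h2 : (N : ℝ) * (1 / d) = N / d := by ring
    rw [mul_sub, h2]
    linarith
  · rw [mul_left_comm]
    exact Measurement.longTimeBound_avgDecoherence m hd hN hij (Measurement.decoherenceFloor_lt m hd)
  · rw [mul_div_left_comm]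
    exact Measurement.longTimeBound_avgSuperFidelity m hd hN hij (Measurement.superFidelityFloor_lt m hd)
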